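/- Let $3\le p\le 5$ and let $u:\mathbb R^3\times\mathbb R\to\mathbb R$ be a global-in-time solution of the defocusing semilinear wave equation $\partial_t^2u-\Delta u=-|u|^{p-1}u$ in the energy class, that is, $(u,u_t)\in C(\mathbb R;\dot H^1(\mathbb R^3)\times L^2(\mathbb R^3))$, $u\in L^{2p/(p-3)}L^{2p}([a,b]\times\mathbb R^3)$ for every compact interval $[a,b]$ (time exponent $\infty$ if $p=3$), and the equation holds in the sense of distributions. Assume that the energy is finite: $$E=\int_{\mathbb R^3}\Big(\tfrac12|\nabla u(x,0)|^2+\tfrac12|u_t(x,0)|^2+\tfrac1{p+1}|u(x,0)|^{p+1}\Big)dx<\infty .$$ Write $\mathbf L_\pm u=\nabla u\cdot\frac{x}{|x|}+\frac{u}{|x|}\pm u_t$, let $\nabla_{\mathrm{tan}} u=\nabla u-\big(\nabla u\cdot\frac{x}{|x|}\big)\frac{x}{|x|}$ be the gradient along the spheres centred at the origin, and define the outward energy $E_+$ and the inward energy $E_-$ in an annulus by $$E_\pm(t;r_1,r_2)=\int_{r_1<|x|<r_2}\Big(\tfrac14|\mathbf L_\mp u(x,t)|^2+\tfrac14|\nabla_{\mathrm{tan}}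 u(x,t)|^2+\tfrac1{2(p+1)}|u(x,t)|^{p+1}\Big)dx .$$ Then for every $c\in(0,1)$, $$\lim_{t\to+\infty}E_+(t;0,c|t|)=0\qquad\text{and}\qquad\lim_{t\to-\infty}E_-(t;0,c|t|)=0 .$$ -/

import Mathlib

open Filter Topology MeasureTheory Set
open scoped ENNReal ContDiff

namespace SemilinearWave

noncomputable section

/-- Three-dimensional Euclidean space. -/
abbrev Space : Type := EuclideanSpace ℝ (Fin 3)

/-- `g` is the weak (distributional) gradient of `f` on `ℝ³`, both being locally integrable. -/
structure HasWeakGradient (f : Space → ℝ) (g : Space → Space) : Prop where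
  locallyIntegrable : LocallyIntegrable f volume
  locallyIntegrable_grad : LocallyIntegrable g volume
  integral_eq : ∀ ψ : Space → ℝ, ContDiff ℝ ∞ ψ → HasCompactSupport ψ → ∀ y : Space,
    ∫ x, f x * fderiv ℝ ψ x y = - ∫ x, inner ℝ (g x) y * ψ x

/-- `f` belongs to the homogeneous Sobolev space `Ḣ¹(ℝ³)`, realised as the space of
`L⁶` functions with square integrable weak gradient, and `g` is its weak gradient. -/
structure MemHomSobolevOne (f : Space → ℝ) (g : Space → Space) : Prop where
  memLp_six : MemLp f 6 volume
  memLp_grad : MemLp g 2 volume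
  hasWeakGradient : HasWeakGradient f g

/-- `u` is a solution, defined for all times and with `(u, u_t)` in the energy space, of
`∂ₜ² u - Δ u = - |u|^(p-1) u` on `ℝ³ × ℝ`; `Du` is its spatial gradient, `ut` its time derivative:

* `(u, ut)` is a continuous function of time with values in `Ḣ¹ × L²`;
* `u` belongs to `L^{2p/(p-3)} L^{2p}([a, b] × ℝ³)` for every compact time interval `[a, b]`
  (the time exponent is `∞` for `p = 3`);
* `∂ₜ u = ut` and `∂ₜ ut = Δ u - |u|^(p-1) u` when tested against `C_c^∞(ℝ³)`. -/
structure IsSolution (p : ℝ) (u : ℝ → Space → ℝ) (Du : ℝ → Space → Space)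
    (ut : ℝ → Space → ℝ) : Prop where
  memHomSobolevOne : ∀ t, MemHomSobolevOne (u t) (Du t)
  memLp_ut : ∀ t, MemLp (ut t) 2 volume
  continuous_Du : ∀ t, Tendsto (fun s => eLpNorm (Du s - Du t) 2 volume) (𝓝 t) (𝓝 0)
  continuous_ut : ∀ t, Tendsto (fun s => eLpNorm (ut s - ut t) 2 volume) (𝓝 t) (𝓝 0)
  spaceTimeNorm_lt_top : ∀ a b : ℝ,
    eLpNorm (fun t => eLpNorm (u t) (ENNReal.ofReal (2 * p)) volume)
      (ENNReal.ofReal (2 * p) / ENNReal.ofReal (p - 3)) (volume.restrict (Icc a b)) < ⊤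
  hasDerivAt_u : ∀ ψ : Space → ℝ, ContDiff ℝ ∞ ψ → HasCompactSupport ψ → ∀ t,
    HasDerivAt (fun s => ∫ x, u s x * ψ x) (∫ x, ut t x * ψ x) t
  hasDerivAt_ut : ∀ ψ : Space → ℝ, ContDiff ℝ ∞ ψ → HasCompactSupport ψ → ∀ t,
    HasDerivAt (fun s => ∫ x, ut s x * ψ x)
      (- (∫ x, fderiv ℝ ψ x (Du t x)) - ∫ x, |u t x| ^ (p - 1) * u t x * ψ x) t

/-- The energy `∫ (|∇f|²/2 + |h|²/2 + |f|^(p+1)/(p+1)) dx ∈ [0, ∞]` of a state `(f, h)`,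
where `g = ∇f`. -/
def energy (p : ℝ) (f : Space → ℝ) (g : Space → Space) (h : Space → ℝ) : ℝ≥0∞ :=
  ∫⁻ x, ENNReal.ofReal
    (1 / 2 * ‖g x‖ ^ 2 + 1 / 2 * |h x| ^ 2 + 1 / (p + 1) * |f x| ^ (p + 1))

/-- The unit radial vector `x / |x|`. -/
def radialDir (x : Space) : Space := ‖x‖⁻¹ • x

/-- `(𝐋₊ u)(x) = ∇u · x/|x| + u/|x| + u_t`, with `f = u`, `g = ∇u`, `h = u_t`. -/
def Lplus (f : Space → ℝ) (g : Space → Space) (h : Space → ℝ) (x : Space) : ℝ :=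
  inner ℝ (g x) (radialDir x) + f x / ‖x‖ + h x

/-- `(𝐋₋ u)(x) = ∇u · x/|x| + u/|x| - u_t`, with `f = u`, `g = ∇u`, `h = u_t`. -/
def Lminus (f : Space → ℝ) (g : Space → Space) (h : Space → ℝ) (x : Space) : ℝ :=
  inner ℝ (g x) (radialDir x) + f x / ‖x‖ - h x

/-- The gradient along the sphere centred at the origin through `x`: the component of the
gradient `g = ∇u` orthogonal to the radial direction. -/
def sphericalGrad (g : Space → Space) (x : Space) : Space :=
  g x - inner ℝ (g x) (radialDir x) • radialDir x

/-- The inward energy `E₋` in the region `S`, of a state with `f = u`, `g = ∇u`, `h = u_t`. -/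
def inwardEnergy (p : ℝ) (f : Space → ℝ) (g : Space → Space) (h : Space → ℝ)
    (S : Set Space) : ℝ≥0∞ :=
  ∫⁻ x in S, ENNReal.ofReal (1 / 4 * |Lplus f g h x| ^ 2 + 1 / 4 * ‖sphericalGrad g x‖ ^ 2
    + 1 / (2 * (p + 1)) * |f x| ^ (p + 1))

/-- The outward energy `E₊` in the region `S`, of a state with `f = u`, `g = ∇u`, `h = u_t`. -/
def outwardEnergy (p : ℝ) (f : Space → ℝ) (g : Space → Space) (h : Space → ℝ)
    (S : Set Space) : ℝ≥0∞ :=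
  ∫⁻ x in S, ENNReal.ofReal (1 / 4 * |Lminus f g h x| ^ 2 + 1 / 4 * ‖sphericalGrad g x‖ ^ 2
    + 1 / (2 * (p + 1)) * |f x| ^ (p + 1))

/-- The open annulus `{x : r₁ < |x| < r₂}`. -/
def annulus (r₁ r₂ : ℝ) : Set Space := {x | r₁ < ‖x‖ ∧ ‖x‖ < r₂}

end

end SemilinearWave

/-!
The outward energy can only grow: inward travelling waves turn into outward travelling ones, never
the converse. This is quantified by a monotonicity formula. For a smooth weight `f ≥ 0` vanishing
near `-∞` and such that `f + r f' ≥ 0` holds at distance `r` from the origin, the quantity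
`∫ f (t - |x|) e₊(x, t) dx` is nondecreasing in `t`, where `e₊` is the density of the outward
energy (`IsSolution.integral_outwardDensity_le`). The weights `f s = 1 - exp (l (s - t₁))`, cut off near
`-∞` by a nondecreasing function, are admissible for `t ≤ t₁` because they are concave and vanish
at `t₁`. They are close to `1` far from the origin but vanish at the origin as `t → t₁`. Comparing
a time `t₀` with the time `t₁` gives (`IsSolution.outwardEnergy_add_le`)

  `(1 - exp (-l (t₁ - t₀))) E₊(t₀) + exp (-l c t₁) E₊(t₁; 0, c t₁) ≤ E₊(t₁)`.

Let `S` be the supremum of `E₊` over positive times, which is finite by Hardy's inequality and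
conservation of energy. Take `l = K / t₁` and a time `t₀` with `E₊(t₀)` close to `S`. For `t₁ → ∞`
the inequality bounds `E₊(t₁; 0, c t₁)` by `exp (K c) (S - E₊(t₀)) + exp (-K (1 - c) / 2) S`,
which is small if `K` is chosen large first and `t₀` afterwards
(`IsSolution.tendsto_outwardEnergy`). The claim about `t → -∞` follows by reversing time, which
exchanges the outward and the inward energy.

The monotonicity formula is a flux identity for the multiplier `u_t - (∂_r u + u / r)`, whose
pointwise form is `densityRate_eq`. A parameter `a` joins it with the energy identity: for `a = 0`
the multiplier is `u_t`, and the same argument yields the monotonicity of the energy in regions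
that expand at the speed of light. Two regularisations are needed. The singularity at the origin
is removed by replacing `|x|` with `ρ = √(|x|² + δ²)`; this creates an error term of order
`δ u² / ρ²`, which Hardy's inequality controls (`le_production_one`), and `δ → 0` by dominated convergence
(`MemHomSobolevOne.tendsto_functional_one`). Since the solution is only of finite energy, the
identity is applied to its mollification in space (`IsSolution.functional_mollify_le`). The
commutator of the mollification with the nonlinearity tends to zero in `L¹_t L²_x`, because the
space-time norm of the solution is locally finite (`IsSolution.tendsto_lintegral_commutator`).
-/

namespace SemilinearWave

noncomputable section

/-! ### Mollification -/

/-- The `i`-th vector of the standard basis of `ℝ³`. -/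
def basisVec (i : Fin 3) : Space := EuclideanSpace.single i 1

/-- The `i`-th partial derivative of a function on `ℝ³`. -/
def pd (i : Fin 3) (f : Space → ℝ) (x : Space) : ℝ := fderiv ℝ f x (basisVec i)

/-- The convolution of `f` with the kernel `η`. -/
def mollify (η f : Space → ℝ) (x : Space) : ℝ := ∫ y, f y * η (x - y)

/-- Bump functions around the origin whose supports shrink to it. -/
def bump (n : ℕ) : ContDiffBump (0 : Space) where
  rIn := 1 / (2 * (n + 1))
  rOut := 1 / (n + 1)
  rIn_pos := by positivity
  rIn_lt_rOut := by
    rw [div_lt_div_iff₀ (by positivity) (by positivity)]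
    have : (0 : ℝ) < n + 1 := by positivity
    linarith

/-- A sequence of smooth, compactly supported probability densities concentrating at the
origin. -/
def mollifier (n : ℕ) : Space → ℝ := (bump n).normed volume

lemma contDiff_mollifier (n : ℕ) : ContDiff ℝ ∞ (mollifier n) :=
  (bump n).contDiff_normed (n := ⊤)

lemma hasCompactSupport_mollifier (n : ℕ) : HasCompactSupport (mollifier n) :=
  (bump n).hasCompactSupport_normed

lemma mollifier_nonneg (n : ℕ) (x : Space) : 0 ≤ mollifier n x := (bump n).nonneg_normed x

lemma integral_mollifier (n : ℕ) : ∫ x, mollifier n x = 1 := (bump n).integral_normed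

lemma contDiff_pd {f : Space → ℝ} (hf : ContDiff ℝ ∞ f) (i : Fin 3) : ContDiff ℝ ∞ (pd i f) :=
  (hf.fderiv_right (m := ∞) (by simp)).clm_apply contDiff_const

lemma hasCompactSupport_pd {f : Space → ℝ} (hf : HasCompactSupport f) (i : Fin 3) :
    HasCompactSupport (pd i f) :=
  (hf.fderiv ℝ).comp_left (g := fun L : Space →L[ℝ] ℝ => L (basisVec i)) (by simp)

lemma mollify_eq_convolution (η f : Space → ℝ) :
    mollify η f = convolution f η (ContinuousLinearMap.mul ℝ ℝ) volume := by
  ext x; rw [convolution_mul]; rfl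

lemma contDiff_mollify {η f : Space → ℝ} (hη : ContDiff ℝ ∞ η) (hc : HasCompactSupport η)
    (hf : LocallyIntegrable f volume) : ContDiff ℝ ∞ (mollify η f) := by
  rw [mollify_eq_convolution]
  exact hc.contDiff_convolution_right (n := ⊤) _ hf hη

lemma pd_mollify {η f : Space → ℝ} (hη : ContDiff ℝ ∞ η) (hc : HasCompactSupport η)
    (hf : LocallyIntegrable f volume) (i : Fin 3) :
    pd i (mollify η f) = mollify (pd i η) f := by
  ext x
  have h := hc.hasFDerivAt_convolution_right (ContinuousLinearMap.mul ℝ ℝ) hf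
    (hη.of_le (by simp)) x
  rw [pd, mollify_eq_convolution, h.fderiv,
    convolution_precompR_apply _ hf (hc.fderiv ℝ) (hη.continuous_fderiv (by simp)),
    mollify_eq_convolution]
  rfl

lemma continuous_mollify {η f : Space → ℝ} (hη : ContDiff ℝ ∞ η) (hc : HasCompactSupport η)
    (hf : LocallyIntegrable f volume) : Continuous (mollify η f) :=
  (contDiff_mollify hη hc hf).continuous

/-- The reflected translate `y ↦ η (x - y)` of a test function is a test function. -/
lemma contDiff_translate {η : Space → ℝ} (hη : ContDiff ℝ ∞ η) (x : Space) :
    ContDiff ℝ ∞ (fun y => η (x - y)) :=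
  hη.comp (contDiff_const.sub contDiff_id)

lemma hasCompactSupport_translate {η : Space → ℝ} (hc : HasCompactSupport η) (x : Space) :
    HasCompactSupport (fun y => η (x - y)) :=
  hc.comp_homeomorph (Homeomorph.subLeft x)

lemma integrable_mul_translate {η f : Space → ℝ} (hη : ContDiff ℝ ∞ η) (hc : HasCompactSupport η)
    (hf : LocallyIntegrable f volume) (x : Space) :
    Integrable (fun y => f y * η (x - y)) := by
  have := hf.integrable_smul_left_of_hasCompactSupport
    (contDiff_translate hη x).continuous (hasCompactSupport_translate hc x)
  simpa [mul_comm] using this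

lemma mollify_sub {η f g : Space → ℝ} (hη : ContDiff ℝ ∞ η) (hc : HasCompactSupport η)
    (hf : LocallyIntegrable f volume) (hg : LocallyIntegrable g volume) :
    mollify η (f - g) = mollify η f - mollify η g := by
  ext x
  simp only [mollify, Pi.sub_apply, sub_mul]
  exact integral_sub (integrable_mul_translate hη hc hf x) (integrable_mul_translate hη hc hg x)

/-- Cauchy–Schwarz for the value of a mollification. -/
lemma enorm_mollify_le {η f : Space → ℝ} (hη : ContDiff ℝ ∞ η)
    (hf : AEStronglyMeasurable f volume) (x : Space) :
    ‖mollify η f x‖ₑ ≤ eLpNorm f 2 volume * eLpNorm η 2 volume := by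
  have h1 : ‖mollify η f x‖ₑ ≤ eLpNorm (f * fun y => η (x - y)) 1 volume := by
    rw [eLpNorm_one_eq_lintegral_enorm]
    exact enorm_integral_le_lintegral_enorm _
  have h2 : eLpNorm (fun y => η (x - y)) 2 volume = eLpNorm η 2 volume :=
    eLpNorm_comp_measurePreserving (g := η) hη.continuous.aestronglyMeasurable
      (Measure.measurePreserving_sub_left volume x)
  rw [← h2]
  refine h1.trans ?_
  have := eLpNorm_smul_le_mul_eLpNorm (p := 2) (q := 2) (r := 1) (μ := volume) (φ := f)
    (contDiff_translate hη x).continuous.aestronglyMeasurable hf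
  simpa only [smul_eq_mul] using this

/-- Mollification does not increase `Lᵠ` norms. -/
lemma eLpNorm_mollify_le (n : ℕ) {f : Space → ℝ} (hf : LocallyIntegrable f volume)
    {q : ℝ≥0∞} (hq : 1 ≤ q) (hq' : q ≠ ⊤) :
    eLpNorm (mollify (mollifier n) f) q volume ≤ eLpNorm f q volume := by
  have hq0 : q ≠ 0 := (zero_lt_one.trans_le hq).ne'
  have hqr : 0 < q.toReal := ENNReal.toReal_pos hq0 hq'
  set η := mollifier n with hηdef
  have hηc : Continuous η := (contDiff_mollifier n).continuous
  have hηm : Measurable fun z : Space => ENNReal.ofReal (η z) := hηc.measurable.ennreal_ofReal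
  have hmass : ∫⁻ z, ENNReal.ofReal (η z) = 1 := by
    rw [← ofReal_integral_eq_lintegral_ofReal, integral_mollifier, ENNReal.ofReal_one]
    · exact hηc.integrable_of_hasCompactSupport (hasCompactSupport_mollifier n)
    · exact Eventually.of_forall (mollifier_nonneg n)
  -- Jensen's inequality for the probability measure `η (x - y) dy`
  have hpt : ∀ x, ‖mollify η f x‖ₑ ^ q.toReal
      ≤ ∫⁻ y, ‖f y‖ₑ ^ q.toReal * ENNReal.ofReal (η (x - y)) := by
    intro x
    set ν : Measure Space := volume.withDensity fun y => ENNReal.ofReal (η (x - y)) with hν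
    have hm : Measurable fun y : Space => ENNReal.ofReal (η (x - y)) :=
      hηm.comp (measurable_const.sub measurable_id)
    have : IsProbabilityMeasure ν := by
      constructor
      rw [hν, withDensity_apply _ MeasurableSet.univ, Measure.restrict_univ]
      rw [lintegral_sub_left_eq_self (fun z => ENNReal.ofReal (η z)) x, hmass]
    have hfν : AEStronglyMeasurable f ν :=
      hf.aestronglyMeasurable.mono_ac (withDensity_absolutelyContinuous _ _)
    have h1 : ‖mollify η f x‖ₑ ≤ eLpNorm f 1 ν := by
      rw [eLpNorm_one_eq_lintegral_enorm, hν, lintegral_withDensity_eq_lintegral_mul₀' hm.aemeasurable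
        (by rw [← hν]; exact hfν.enorm)]
      refine (enorm_integral_le_lintegral_enorm _).trans (le_of_eq ?_)
      refine lintegral_congr fun y => ?_
      rw [enorm_mul, Pi.mul_apply, mul_comm, Real.enorm_of_nonneg (mollifier_nonneg n _)]
    have h2 : eLpNorm f 1 ν ≤ eLpNorm f q ν := eLpNorm_le_eLpNorm_of_exponent_le hq hfν
    calc ‖mollify η f x‖ₑ ^ q.toReal ≤ eLpNorm f q ν ^ q.toReal :=
          ENNReal.rpow_le_rpow (h1.trans h2) hqr.le
      _ = ∫⁻ y, ‖f y‖ₑ ^ q.toReal ∂ν := by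
          rw [eLpNorm_eq_lintegral_rpow_enorm_toReal hq0 hq', ← ENNReal.rpow_mul, one_div,
            inv_mul_cancel₀ hqr.ne', ENNReal.rpow_one]
      _ = _ := by
          rw [hν, lintegral_withDensity_eq_lintegral_mul₀' hm.aemeasurable
            (by rw [← hν]; exact hfν.enorm.pow_const _)]
          exact lintegral_congr fun y => mul_comm _ _
  rw [eLpNorm_eq_lintegral_rpow_enorm_toReal hq0 hq', eLpNorm_eq_lintegral_rpow_enorm_toReal hq0 hq']
  refine ENNReal.rpow_le_rpow ?_ (by positivity)
  calc ∫⁻ x, ‖mollify η f x‖ₑ ^ q.toReal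
      ≤ ∫⁻ x, ∫⁻ y, ‖f y‖ₑ ^ q.toReal * ENNReal.ofReal (η (x - y)) := lintegral_mono hpt
    _ = ∫⁻ y, ∫⁻ x, ‖f y‖ₑ ^ q.toReal * ENNReal.ofReal (η (x - y)) := by
        refine lintegral_lintegral_swap ?_
        refine AEMeasurable.mul ?_ ?_
        · exact (hf.aestronglyMeasurable.enorm.pow_const q.toReal).comp_snd
        · exact (hηm.comp (measurable_fst.sub measurable_snd)).aemeasurable
    _ = ∫⁻ y, ‖f y‖ₑ ^ q.toReal := by
        refine lintegral_congr fun y => ?_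
        have hm : Measurable fun x : Space => ENNReal.ofReal (η (x - y)) :=
          hηm.comp (measurable_id.sub_const y)
        rw [lintegral_const_mul _ hm,
          lintegral_sub_right_eq_self (fun z => ENNReal.ofReal (η z)) y, hmass, mul_one]

lemma mollify_mollifier_eq (n : ℕ) (f : Space → ℝ) :
    mollify (mollifier n) f
      = convolution ((bump n).normed volume) f (ContinuousLinearMap.lsmul ℝ ℝ) volume := by
  ext x
  rw [convolution_lsmul_swap]
  simp only [mollify, smul_eq_mul, mul_comm]
  rfl

lemma tendsto_bump_rOut : Tendsto (fun n => (bump n).rOut) atTop (𝓝 0) :=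
  tendsto_one_div_add_atTop_nhds_zero_nat (𝕜 := ℝ)

lemma ae_tendsto_mollify {f : Space → ℝ} (hf : LocallyIntegrable f volume) :
    ∀ᵐ x, Tendsto (fun n => mollify (mollifier n) f x) atTop (𝓝 (f x)) := by
  have := ContDiffBump.ae_convolution_tendsto_right_of_locallyIntegrable (φ := bump) (K := 2)
    tendsto_bump_rOut (Eventually.of_forall fun n => ?_) hf
  · simpa only [mollify_mollifier_eq] using this
  · change (1 : ℝ) / (n + 1) ≤ 2 * (1 / (2 * (n + 1)))
    have : (0 : ℝ) < n + 1 := by positivity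
    field_simp; rfl

/-- Mollifications of a continuous compactly supported function converge in every `Lᵠ`. -/
lemma tendsto_eLpNorm_mollify_sub_of_continuous {g : Space → ℝ} (hg : Continuous g)
    (hgc : HasCompactSupport g) (q : ℝ≥0∞) :
    Tendsto (fun n => eLpNorm (mollify (mollifier n) g - g) q volume) atTop (𝓝 0) := by
  obtain ⟨R, hR⟩ := hgc.isCompact.isBounded.subset_closedBall (0 : Space)
  set K : Set Space := Metric.closedBall 0 (R + 1)
  have hKfin : volume K ≠ ⊤ := measure_closedBall_lt_top.ne
  have hzero : ∀ n, ∀ x ∉ K, (mollify (mollifier n) g - g) x = 0 := by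
    intro n x hx
    have hx' : R + 1 < ‖x‖ := by simpa [K] using hx
    have h1 : ∀ y, R < ‖y‖ → g y = 0 := fun y hy => by
      by_contra h
      have := hR (subset_tsupport g h)
      simp at this; linarith
    have h2 : mollify (mollifier n) g x = 0 := by
      refine integral_eq_zero_of_ae (Eventually.of_forall fun y => ?_)
      rcases lt_or_ge R ‖y‖ with hy | hy
      · simp [h1 y hy]
      · have : mollifier n (x - y) = 0 := by
          have hs : Function.support (mollifier n) = Metric.ball 0 (bump n).rOut :=
            (bump n).support_normed_eq
          by_contra h
          have h3 : x - y ∈ Metric.ball (0 : Space) (bump n).rOut := hs ▸ h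
          rw [mem_ball_zero_iff] at h3
          have h4 : (bump n).rOut ≤ 1 := by
            change (1 : ℝ) / (n + 1) ≤ 1
            rw [div_le_one (by positivity)]
            linarith [n.cast_nonneg (α := ℝ)]
          have := norm_sub_norm_le x y
          linarith
        simp [this]
    simp [h2, h1 x (by linarith)]
  rw [ENNReal.tendsto_atTop_zero]
  intro ε hε
  -- the difference is at most `δ` everywhere, and lives on the ball `K`
  obtain ⟨δ, hδ, hδε⟩ : ∃ δ : ℝ, 0 < δ ∧
      volume K ^ (q.toReal)⁻¹ * ENNReal.ofReal δ ≤ ε := by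
    have ht : Tendsto (fun δ : ℝ => volume K ^ (q.toReal)⁻¹ * ENNReal.ofReal δ) (𝓝[>] 0) (𝓝 0) := by
      have : Tendsto (fun δ : ℝ => volume K ^ (q.toReal)⁻¹ * ENNReal.ofReal δ) (𝓝[>] 0)
          (𝓝 (volume K ^ (q.toReal)⁻¹ * ENNReal.ofReal 0)) :=
        ENNReal.Tendsto.const_mul
          ((ENNReal.continuous_ofReal.tendsto 0).mono_left nhdsWithin_le_nhds)
          (Or.inr (ENNReal.rpow_ne_top_of_nonneg (by positivity) hKfin))
      simpa using this
    obtain ⟨δ, h1, h2⟩ := ((ht.eventually (gt_mem_nhds hε)).and self_mem_nhdsWithin).exists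
    exact ⟨δ, h2, h1.le⟩
  obtain ⟨r, hr, hunif⟩ := Metric.uniformContinuous_iff.1
    (hgc.uniformContinuous_of_continuous hg) δ hδ
  obtain ⟨N, hN⟩ := eventually_atTop.1 (tendsto_bump_rOut.eventually (gt_mem_nhds hr))
  refine ⟨N, fun n hn => ?_⟩
  have hbd : ∀ x, ‖(mollify (mollifier n) g - g) x‖ ≤ δ := by
    intro x
    have := (bump n).dist_normed_convolution_le (μ := volume) (g := g) (x₀ := x) (ε := δ)
      hg.aestronglyMeasurable (fun y hy => (hunif (lt_of_lt_of_le hy (hN n hn).le)).le)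
    rwa [← mollify_mollifier_eq, dist_eq_norm] at this
  have hrestr : eLpNorm (mollify (mollifier n) g - g) q volume
      = eLpNorm (mollify (mollifier n) g - g) q (volume.restrict K) := by
    rw [← eLpNorm_indicator_eq_eLpNorm_restrict measurableSet_closedBall]
    congr 1; ext x
    by_cases hx : x ∈ K
    · rw [indicator_of_mem hx]
    · rw [indicator_of_notMem hx, hzero n x hx]
  rw [hrestr]
  refine (eLpNorm_le_of_ae_bound (C := δ) (Eventually.of_forall hbd)).trans ?_
  simpa using hδε

/-- Mollifications of an `Lᵠ` function converge in `Lᵠ`. -/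
lemma tendsto_eLpNorm_mollify_sub {f : Space → ℝ} {q : ℝ≥0∞} (hq : 1 ≤ q) (hq' : q ≠ ⊤)
    (hf : MemLp f q volume) :
    Tendsto (fun n => eLpNorm (mollify (mollifier n) f - f) q volume) atTop (𝓝 0) := by
  rw [ENNReal.tendsto_atTop_zero]
  intro ε hε
  have hε3 : ε / 3 ≠ 0 := (ENNReal.div_pos hε.ne' (by norm_num)).ne'
  obtain ⟨g, hgc, hfg, hg, hgm⟩ := hf.exists_hasCompactSupport_eLpNorm_sub_le hq' hε3
  obtain ⟨N, hN⟩ := ENNReal.tendsto_atTop_zero.1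
    (tendsto_eLpNorm_mollify_sub_of_continuous hg hgc q) (ε / 3) (pos_iff_ne_zero.2 hε3)
  refine ⟨N, fun n hn => ?_⟩
  have hfl := hf.locallyIntegrable hq
  have hgl := hgm.locallyIntegrable hq
  have hsm := contDiff_mollifier n
  have hcs := hasCompactSupport_mollifier n
  have hdec : mollify (mollifier n) f - f
      = mollify (mollifier n) (f - g) + (mollify (mollifier n) g - g) + (g - f) := by
    rw [mollify_sub hsm hcs hfl hgl]; abel
  have m1 := (continuous_mollify hsm hcs (hfl.sub hgl)).aestronglyMeasurable (μ := volume)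
  have m2 := (continuous_mollify hsm hcs hgl).aestronglyMeasurable (μ := volume)
  have hgf : eLpNorm (g - f) q volume ≤ ε / 3 := by rwa [eLpNorm_sub_comm]
  rw [hdec]
  calc _ ≤ eLpNorm (mollify (mollifier n) (f - g)) q volume
        + eLpNorm (mollify (mollifier n) g - g) q volume + eLpNorm (g - f) q volume :=
        (eLpNorm_add_le (m1.add (m2.sub hgm.1)) (hgm.1.sub hf.1) hq).trans
          (add_le_add (eLpNorm_add_le m1 (m2.sub hgm.1) hq) le_rfl)
    _ ≤ ε / 3 + ε / 3 + ε / 3 := by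
        gcongr
        · exact (eLpNorm_mollify_le n (hfl.sub hgl) hq hq').trans hfg
        · exact hN n hn
    _ = ε := ENNReal.add_thirds ε

/-! ### The spatial part of the flux identity -/

/-- The smooth substitute `√(|x|² + δ²)` for the distance to the origin. -/
def rho (δ : ℝ) (x : Space) : ℝ := √(‖x‖ ^ 2 + δ ^ 2)

/-- The nonlinearity `|y|^(p-1) y`. -/
def nonlin (p y : ℝ) : ℝ := |y| ^ (p - 1) * y

/-- The potential energy density `|y|^(p+1) / (p+1)`. -/
def potential (p y : ℝ) : ℝ := 1 / (p + 1) * |y| ^ (p + 1)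

lemma rho_sq (δ : ℝ) (x : Space) : rho δ x ^ 2 = ‖x‖ ^ 2 + δ ^ 2 :=
  Real.sq_sqrt (by positivity)

lemma rho_pos {δ : ℝ} (hδ : 0 < δ) (x : Space) : 0 < rho δ x :=
  Real.sqrt_pos.2 (by positivity)

lemma norm_le_rho (δ : ℝ) (x : Space) : ‖x‖ ≤ rho δ x :=
  Real.le_sqrt_of_sq_le (by nlinarith [sq_nonneg δ])

lemma le_rho {δ : ℝ} (x : Space) : δ ≤ rho δ x :=
  Real.le_sqrt_of_sq_le (by nlinarith [sq_nonneg ‖x‖])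

lemma norm_sq_eq_sum (x : Space) : ‖x‖ ^ 2 = ∑ i, x i ^ 2 := by
  rw [EuclideanSpace.norm_sq_eq]; simp

lemma contDiff_rho {δ : ℝ} (hδ : 0 < δ) : ContDiff ℝ ∞ (rho δ) := by
  refine ContDiff.sqrt ((contDiff_norm_sq ℝ).add contDiff_const) fun x => ?_
  positivity

lemma hasDerivAt_coord (x : Space) (i j : Fin 3) :
    HasDerivAt (fun s : ℝ => (x + s • basisVec i) j) (if j = i then 1 else 0) 0 := by
  have : (fun s : ℝ => (x + s • basisVec i) j) = fun s => x j + s * (if j = i then 1 else 0) := by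
    ext s; simp [basisVec]
  rw [this]
  simpa using ((hasDerivAt_id (0 : ℝ)).mul_const (if j = i then (1 : ℝ) else 0)).const_add (x j)

lemma hasDerivAt_line {f : Space → ℝ} (hf : ContDiff ℝ 1 f) (x : Space) (i : Fin 3) :
    HasDerivAt (fun s : ℝ => f (x + s • basisVec i)) (pd i f x) 0 :=
  ((hf.differentiable one_ne_zero).differentiableAt.hasFDerivAt).hasLineDerivAt (basisVec i)

lemma hasDerivAt_rho_line {δ : ℝ} (hδ : 0 < δ) (x : Space) (i : Fin 3) :
    HasDerivAt (fun s : ℝ => rho δ (x + s • basisVec i)) (x i / rho δ x) 0 := by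
  have h1 : (fun s : ℝ => rho δ (x + s • basisVec i))
      = fun s : ℝ => √(∑ j, (x + s • basisVec i) j ^ 2 + δ ^ 2) := by
    ext s; rw [rho, norm_sq_eq_sum]
  have h2 : HasDerivAt (fun s : ℝ => ∑ j, (x + s • basisVec i) j ^ 2 + δ ^ 2) (2 * x i) 0 := by
    have := (HasDerivAt.fun_sum (u := Finset.univ)
      fun j _ => (hasDerivAt_coord x i j).pow 2).add_const (δ ^ 2)
    refine this.congr_deriv ?_
    simp
  rw [h1]
  have h3 := h2.sqrt (by rw [← norm_sq_eq_sum]; positivity)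
  refine h3.congr_deriv ?_
  simp only [zero_smul, add_zero]
  rw [← norm_sq_eq_sum, ← rho]
  have := rho_pos hδ x
  field_simp

lemma hasDerivAt_potential {p : ℝ} (hp : 3 ≤ p) (y : ℝ) :
    HasDerivAt (potential p) (nonlin p y) y := by
  have h := (hasDerivAt_abs_rpow y (p := p + 1) (by linarith)).const_mul (1 / (p + 1))
  refine HasDerivAt.congr_deriv (f := potential p) h ?_
  have : p + 1 ≠ 0 := by linarith
  rw [nonlin, show p + 1 - 2 = p - 1 by ring]
  field_simp

lemma continuous_nonlin {p : ℝ} (hp : 3 ≤ p) : Continuous (nonlin p) :=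
  (continuous_abs.rpow_const fun _ => Or.inr (by linarith)).mul continuous_id

lemma continuous_potential {p : ℝ} (hp : 3 ≤ p) : Continuous (potential p) :=
  continuous_const.mul (continuous_abs.rpow_const fun _ => Or.inr (by linarith))

lemma contDiff_potential {p : ℝ} (hp : 3 ≤ p) : ContDiff ℝ 1 (potential p) := by
  rw [contDiff_one_iff_deriv]
  refine ⟨fun y => (hasDerivAt_potential hp y).differentiableAt, ?_⟩
  rw [show deriv (potential p) = nonlin p from
    funext fun y => (hasDerivAt_potential hp y).deriv]
  exact continuous_nonlin hp

lemma potential_nonneg {p : ℝ} (hp : 3 ≤ p) (y : ℝ) : 0 ≤ potential p y := by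
  unfold potential
  have : 0 < p + 1 := by linarith
  positivity

/-- A compactly supported `C¹` function has partial derivatives of mean zero. -/
lemma integral_pd_eq_zero {F : Space → ℝ} (hF : ContDiff ℝ 1 F) (hc : HasCompactSupport F)
    (i : Fin 3) : ∫ x, pd i F x = 0 := by
  have hcont : Continuous (pd i F) := (hF.continuous_fderiv one_ne_zero).clm_apply continuous_const
  have hint := hcont.integrable_of_hasCompactSupport (μ := volume) (hasCompactSupport_pd hc i)
  have h := integral_bilinear_hasLineDerivAt_right_eq_neg_left_of_integrable (μ := volume)
    (f := fun _ : Space => (1 : ℝ)) (f' := fun _ => 0) (g := F) (g' := pd i F)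
    (B := ContinuousLinearMap.mul ℝ ℝ) (v := basisVec i) (by simp) (by simpa using hint)
    (by simpa using hF.continuous.integrable_of_hasCompactSupport hc)
    (fun x _ => hasDerivAt_const _ _) (fun x _ => hasDerivAt_line hF x i)
  simpa using h

/-- The density of the localised functional. The weight is `f (t - ρ)`, the arguments `y`, `z`, `w`
stand for `u`, `∇u`, `u_t`. For `a = 0` this is half the weighted energy density; for `a = 1` it
is, up to a divergence and to errors which disappear as `δ → 0`, the weighted outward energy
density. -/
def density (p a δ : ℝ) (f : ℝ → ℝ) (t : ℝ) (x : Space) (y : ℝ) (z : Fin 3 → ℝ) (w : ℝ) : ℝ :=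
  1 / 2 * f (t - rho δ x) * (1 / 2 * ∑ i, z i ^ 2 + 1 / 2 * w ^ 2 + potential p y)
    - a * (1 / 2 * f (t - rho δ x) * w * ((∑ i, x i * z i + y) / rho δ x)
      - 1 / 4 * deriv f (t - rho δ x) * y ^ 2 / rho δ x)

/-- The time derivative of `density` along `y' = w`, `z' = wz`, `w' = ℓ - N(y)`. -/
def densityRate (p a δ : ℝ) (f : ℝ → ℝ) (t : ℝ) (x : Space) (y : ℝ) (z : Fin 3 → ℝ) (w : ℝ)
    (wz : Fin 3 → ℝ) (ℓ : ℝ) : ℝ :=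
  1 / 2 * deriv f (t - rho δ x) * (1 / 2 * ∑ i, z i ^ 2 + 1 / 2 * w ^ 2 + potential p y)
    + 1 / 2 * f (t - rho δ x) * (∑ i, z i * wz i + w * ℓ)
    - a * (1 / 2 * deriv f (t - rho δ x) * w * ((∑ i, x i * z i) / rho δ x)
      + 1 / 2 * f (t - rho δ x) * (ℓ - nonlin p y) * ((∑ i, x i * z i + y) / rho δ x)
      + 1 / 2 * f (t - rho δ x) * w * ((∑ i, x i * wz i + w) / rho δ x)
      - 1 / 4 * deriv (deriv f) (t - rho δ x) * y ^ 2 / rho δ x)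

/-- What remains of `densityRate` once a divergence is removed: the production of the functional. -/
def production (p a δ : ℝ) (f : ℝ → ℝ) (t : ℝ) (x : Space) (y : ℝ) (z : Fin 3 → ℝ) (w : ℝ) : ℝ :=
  (1 - a) * (1 / 2 * deriv f (t - rho δ x) * ((1 / 2 * ∑ i, z i ^ 2 + 1 / 2 * w ^ 2 + potential p y)
      + w * ((∑ i, x i * z i) / rho δ x)))
    + a * (1 / 4 * (1 - ‖x‖ ^ 2 / rho δ x ^ 2)
          * (deriv f (t - rho δ x) + f (t - rho δ x) / rho δ x) * w ^ 2
      + 1 / 4 * (deriv f (t - rho δ x) + f (t - rho δ x) / rho δ x)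
          * ((1 + ‖x‖ ^ 2 / rho δ x ^ 2) * ∑ i, z i ^ 2 - 2 * ((∑ i, x i * z i) / rho δ x) ^ 2)
      + (1 / 2 * deriv f (t - rho δ x) * (1 + ‖x‖ ^ 2 / rho δ x ^ 2)
          + 1 / 2 * (f (t - rho δ x) / rho δ x) * (p - 2 + ‖x‖ ^ 2 / rho δ x ^ 2)) * potential p y
      + 1 / 4 * ((1 - ‖x‖ ^ 2 / rho δ x ^ 2) / rho δ x) * (deriv (deriv f) (t - rho δ x)
          + 3 / rho δ x * (deriv f (t - rho δ x) + f (t - rho δ x) / rho δ x)) * y ^ 2)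

/-- The vector field whose divergence is `densityRate - production`. -/
def flux (p a δ : ℝ) (f : ℝ → ℝ) (t : ℝ) (v w : Space → ℝ) (i : Fin 3) (x : Space) : ℝ :=
  1 / 2 * (f (t - rho δ x) * w x * pd i v x)
    - a / 2 * (f (t - rho δ x) / rho δ x
        * (x i * (1 / 2 * w x ^ 2 - 1 / 2 * ∑ j, pd j v x ^ 2 - potential p (v x))
          + pd i v x * (∑ j, x j * pd j v x + v x))
      + 1 / 2 * v x ^ 2 * (deriv f (t - rho δ x) / rho δ x ^ 2 + f (t - rho δ x) / rho δ x ^ 3)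
        * x i)

lemma contDiff_coord (i : Fin 3) : ContDiff ℝ ∞ (fun x : Space => x i) := by fun_prop

lemma contDiff_deriv {f : ℝ → ℝ} (hf : ContDiff ℝ ∞ f) : ContDiff ℝ ∞ (deriv f) :=
  (contDiff_infty_iff_deriv.1 hf).2

lemma contDiff_weight {f : ℝ → ℝ} (hf : ContDiff ℝ ∞ f) {δ : ℝ} (hδ : 0 < δ) (t : ℝ) :
    ContDiff ℝ ∞ (fun x => f (t - rho δ x)) :=
  hf.comp (contDiff_const.sub (contDiff_rho hδ))

lemma contDiff_flux {p : ℝ} (hp : 3 ≤ p) (a : ℝ) {δ : ℝ} (hδ : 0 < δ) {f : ℝ → ℝ}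
    (hf : ContDiff ℝ ∞ f) (t : ℝ) {v w : Space → ℝ} (hv : ContDiff ℝ ∞ v) (hw : ContDiff ℝ ∞ w)
    (i : Fin 3) : ContDiff ℝ 1 (flux p a δ f t v w i) := by
  have h1 : (1 : WithTop ℕ∞) ≤ (∞ : WithTop ℕ∞) := by simp
  have hφ := (contDiff_weight hf hδ t).of_le h1
  have hφ' := (contDiff_weight (contDiff_deriv hf) hδ t).of_le h1
  have hρ := (contDiff_rho hδ).of_le h1
  have hρ0 : ∀ x, rho δ x ≠ 0 := fun x => (rho_pos hδ x).ne'
  have hvj : ∀ j, ContDiff ℝ 1 (pd j v) := fun j => (contDiff_pd hv j).of_le h1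
  have hx : ∀ j, ContDiff ℝ 1 (fun x : Space => x j) := fun j => (contDiff_coord j).of_le h1
  have hv1 := hv.of_le h1
  have hw1 := hw.of_le h1
  have hV := (contDiff_potential hp).comp hv1
  refine (contDiff_const.mul ((hφ.mul hw1).mul (hvj i))).sub (contDiff_const.mul (ContDiff.add
    ((hφ.div hρ hρ0).mul (((hx i).mul (((contDiff_const.mul (hw1.pow 2)).sub (contDiff_const.mul
    (ContDiff.sum fun j _ => (hvj j).pow 2))).sub hV)).add ((hvj i).mul
    ((ContDiff.sum fun j _ => (hx j).mul (hvj j)).add hv1)))) ?_))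
  exact ((contDiff_const.mul (hv1.pow 2)).mul ((hφ'.div (hρ.pow 2) fun x => pow_ne_zero _ (hρ0 x)).add
    (hφ.div (hρ.pow 3) fun x => pow_ne_zero _ (hρ0 x)))).mul (hx i)

lemma pd_comm {v : Space → ℝ} (hv : ContDiff ℝ ∞ v) (i j : Fin 3) (x : Space) :
    pd i (pd j v) x = pd j (pd i v) x := by
  have hd : DifferentiableAt ℝ (fderiv ℝ v) x :=
    ((hv.fderiv_right (m := ∞) (by simp)).differentiable (by simp)).differentiableAt
  have key : ∀ k l : Fin 3, pd k (pd l v) x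
      = fderiv ℝ (fderiv ℝ v) x (basisVec k) (basisVec l) := by
    intro k l
    have : pd l v = fun y => fderiv ℝ v y (basisVec l) := rfl
    rw [pd, this, fderiv_clm_apply hd (differentiableAt_const _)]
    simp
  rw [key, key]
  exact (hv.contDiffAt.isSymmSndFDerivAt
    (by rw [minSmoothness_of_isRCLikeNormedField]; exact (mod_cast le_top : ((2 : ℕ∞) : WithTop ℕ∞) ≤ ((⊤ : ℕ∞) : WithTop ℕ∞)))) _ _

/-- The derivative of the `i`-th component of the flux in the `i`-th direction. -/
lemma pd_flux {p : ℝ} (hp : 3 ≤ p) (a : ℝ) {δ : ℝ} (hδ : 0 < δ) {f : ℝ → ℝ}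
    (hf : ContDiff ℝ ∞ f) (t : ℝ) {v w : Space → ℝ} (hv : ContDiff ℝ ∞ v) (hw : ContDiff ℝ ∞ w)
    (i : Fin 3) (x : Space) : pd i (flux p a δ f t v w i) x =
    1 / 2 * (f (t - rho δ x) * (pd i w x * pd i v x + w x * pd i (pd i v) x)
        - deriv f (t - rho δ x) * (x i / rho δ x) * w x * pd i v x)
    - a / 2 * ((-(deriv f (t - rho δ x) * (x i / rho δ x)) / rho δ x
          - f (t - rho δ x) * (x i / rho δ x) / rho δ x ^ 2)
        * (x i * (1 / 2 * w x ^ 2 - 1 / 2 * ∑ j, pd j v x ^ 2 - potential p (v x))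
          + pd i v x * (∑ j, x j * pd j v x + v x))
      + f (t - rho δ x) / rho δ x
        * ((1 / 2 * w x ^ 2 - 1 / 2 * ∑ j, pd j v x ^ 2 - potential p (v x))
          + x i * (w x * pd i w x - ∑ j, pd j v x * pd i (pd j v) x - nonlin p (v x) * pd i v x)
          + pd i (pd i v) x * (∑ j, x j * pd j v x + v x)
          + pd i v x * (∑ j, x j * pd i (pd j v) x + 2 * pd i v x))
      + v x * pd i v x * (deriv f (t - rho δ x) / rho δ x ^ 2 + f (t - rho δ x) / rho δ x ^ 3) * x i
      + 1 / 2 * v x ^ 2 * ((-(deriv (deriv f) (t - rho δ x) * (x i / rho δ x)) / rho δ x ^ 2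
          - 2 * deriv f (t - rho δ x) * (x i / rho δ x) / rho δ x ^ 3
          - deriv f (t - rho δ x) * (x i / rho δ x) / rho δ x ^ 3
          - 3 * f (t - rho δ x) * (x i / rho δ x) / rho δ x ^ 4) * x i
          + (deriv f (t - rho δ x) / rho δ x ^ 2 + f (t - rho δ x) / rho δ x ^ 3))) := by
  have h1 : (1 : WithTop ℕ∞) ≤ (∞ : WithTop ℕ∞) := by simp
  have hρ0 := (rho_pos hδ x).ne'
  have hρ := hasDerivAt_rho_line hδ x i
  have hφ : ∀ {g : ℝ → ℝ}, ContDiff ℝ ∞ g → HasDerivAt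
      (fun s : ℝ => g (t - rho δ (x + s • basisVec i)))
      (-(deriv g (t - rho δ x) * (x i / rho δ x))) 0 := by
    intro g hg
    have h2 : HasDerivAt g (deriv g (t - rho δ x)) (t - rho δ (x + (0 : ℝ) • basisVec i)) := by
      simpa using (hg.differentiable (by simp)).differentiableAt.hasDerivAt
    have h3 := h2.comp (0 : ℝ) (hρ.const_sub t)
    exact h3.congr_deriv (by ring)
  have hv0 := hasDerivAt_line (hv.of_le h1) x i
  have hw0 := hasDerivAt_line (hw.of_le h1) x i
  have hvj : ∀ j, HasDerivAt (fun s : ℝ => pd j v (x + s • basisVec i)) (pd i (pd j v) x) 0 :=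
    fun j => hasDerivAt_line ((contDiff_pd hv j).of_le h1) x i
  have hV : HasDerivAt (fun s : ℝ => potential p (v (x + s • basisVec i)))
      (nonlin p (v x) * pd i v x) 0 := by
    have h2 : HasDerivAt (potential p) (nonlin p (v x)) (v (x + (0 : ℝ) • basisVec i)) := by
      simpa using hasDerivAt_potential hp (v x)
    exact HasDerivAt.comp (h₂ := potential p) (0 : ℝ) h2 hv0
  have hx := hasDerivAt_coord x i
  have hρ0' : rho δ (x + (0 : ℝ) • basisVec i) ≠ 0 := (rho_pos hδ _).ne'
  have hsum1 := HasDerivAt.fun_sum (u := Finset.univ) fun j _ => (hvj j).pow 2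
  have hsum2 := HasDerivAt.fun_sum (u := Finset.univ) fun j _ => (hx j).mul (hvj j)
  have main := (((((hφ hf).mul hw0).mul (hvj i)).const_mul (1 / 2)).sub
    ((HasDerivAt.add (((hφ hf).div hρ hρ0').mul (((hx i).mul ((((hw0.pow 2).const_mul (1 / 2)).sub
      (hsum1.const_mul (1 / 2))).sub hV)).add ((hvj i).mul (hsum2.add hv0))))
      ((((hv0.pow 2).const_mul (1 / 2)).mul (((hφ (contDiff_deriv hf)).div (hρ.pow 2)
        (pow_ne_zero _ hρ0')).add ((hφ hf).div (hρ.pow 3) (pow_ne_zero _ hρ0')))).mul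
        (hx i))).const_mul (a / 2)))
  have hflux := hasDerivAt_line (contDiff_flux hp a hδ hf t hv hw i) x i
  rw [hflux.unique main]
  simp only [Pi.mul_apply, Pi.add_apply, Pi.sub_apply, Pi.div_apply, Pi.pow_apply, zero_smul, add_zero]
  fin_cases i <;> simp [Fin.sum_univ_three] <;> field_simp <;> ring

/-- The pointwise flux identity. -/
lemma densityRate_eq {p : ℝ} (hp : 3 ≤ p) (a : ℝ) {δ : ℝ} (hδ : 0 < δ) {f : ℝ → ℝ}
    (hf : ContDiff ℝ ∞ f) (t : ℝ) {v w : Space → ℝ} (hv : ContDiff ℝ ∞ v) (hw : ContDiff ℝ ∞ w)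
    (x : Space) :
    densityRate p a δ f t x (v x) (fun i => pd i v x) (w x) (fun i => pd i w x)
        (∑ i, pd i (pd i v) x)
      = production p a δ f t x (v x) (fun i => pd i v x) (w x)
        + ∑ i, pd i (flux p a δ f t v w i) x := by
  have hρ0 := (rho_pos hδ x).ne'
  simp only [pd_flux hp a hδ hf t hv hw, densityRate, production, norm_sq_eq_sum,
    Fin.sum_univ_three]
  have hV : potential p (v x) = nonlin p (v x) * v x / (p + 1) := by
    rcases eq_or_ne (v x) 0 with h | h
    · simp [h, potential, Real.zero_rpow (by linarith : p + 1 ≠ 0)]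
    · rw [potential, nonlin, show p + 1 = p - 1 + 2 by ring, Real.rpow_add (abs_pos.2 h),
        Real.rpow_two, sq_abs]
      ring
  rw [pd_comm hv 1 0, pd_comm hv 2 0, pd_comm hv 2 1, hV]
  have : p + 1 ≠ 0 := by linarith
  field_simp
  ring

/-! ### Sign of the production -/

lemma sq_sum_coord_mul_le (x : Space) (z : Fin 3 → ℝ) :
    (∑ i, x i * z i) ^ 2 ≤ ‖x‖ ^ 2 * ∑ i, z i ^ 2 := by
  rw [norm_sq_eq_sum]
  exact Finset.sum_mul_sq_le_sq_mul_sq _ _ _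

lemma sq_radial_le {δ : ℝ} (hδ : 0 < δ) (x : Space) (z : Fin 3 → ℝ) :
    ((∑ i, x i * z i) / rho δ x) ^ 2 ≤ ‖x‖ ^ 2 / rho δ x ^ 2 * ∑ i, z i ^ 2 := by
  rw [div_pow, div_mul_eq_mul_div]
  have := rho_pos hδ x
  gcongr
  exact sq_sum_coord_mul_le x z

lemma norm_sq_div_rho_sq_le {δ : ℝ} (hδ : 0 < δ) (x : Space) : ‖x‖ ^ 2 / rho δ x ^ 2 ≤ 1 := by
  have := rho_pos hδ x
  rw [div_le_one (by positivity), rho_sq]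
  nlinarith

/-- The energy in a region which grows at the speed of light is nondecreasing. -/
lemma production_zero_nonneg {p : ℝ} (hp : 3 ≤ p) {δ : ℝ} (hδ : 0 < δ) {f : ℝ → ℝ} {t : ℝ}
    {x : Space} (hf : 0 ≤ deriv f (t - rho δ x)) (y : ℝ) (z : Fin 3 → ℝ) (w : ℝ) :
    0 ≤ production p 0 δ f t x y z w := by
  have h1 := sq_radial_le hδ x z
  have h2 := norm_sq_div_rho_sq_le hδ x
  have h3 : 0 ≤ ∑ i, z i ^ 2 := Finset.sum_nonneg fun i _ => sq_nonneg _
  have h4 := potential_nonneg hp y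
  have h5 : 0 ≤ 1 / 2 * ∑ i, z i ^ 2 + 1 / 2 * w ^ 2 + potential p y
      + w * ((∑ i, x i * z i) / rho δ x) := by
    nlinarith [sq_nonneg (w + (∑ i, x i * z i) / rho δ x),
      mul_le_mul_of_nonneg_right h2 h3]
  simp only [production, sub_zero, one_mul, zero_mul, add_zero]
  positivity

/-- For weights with `f + ρ f' ≥ 0` the outward functional has nonnegative production, except for
one lower order term, controlled by the second derivative of the weight. -/
lemma le_production_one {p : ℝ} (hp : 3 ≤ p) {δ : ℝ} (hδ : 0 < δ) {f : ℝ → ℝ} {t C : ℝ}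
    {x : Space} (hf0 : 0 ≤ f (t - rho δ x))
    (hf : 0 ≤ deriv f (t - rho δ x) + f (t - rho δ x) / rho δ x)
    (hC : |deriv (deriv f) (t - rho δ x)| ≤ C) (y : ℝ) (z : Fin 3 → ℝ) (w : ℝ) :
    -(C * δ * (y / rho δ x) ^ 2) ≤ production p 1 δ f t x y z w := by
  have hρ := rho_pos hδ x
  have h1 := sq_radial_le hδ x z
  have h2 := norm_sq_div_rho_sq_le hδ x
  have h3 : 0 ≤ ∑ i, z i ^ 2 := Finset.sum_nonneg fun i _ => sq_nonneg _
  have h4 := potential_nonneg hp y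
  have h5 : 1 - ‖x‖ ^ 2 / rho δ x ^ 2 = δ ^ 2 / rho δ x ^ 2 := by
    field_simp; rw [rho_sq]; ring
  have h6 : 0 ≤ ‖x‖ ^ 2 / rho δ x ^ 2 := by positivity
  simp only [production, sub_self, zero_mul, one_mul, zero_add]
  set q := ‖x‖ ^ 2 / rho δ x ^ 2
  set F := f (t - rho δ x)
  set F' := deriv f (t - rho δ x)
  set F'' := deriv (deriv f) (t - rho δ x)
  set ρ := rho δ x
  have hFρ : 0 ≤ F / ρ := by positivity
  -- the four terms of the production: `u_t²`, `|∇u|²`, the potential, and `u²`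
  have t1 : 0 ≤ 1 / 4 * (1 - q) * (F' + F / ρ) * w ^ 2 := by
    have : 0 ≤ 1 - q := by linarith
    positivity
  have t2 : 0 ≤ 1 / 4 * (F' + F / ρ)
      * ((1 + q) * ∑ i, z i ^ 2 - 2 * ((∑ i, x i * z i) / ρ) ^ 2) := by
    refine mul_nonneg (by positivity) ?_
    nlinarith [mul_le_mul_of_nonneg_right h2 h3]
  -- here `p ≥ 3` enters, through `p - 2 + q ≥ 1 + q`
  have t3 : 0 ≤ (1 / 2 * F' * (1 + q) + 1 / 2 * (F / ρ) * (p - 2 + q)) * potential p y := by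
    refine mul_nonneg ?_ h4
    nlinarith [mul_nonneg hf (by linarith : 0 ≤ 1 + q), mul_nonneg hFρ (by linarith : 0 ≤ p - 3)]
  have t4 : -(C * δ * (y / ρ) ^ 2)
      ≤ 1 / 4 * ((1 - q) / ρ) * (F'' + 3 / ρ * (F' + F / ρ)) * y ^ 2 := by
    have hq : 0 ≤ (1 - q) / ρ := div_nonneg (by linarith) hρ.le
    -- `1 - q = δ² / ρ²` and `δ ≤ ρ`
    have hq' : (1 - q) / ρ ≤ δ / ρ ^ 2 := by
      rw [h5, div_div, div_le_div_iff₀ (by positivity) (by positivity)]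
      have : δ ≤ ρ := le_rho x
      nlinarith [mul_le_mul_of_nonneg_left this (by positivity : 0 ≤ δ * ρ ^ 2)]
    have hC0 : 0 ≤ C := (abs_nonneg _).trans hC
    have e1 : 0 ≤ 3 / ρ * (F' + F / ρ) := by positivity
    have e2 : -C ≤ F'' + 3 / ρ * (F' + F / ρ) := by linarith [neg_abs_le F'']
    have e3 : -(C * (δ / ρ ^ 2)) ≤ (1 - q) / ρ * (F'' + 3 / ρ * (F' + F / ρ)) := by
      nlinarith [mul_le_mul_of_nonneg_left e2 hq, mul_le_mul_of_nonneg_left hq' hC0]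
    have e4 := mul_le_mul_of_nonneg_right e3 (sq_nonneg y)
    have e5 : 0 ≤ C * (δ / ρ ^ 2) * y ^ 2 := by positivity
    have e6 : C * δ * (y / ρ) ^ 2 = C * (δ / ρ ^ 2) * y ^ 2 := by field_simp
    rw [e6]
    nlinarith
  linarith

/-- A weight that vanishes below `-R` does so together with its derivatives. -/
lemma deriv_eq_zero_of_lt {f : ℝ → ℝ} {R : ℝ} (hf : ∀ s < -R, f s = 0) : ∀ s < -R, deriv f s = 0 := by
  intro s hs
  have : f =ᶠ[𝓝 s] fun _ => 0 := by
    filter_upwards [gt_mem_nhds hs] with r hr using hf r hr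
  rw [this.deriv_eq, deriv_const]

lemma weight_eq_zero {f : ℝ → ℝ} {R : ℝ} (hf : ∀ s < -R, f s = 0) {δ t : ℝ} {x : Space}
    (hx : t + R < ‖x‖) : f (t - rho δ x) = 0 :=
  hf _ (by linarith [norm_le_rho δ x])

lemma hasCompactSupport_of_eq_zero {E : Type*} [Zero E] {F : Space → E} {r : ℝ}
    (h : ∀ x, r < ‖x‖ → F x = 0) :
    HasCompactSupport F := by
  refine HasCompactSupport.intro (isCompact_closedBall (0 : Space) r) fun x hx => h x ?_
  simpa using hx

section

variable {p a δ t R : ℝ} {f : ℝ → ℝ} {x : Space}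

lemma density_eq_zero (hf : ∀ s < -R, f s = 0) (hx : t + R < ‖x‖) (y : ℝ) (z : Fin 3 → ℝ) (w : ℝ) :
    density p a δ f t x y z w = 0 := by
  simp [density, weight_eq_zero hf hx, weight_eq_zero (deriv_eq_zero_of_lt hf) hx]

lemma densityRate_eq_zero (hf : ∀ s < -R, f s = 0) (hx : t + R < ‖x‖) (y : ℝ) (z : Fin 3 → ℝ)
    (w : ℝ) (wz : Fin 3 → ℝ) (ℓ : ℝ) : densityRate p a δ f t x y z w wz ℓ = 0 := by
  simp [densityRate, weight_eq_zero hf hx, weight_eq_zero (deriv_eq_zero_of_lt hf) hx,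
    weight_eq_zero (deriv_eq_zero_of_lt (deriv_eq_zero_of_lt hf)) hx]

lemma production_eq_zero (hf : ∀ s < -R, f s = 0) (hx : t + R < ‖x‖) (y : ℝ) (z : Fin 3 → ℝ)
    (w : ℝ) : production p a δ f t x y z w = 0 := by
  simp [production, weight_eq_zero hf hx, weight_eq_zero (deriv_eq_zero_of_lt hf) hx,
    weight_eq_zero (deriv_eq_zero_of_lt (deriv_eq_zero_of_lt hf)) hx]

lemma flux_eq_zero (hf : ∀ s < -R, f s = 0) (hx : t + R < ‖x‖) (v w : Space → ℝ) (i : Fin 3) :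
    flux p a δ f t v w i x = 0 := by
  simp [flux, weight_eq_zero hf hx, weight_eq_zero (deriv_eq_zero_of_lt hf) hx]

end

lemma continuous_rho (δ : ℝ) : Continuous (rho δ) := by
  unfold rho; fun_prop

/-- Joint continuity of the rate along continuous data. -/
lemma continuous_densityRate {α : Type*} [TopologicalSpace α] {p : ℝ} (hp : 3 ≤ p) (a : ℝ) {δ : ℝ}
    (hδ : 0 < δ) {f : ℝ → ℝ} (hf : ContDiff ℝ ∞ f) {t : α → ℝ} {x : α → Space} {y w ℓ : α → ℝ}
    {z wz : Fin 3 → α → ℝ}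
    (ht : Continuous t) (hx : Continuous x) (hy : Continuous y) (hz : ∀ i, Continuous (z i))
    (hw : Continuous w) (hwz : ∀ i, Continuous (wz i)) (hl : Continuous ℓ) :
    Continuous fun b => densityRate p a δ f (t b) (x b) (y b) (fun i => z i b) (w b)
      (fun i => wz i b) (ℓ b) := by
  have hρ : Continuous fun b => rho δ (x b) := (continuous_rho δ).comp hx
  have hρ0 : ∀ b, rho δ (x b) ≠ 0 := fun b => (rho_pos hδ _).ne'
  have h0 := hf.continuous
  have h1 := (contDiff_deriv hf).continuous
  have h2 := (contDiff_deriv (contDiff_deriv hf)).continuous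
  have hN := continuous_nonlin hp
  have hV := continuous_potential hp
  have hxi : ∀ i, Continuous fun b => x b i := fun i => (contDiff_coord i).continuous.comp hx
  unfold densityRate
  fun_prop (disch := assumption)

lemma continuous_production {α : Type*} [TopologicalSpace α] {p : ℝ} (hp : 3 ≤ p) (a : ℝ) {δ : ℝ}
    (hδ : 0 < δ) {f : ℝ → ℝ} (hf : ContDiff ℝ ∞ f) {t : α → ℝ} {x : α → Space} {y w : α → ℝ}
    {z : Fin 3 → α → ℝ}
    (ht : Continuous t) (hx : Continuous x) (hy : Continuous y) (hz : ∀ i, Continuous (z i))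
    (hw : Continuous w) :
    Continuous fun b => production p a δ f (t b) (x b) (y b) (fun i => z i b) (w b) := by
  have hρ : Continuous fun b => rho δ (x b) := (continuous_rho δ).comp hx
  have hρ0 : ∀ b, rho δ (x b) ≠ 0 := fun b => (rho_pos hδ _).ne'
  have hρ2 : ∀ b, rho δ (x b) ^ 2 ≠ 0 := fun b => pow_ne_zero _ (hρ0 b)
  have h0 := hf.continuous
  have h1 := (contDiff_deriv hf).continuous
  have h2 := (contDiff_deriv (contDiff_deriv hf)).continuous
  have hV := continuous_potential hp
  have hxi : ∀ i, Continuous fun b => x b i := fun i => (contDiff_coord i).continuous.comp hx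
  unfold production
  fun_prop (disch := assumption)

lemma continuous_density {α : Type*} [TopologicalSpace α] {p : ℝ} (hp : 3 ≤ p) (a : ℝ) {δ : ℝ}
    (hδ : 0 < δ) {f : ℝ → ℝ} (hf : ContDiff ℝ ∞ f) {t : α → ℝ} {x : α → Space} {y w : α → ℝ}
    {z : Fin 3 → α → ℝ}
    (ht : Continuous t) (hx : Continuous x) (hy : Continuous y) (hz : ∀ i, Continuous (z i))
    (hw : Continuous w) :
    Continuous fun b => density p a δ f (t b) (x b) (y b) (fun i => z i b) (w b) := by
  have hρ : Continuous fun b => rho δ (x b) := (continuous_rho δ).comp hx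
  have hρ0 : ∀ b, rho δ (x b) ≠ 0 := fun b => (rho_pos hδ _).ne'
  have h0 := hf.continuous
  have h1 := (contDiff_deriv hf).continuous
  have hV := continuous_potential hp
  have hxi : ∀ i, Continuous fun b => x b i := fun i => (contDiff_coord i).continuous.comp hx
  unfold density
  fun_prop (disch := assumption)

/-- The integrated flux identity. -/
lemma integral_densityRate_eq {p : ℝ} (hp : 3 ≤ p) (a : ℝ) {δ : ℝ} (hδ : 0 < δ) {f : ℝ → ℝ}
    (hf : ContDiff ℝ ∞ f) {R : ℝ} (hR : ∀ s < -R, f s = 0) (t : ℝ) {v w : Space → ℝ}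
    (hv : ContDiff ℝ ∞ v) (hw : ContDiff ℝ ∞ w) :
    ∫ x, densityRate p a δ f t x (v x) (fun i => pd i v x) (w x) (fun i => pd i w x)
        (∑ i, pd i (pd i v) x)
      = ∫ x, production p a δ f t x (v x) (fun i => pd i v x) (w x) := by
  have hF := contDiff_flux hp a hδ hf t hv hw
  have hFc : ∀ i, HasCompactSupport (flux p a δ f t v w i) := fun i =>
    hasCompactSupport_of_eq_zero fun x hx => flux_eq_zero hR hx v w i
  have hP : Integrable fun x => production p a δ f t x (v x) (fun i => pd i v x) (w x) :=
    (continuous_production hp a hδ hf continuous_const continuous_id hv.continuous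
      (fun i => (contDiff_pd hv i).continuous) hw.continuous).integrable_of_hasCompactSupport
      (hasCompactSupport_of_eq_zero fun x hx => production_eq_zero hR hx _ _ _)
  have hD : ∀ i, Integrable (pd i (flux p a δ f t v w i)) := fun i =>
    (((hF i).continuous_fderiv one_ne_zero).clm_apply
      continuous_const).integrable_of_hasCompactSupport (hasCompactSupport_pd (hFc i) i)
  simp only [densityRate_eq hp a hδ hf t hv hw]
  rw [integral_add hP (integrable_finsetSum _ fun i _ => hD i), integral_finsetSum _ fun i _ => hD i,
    Finset.sum_eq_zero fun i _ => integral_pd_eq_zero (hF i) (hFc i) i, add_zero]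

/-! ### Hardy's inequality -/

lemma eLpNorm_two_sq {α E : Type*} [MeasurableSpace α] [NormedAddCommGroup E] (f : α → E)
    (μ : Measure α) : eLpNorm f 2 μ ^ 2 = ∫⁻ x, ‖f x‖ₑ ^ 2 ∂μ := by
  simpa using eLpNorm_nnreal_pow_eq_lintegral (p := 2) (f := f) (μ := μ) (by norm_num)

lemma eLpNorm_two_sq_real {α : Type*} [MeasurableSpace α] (f : α → ℝ)
    (μ : Measure α) : eLpNorm f 2 μ ^ 2 = ∫⁻ x, ENNReal.ofReal (f x ^ 2) ∂μ := by
  rw [eLpNorm_two_sq]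
  refine lintegral_congr fun x => ?_
  rw [← ofReal_norm, ← ENNReal.ofReal_pow (norm_nonneg _), Real.norm_eq_abs, sq_abs]

/-- The mean of the square of an `L⁶` function over a ball of radius `r` is `o(r⁻¹)`. -/
lemma tendsto_div_eLpNorm_two_ball {v : Space → ℝ} (hv : MemLp v 6 volume) :
    Tendsto (fun n : ℕ => (ENNReal.ofReal (n + 1))⁻¹
      * eLpNorm v 2 (volume.restrict (Metric.closedBall 0 (n + 1)))) atTop (𝓝 0) := by
  set c : ℝ≥0∞ := volume (Metric.closedBall (0 : Space) 1) ^ (1 / (2 : ℝ) - 1 / 6)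
  have hc : c ≠ ⊤ := ENNReal.rpow_ne_top_of_nonneg (by norm_num) measure_closedBall_lt_top.ne
  have hr : ∀ n : ℕ, ENNReal.ofReal ((n : ℝ) + 1) ≠ 0 := fun n => by
    simp only [ne_eq, ENNReal.ofReal_eq_zero, not_le]; positivity
  have hvol : ∀ n : ℕ, volume (Metric.closedBall (0 : Space) (n + 1)) ^ (1 / (2 : ℝ) - 1 / 6)
      = ENNReal.ofReal (n + 1) * c := by
    intro n
    rw [Measure.addHaar_closedBall' _ _ (by positivity), ENNReal.mul_rpow_of_nonneg _ _ (by norm_num)]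
    congr 1
    rw [ENNReal.ofReal_pow (by positivity), ← ENNReal.rpow_natCast, ← ENNReal.rpow_mul]
    simp
    norm_num
  rw [ENNReal.tendsto_atTop_zero]
  intro ε hε
  obtain ⟨e, he0, he⟩ : ∃ e : ℝ≥0∞, e ≠ 0 ∧ e * c ≤ ε / 2 := by
    refine ⟨ε / 2 / (c + 1), ?_, ?_⟩
    · exact (ENNReal.div_pos (ENNReal.half_pos hε.ne').ne' (by finiteness)).ne'
    · calc ε / 2 / (c + 1) * c ≤ ε / 2 / (c + 1) * (c + 1) := by gcongr; simp
        _ = ε / 2 := ENNReal.div_mul_cancel (by simp) (by finiteness)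
  -- up to a small error in `L⁶`, which costs a power of `r` by Hölder's inequality, `v` is compactly
  -- supported
  obtain ⟨g, hgc, hvg, hg, hg6⟩ := hv.exists_hasCompactSupport_eLpNorm_sub_le (by norm_num) he0
  have hg2 : eLpNorm g 2 volume ≠ ⊤ := (hg.memLp_of_hasCompactSupport hgc).2.ne
  have ht : Tendsto (fun n : ℕ => (ENNReal.ofReal (n + 1))⁻¹ * eLpNorm g 2 volume) atTop (𝓝 0) := by
    have h1 : Tendsto (fun n : ℕ => (ENNReal.ofReal (n + 1))⁻¹) atTop (𝓝 0) := by
      rw [← ENNReal.inv_top]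
      refine tendsto_inv_iff.2 ?_
      exact ENNReal.tendsto_ofReal_atTop.comp
        (tendsto_atTop_add_const_right _ _ tendsto_natCast_atTop_atTop)
    simpa using ENNReal.Tendsto.mul_const h1 (Or.inr hg2)
  obtain ⟨N, hN⟩ := ENNReal.tendsto_atTop_zero.1 ht (ε / 2) (ENNReal.half_pos hε.ne')
  refine ⟨N, fun n hn => ?_⟩
  set μ := volume.restrict (Metric.closedBall (0 : Space) (n + 1))
  have hsum : eLpNorm v 2 μ ≤ eLpNorm g 2 volume + e * (ENNReal.ofReal (n + 1) * c) := by
    calc eLpNorm v 2 μ = eLpNorm (g + (v - g)) 2 μ := by congr 1; abel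
      _ ≤ eLpNorm g 2 μ + eLpNorm (v - g) 2 μ :=
          eLpNorm_add_le hg.aestronglyMeasurable (hv.1.restrict.sub hg.aestronglyMeasurable)
            (by norm_num)
      _ ≤ eLpNorm g 2 volume + eLpNorm (v - g) 6 μ * μ univ ^ (1 / (2 : ℝ) - 1 / 6) := by
          gcongr
          · exact Measure.restrict_le_self
          · have := eLpNorm_le_eLpNorm_mul_rpow_measure_univ (p := 2) (q := 6) (μ := μ)
              (by norm_num) (hv.1.restrict.sub hg.aestronglyMeasurable)
            simpa using this
      _ ≤ _ := by
          rw [Measure.restrict_apply_univ, hvol]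
          gcongr
          exact (eLpNorm_mono_measure _ Measure.restrict_le_self).trans hvg
  calc (ENNReal.ofReal (n + 1))⁻¹ * eLpNorm v 2 μ
      ≤ (ENNReal.ofReal (n + 1))⁻¹ * (eLpNorm g 2 volume + e * (ENNReal.ofReal (n + 1) * c)) := by
        gcongr
    _ = (ENNReal.ofReal (n + 1))⁻¹ * eLpNorm g 2 volume
        + (ENNReal.ofReal (n + 1))⁻¹ * ENNReal.ofReal (n + 1) * (e * c) := by ring
    _ ≤ ε / 2 + ε / 2 := by
        gcongr
        · exact hN n hn
        · rw [ENNReal.inv_mul_cancel (hr n) ENNReal.ofReal_ne_top, one_mul]; exact he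
    _ = ε := ENNReal.add_halves ε

/-- The derivative of the smooth step function is bounded. -/
lemma exists_deriv_smoothTransition_le : ∃ C, ∀ s, |deriv Real.smoothTransition s| ≤ C := by
  have hs : ContDiff ℝ ∞ Real.smoothTransition := Real.smoothTransition.contDiff (n := ⊤)
  have hc : HasCompactSupport (deriv Real.smoothTransition) := by
    refine HasCompactSupport.intro (isCompact_Icc (a := (0 : ℝ)) (b := 1)) fun s hs => ?_
    rw [mem_Icc, not_and_or, not_le, not_le] at hs
    rcases hs with hs | hs
    · have : Real.smoothTransition =ᶠ[𝓝 s] fun _ => 0 := by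
        filter_upwards [gt_mem_nhds hs] with r hr using Real.smoothTransition.zero_of_nonpos hr.le
      rw [this.deriv_eq, deriv_const]
    · have : Real.smoothTransition =ᶠ[𝓝 s] fun _ => 1 := by
        filter_upwards [lt_mem_nhds hs] with r hr using Real.smoothTransition.one_of_one_le hr.le
      rw [this.deriv_eq, deriv_const]
  obtain ⟨C, hC⟩ := hc.exists_bound_of_continuous (contDiff_deriv hs).continuous
  exact ⟨C, fun s => by simpa using hC s⟩

/-- The field `χ x v² / ρ²`, with the cut-off `χ = step (2 - ρ / r)`. -/
def hardyField (δ r : ℝ) (v : Space → ℝ) (i : Fin 3) (x : Space) : ℝ :=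
  Real.smoothTransition (2 - rho δ x / r) * x i / rho δ x ^ 2 * v x ^ 2

lemma smoothTransition_contDiff : ContDiff ℝ ∞ Real.smoothTransition :=
  Real.smoothTransition.contDiff (n := ⊤)

lemma contDiff_hardyField {δ : ℝ} (hδ : 0 < δ) (r : ℝ) {v : Space → ℝ} (hv : ContDiff ℝ ∞ v)
    (i : Fin 3) : ContDiff ℝ ∞ (hardyField δ r v i) :=
  ((((smoothTransition_contDiff.comp (contDiff_const.sub ((contDiff_rho hδ).div_const r))).mul
    (contDiff_coord i)).div ((contDiff_rho hδ).pow 2)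
      fun x => pow_ne_zero _ (rho_pos hδ x).ne')).mul (hv.pow 2)

lemma pd_hardyField {δ r : ℝ} (hδ : 0 < δ) {v : Space → ℝ} (hv : ContDiff ℝ ∞ v)
    (i : Fin 3) (x : Space) : pd i (hardyField δ r v i) x =
      ((-(deriv Real.smoothTransition (2 - rho δ x / r) * (x i / rho δ x / r)) * x i
          + Real.smoothTransition (2 - rho δ x / r)) / rho δ x ^ 2
        - 2 * Real.smoothTransition (2 - rho δ x / r) * x i * (x i / rho δ x) / rho δ x ^ 3)
          * v x ^ 2
        + 2 * Real.smoothTransition (2 - rho δ x / r) * x i / rho δ x ^ 2 * v x * pd i v x := by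
  have h1 : (1 : WithTop ℕ∞) ≤ (∞ : WithTop ℕ∞) := by simp
  have hρ0 := (rho_pos hδ x).ne'
  have hρ0' : rho δ (x + (0 : ℝ) • basisVec i) ≠ 0 := (rho_pos hδ _).ne'
  have hρ := hasDerivAt_rho_line hδ x i
  have hs : HasDerivAt (fun s : ℝ => Real.smoothTransition (2 - rho δ (x + s • basisVec i) / r))
      (-(deriv Real.smoothTransition (2 - rho δ x / r) * (x i / rho δ x / r))) 0 := by
    have h2 : HasDerivAt Real.smoothTransition (deriv Real.smoothTransition (2 - rho δ x / r))
        (2 - rho δ (x + (0 : ℝ) • basisVec i) / r) := by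
      simpa using
        (smoothTransition_contDiff.differentiable (by simp)).differentiableAt.hasDerivAt
    exact (HasDerivAt.comp (h₂ := Real.smoothTransition) (0 : ℝ) h2
      ((hρ.div_const r).const_sub 2)).congr_deriv (by ring)
  have hv0 := hasDerivAt_line (hv.of_le h1) x i
  have main := ((hs.mul (hasDerivAt_coord x i i)).div (hρ.pow 2) (pow_ne_zero _ hρ0')).mul
    (hv0.pow 2)
  rw [(hasDerivAt_line ((contDiff_hardyField hδ r hv i).of_le h1) x i).unique main]
  simp only [Pi.mul_apply, Pi.div_apply, Pi.pow_apply, zero_smul, add_zero]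
  simp
  field_simp

/-- Hardy's inequality with a cut-off, before integration: the divergence of `hardyField` produces
`v² / ρ²`, and the cross term is absorbed by completing a square. The last term comes from the
cut-off. -/
lemma hardy_pointwise {δ r C : ℝ} (hδ : 0 < δ) (hr : 0 < r)
    (hC : ∀ s, |deriv Real.smoothTransition s| ≤ C)
    {v : Space → ℝ} (hv : ContDiff ℝ ∞ v) (x : Space) :
    1 / 2 * (Real.smoothTransition (2 - rho δ x / r) * (v x / rho δ x) ^ 2)
      ≤ ∑ i, pd i (hardyField δ r v i) x + 2 * ∑ i, pd i v x ^ 2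
        + C / r ^ 2 * (Metric.closedBall (0 : Space) (2 * r)).indicator (fun y => v y ^ 2) x := by
  have hρ := rho_pos hδ x
  set ρ := rho δ x with hρdef
  set χ := Real.smoothTransition (2 - ρ / r) with hχ
  set χ' := deriv Real.smoothTransition (2 - ρ / r) with hχ'
  have hχ0 : 0 ≤ χ := Real.smoothTransition.nonneg _
  have hχ1 : χ ≤ 1 := Real.smoothTransition.le_one _
  have hC0 : 0 ≤ C := (abs_nonneg _).trans (hC 0)
  have hdiv : ∑ i, pd i (hardyField δ r v i) x
      = χ * (3 / ρ ^ 2 - 2 * ‖x‖ ^ 2 / ρ ^ 4) * v x ^ 2 - χ' * ‖x‖ ^ 2 / (r * ρ ^ 3) * v x ^ 2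
        + 2 * χ * (v x / ρ) * ((∑ i, x i * pd i v x) / ρ) := by
    simp only [pd_hardyField hδ hv, norm_sq_eq_sum, Fin.sum_univ_three, ← hρdef, ← hχ, ← hχ']
    field_simp
    ring
  have hq := norm_sq_div_rho_sq_le hδ x
  rw [← hρdef] at hq
  have hrad := sq_radial_le hδ x (fun i => pd i v x)
  rw [← hρdef] at hrad
  set S := (∑ i, x i * pd i v x) / ρ
  set G := ∑ i, pd i v x ^ 2
  have hG : 0 ≤ G := Finset.sum_nonneg fun i _ => sq_nonneg _
  have hSG : S ^ 2 ≤ G := by nlinarith [mul_le_mul_of_nonneg_right hq hG]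
  -- the derivative of the cut-off only lives on `r ≤ ρ ≤ 2 r`
  have hcut : χ' * ‖x‖ ^ 2 / (r * ρ ^ 3) * v x ^ 2
      ≤ C / r ^ 2 * (Metric.closedBall (0 : Space) (2 * r)).indicator (fun y => v y ^ 2) x := by
    have hpos : 0 ≤ C / r ^ 2 * (Metric.closedBall (0 : Space) (2 * r)).indicator
        (fun y => v y ^ 2) x :=
      mul_nonneg (by positivity) (indicator_nonneg (fun y _ => sq_nonneg _) x)
    rcases lt_or_ge ρ r with h1 | h1
    · have : χ' = 0 := by
        have h2 : 1 < 2 - ρ / r := by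
          have : ρ / r < 1 := (div_lt_one hr).2 h1
          linarith
        have : Real.smoothTransition =ᶠ[𝓝 (2 - ρ / r)] fun _ => 1 := by
          filter_upwards [lt_mem_nhds h2] with s hs using Real.smoothTransition.one_of_one_le hs.le
        rw [hχ', this.deriv_eq, deriv_const]
      rw [this]; simpa using hpos
    rcases lt_or_ge (2 * r) ρ with h2 | h2
    · have : χ' = 0 := by
        have h2 : 2 - ρ / r < 0 := by
          have : 2 < ρ / r := (lt_div_iff₀ hr).2 h2
          linarith
        have : Real.smoothTransition =ᶠ[𝓝 (2 - ρ / r)] fun _ => 0 := by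
          filter_upwards [gt_mem_nhds h2] with s hs using Real.smoothTransition.zero_of_nonpos hs.le
        rw [hχ', this.deriv_eq, deriv_const]
      rw [this]; simpa using hpos
    · have hx : x ∈ Metric.closedBall (0 : Space) (2 * r) := by
        simpa using (norm_le_rho δ x).trans h2
      rw [indicator_of_mem hx]
      refine mul_le_mul_of_nonneg_right ?_ (sq_nonneg _)
      have e1 : χ' * ‖x‖ ^ 2 / (r * ρ ^ 3) = χ' * (‖x‖ ^ 2 / ρ ^ 2) / (r * ρ) := by field_simp
      rw [e1]
      have e2 : χ' * (‖x‖ ^ 2 / ρ ^ 2) ≤ C := by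
        have e3 : χ' ≤ C := (le_abs_self _).trans (hC _)
        have e4 : 0 ≤ ‖x‖ ^ 2 / ρ ^ 2 := by positivity
        nlinarith
      exact div_le_div₀ hC0 e2 (by positivity) (by nlinarith)
  have hmain : 1 / 2 * (χ * (v x / ρ) ^ 2)
      ≤ χ * (3 / ρ ^ 2 - 2 * ‖x‖ ^ 2 / ρ ^ 4) * v x ^ 2 + 2 * χ * (v x / ρ) * S + 2 * G := by
    have e1 : χ * (3 / ρ ^ 2 - 2 * ‖x‖ ^ 2 / ρ ^ 4) * v x ^ 2
        = χ * ((3 - 2 * (‖x‖ ^ 2 / ρ ^ 2)) * (v x / ρ) ^ 2) := by field_simp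
    rw [e1]
    have e2 : (v x / ρ) ^ 2 ≤ (3 - 2 * (‖x‖ ^ 2 / ρ ^ 2)) * (v x / ρ) ^ 2 := by
      nlinarith [sq_nonneg (v x / ρ)]
    have e3 : 0 ≤ χ * ((1 / 2) * (v x / ρ + 2 * S) ^ 2
      + ((3 - 2 * (‖x‖ ^ 2 / ρ ^ 2)) * (v x / ρ) ^ 2 - (v x / ρ) ^ 2)) := by
      refine mul_nonneg hχ0 (add_nonneg (by positivity) (by linarith))
    have e4 : χ * (2 * S ^ 2) ≤ 2 * G := by nlinarith [sq_nonneg S]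
    nlinarith
  rw [hdiv]
  linarith

/-- Hardy's inequality for smooth functions. -/
lemma hardy_smooth {δ : ℝ} (hδ : 0 < δ) {v : Space → ℝ} (hv : ContDiff ℝ ∞ v)
    (hv6 : MemLp v 6 volume) (hv2 : ∀ i, MemLp (pd i v) 2 volume) :
    eLpNorm (fun x => v x / rho δ x) 2 volume ^ 2 ≤ 4 * ∑ i, eLpNorm (pd i v) 2 volume ^ 2 := by
  obtain ⟨C, hC⟩ := exists_deriv_smoothTransition_le
  have hC0 : 0 ≤ C := (abs_nonneg _).trans (hC 0)
  have hfin : ∑ i, eLpNorm (pd i v) 2 volume ^ 2 ≠ ⊤ :=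
    ENNReal.sum_ne_top.2 fun i _ => ENNReal.pow_ne_top (hv2 i).2.ne
  have hG : ∫⁻ x, ENNReal.ofReal (∑ i, pd i v x ^ 2) = ∑ i, eLpNorm (pd i v) 2 volume ^ 2 := by
    simp only [eLpNorm_two_sq_real]
    rw [← lintegral_finsetSum]
    · refine lintegral_congr fun x => ENNReal.ofReal_sum_of_nonneg fun i _ => sq_nonneg _
    · intro i _
      exact ((contDiff_pd hv i).continuous.measurable.pow_const 2).ennreal_ofReal
  have hGint : Integrable fun x => ∑ i, pd i v x ^ 2 :=
    integrable_finsetSum _ fun i _ => (hv2 i).integrable_sq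
  -- the inequality with a cut-off of radius `r`
  have hcut : ∀ r : ℝ, 0 < r →
      ∫⁻ x, ENNReal.ofReal (Real.smoothTransition (2 - rho δ x / r) * (v x / rho δ x) ^ 2)
        ≤ 4 * ∑ i, eLpNorm (pd i v) 2 volume ^ 2 + ENNReal.ofReal (2 * C / r ^ 2)
          * eLpNorm v 2 (volume.restrict (Metric.closedBall 0 (2 * r))) ^ 2 := by
    intro r hr
    have hz : ∀ i, ∀ x, 2 * r < ‖x‖ → hardyField δ r v i x = 0 := by
      intro i x hx
      have : 2 - rho δ x / r ≤ 0 := by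
        have : 2 ≤ rho δ x / r := (le_div_iff₀ hr).2 (by linarith [norm_le_rho δ x])
        linarith
      simp [hardyField, Real.smoothTransition.zero_of_nonpos this]
    have hc : ∀ i, HasCompactSupport (hardyField δ r v i) := fun i =>
      hasCompactSupport_of_eq_zero (hz i)
    have h1 : ∀ i, ContDiff ℝ 1 (hardyField δ r v i) := fun i =>
      (contDiff_hardyField hδ r hv i).of_le (by simp)
    have hDint : ∀ i, Integrable (pd i (hardyField δ r v i)) := fun i =>
      (((h1 i).continuous_fderiv one_ne_zero).clm_apply
        continuous_const).integrable_of_hasCompactSupport (hasCompactSupport_pd (hc i) i)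
    have hcontL : Continuous fun x => Real.smoothTransition (2 - rho δ x / r)
        * (v x / rho δ x) ^ 2 := by
      have := continuous_rho δ
      have h0 : ∀ x, rho δ x ≠ 0 := fun x => (rho_pos hδ x).ne'
      have h2 := hv.continuous
      have h3 := smoothTransition_contDiff.continuous
      fun_prop (disch := assumption)
    have hLint : Integrable fun x => Real.smoothTransition (2 - rho δ x / r)
        * (v x / rho δ x) ^ 2 := by
      refine hcontL.integrable_of_hasCompactSupport
        (hasCompactSupport_of_eq_zero (r := 2 * r) fun x hx => ?_)
      have : 2 - rho δ x / r ≤ 0 := by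
        have : 2 ≤ rho δ x / r := (le_div_iff₀ hr).2 (by linarith [norm_le_rho δ x])
        linarith
      simp [Real.smoothTransition.zero_of_nonpos this]
    have hBint : Integrable fun x => (Metric.closedBall (0 : Space) (2 * r)).indicator
        (fun y => v y ^ 2) x := by
      rw [integrable_indicator_iff measurableSet_closedBall]
      exact (hv.continuous.pow 2).continuousOn.integrableOn_compact (isCompact_closedBall _ _)
    have hle : ∫ x, Real.smoothTransition (2 - rho δ x / r) * (v x / rho δ x) ^ 2
        ≤ 4 * (∫ x, ∑ i, pd i v x ^ 2) + 2 * C / r ^ 2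
          * ∫ x, (Metric.closedBall (0 : Space) (2 * r)).indicator (fun y => v y ^ 2) x := by
      have h2 := integral_mono (hLint.const_mul (1 / 2))
        (((integrable_finsetSum _ fun i _ => hDint i).add (hGint.const_mul 2)).add
          (hBint.const_mul (C / r ^ 2))) fun x => hardy_pointwise hδ hr hC hv x
      simp only [Pi.add_apply] at h2
      have h3 : Integrable fun x => ∑ i, pd i (hardyField δ r v i) x + 2 * ∑ i, pd i v x ^ 2 :=
        (integrable_finsetSum _ fun i _ => hDint i).add (hGint.const_mul 2)
      rw [integral_add h3 (hBint.const_mul _), integral_add (integrable_finsetSum _ fun i _ => hDint i)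
        (hGint.const_mul 2), integral_finsetSum _ fun i _ => hDint i,
        Finset.sum_eq_zero fun i _ => integral_pd_eq_zero (h1 i) (hc i) i, integral_const_mul,
        integral_const_mul, integral_const_mul] at h2
      have : 2 * C / r ^ 2 = 2 * (C / r ^ 2) := by ring
      rw [this]
      linarith
    have hA : ∫⁻ x, ENNReal.ofReal (Real.smoothTransition (2 - rho δ x / r)
        * (v x / rho δ x) ^ 2) = ENNReal.ofReal (∫ x, Real.smoothTransition (2 - rho δ x / r)
        * (v x / rho δ x) ^ 2) :=
      (ofReal_integral_eq_lintegral_ofReal hLint (Eventually.of_forall fun x =>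
        mul_nonneg (Real.smoothTransition.nonneg _) (sq_nonneg _))).symm
    have hB : eLpNorm v 2 (volume.restrict (Metric.closedBall 0 (2 * r))) ^ 2
        = ENNReal.ofReal (∫ x, (Metric.closedBall (0 : Space) (2 * r)).indicator
          (fun y => v y ^ 2) x) := by
      rw [eLpNorm_two_sq_real, ofReal_integral_eq_lintegral_ofReal hBint
        (Eventually.of_forall fun x => indicator_nonneg (fun y _ => sq_nonneg _) x),
        ← lintegral_indicator measurableSet_closedBall]
      refine lintegral_congr fun x => ?_
      by_cases hx : x ∈ Metric.closedBall (0 : Space) (2 * r)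
      · simp only [indicator_of_mem hx]
      · simp only [indicator_of_notMem hx, ENNReal.ofReal_zero]
    have hGI : ENNReal.ofReal (∫ x, ∑ i, pd i v x ^ 2) = ∑ i, eLpNorm (pd i v) 2 volume ^ 2 := by
      rw [← hG, ofReal_integral_eq_lintegral_ofReal hGint
        (Eventually.of_forall fun x => Finset.sum_nonneg fun i _ => sq_nonneg _)]
    rw [hA, hB, ← hGI]
    refine (ENNReal.ofReal_le_ofReal hle).trans (ENNReal.ofReal_add_le.trans ?_)
    rw [ENNReal.ofReal_mul (by norm_num), ENNReal.ofReal_mul (by positivity)]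
    simp
  -- the limit of large radii
  rw [eLpNorm_two_sq_real]
  have hrad : ∀ n : ℕ, 0 < ((n : ℝ) + 1) / 2 := fun n => by positivity
  have hlim : Tendsto (fun n : ℕ => 4 * ∑ i, eLpNorm (pd i v) 2 volume ^ 2
      + ENNReal.ofReal (2 * C / (((n : ℝ) + 1) / 2) ^ 2)
        * eLpNorm v 2 (volume.restrict (Metric.closedBall 0 (2 * (((n : ℝ) + 1) / 2)))) ^ 2) atTop
      (𝓝 (4 * ∑ i, eLpNorm (pd i v) 2 volume ^ 2)) := by
    have h1 := ENNReal.Tendsto.const_mul (a := ENNReal.ofReal (8 * C))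
      (ENNReal.Tendsto.pow (n := 2) (tendsto_div_eLpNorm_two_ball hv6)) (Or.inr ENNReal.ofReal_ne_top)
    have h2 := h1.const_add (4 * ∑ i, eLpNorm (pd i v) 2 volume ^ 2)
    simp only [ne_eq, OfNat.ofNat_ne_zero, not_false_eq_true, zero_pow, mul_zero, add_zero] at h2
    refine h2.congr fun n => ?_
    rw [show 2 * (((n : ℝ) + 1) / 2) = n + 1 by ring, mul_pow, ← mul_assoc]
    congr 2
    rw [← ENNReal.ofReal_inv_of_pos (by positivity), ← ENNReal.ofReal_pow (by positivity),
      ← ENNReal.ofReal_mul (by positivity)]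
    congr 1
    field_simp
    ring
  have hpt : ∀ x, ENNReal.ofReal ((v x / rho δ x) ^ 2) = liminf (fun n : ℕ => ENNReal.ofReal
      (Real.smoothTransition (2 - rho δ x / (((n : ℝ) + 1) / 2)) * (v x / rho δ x) ^ 2)) atTop := by
    intro x
    refine (Tendsto.liminf_eq ?_).symm
    refine tendsto_const_nhds.congr' ?_
    filter_upwards [(tendsto_natCast_atTop_atTop (R := ℝ)).eventually_ge_atTop (2 * rho δ x)]
      with n hn
    rw [Real.smoothTransition.one_of_one_le, one_mul]
    have : rho δ x / (((n : ℝ) + 1) / 2) ≤ 1 := by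
      rw [div_le_one (hrad n)]; linarith
    linarith
  simp only [hpt]
  refine (lintegral_liminf_le fun n => ?_).trans ?_
  · have := (continuous_rho δ).measurable
    have h2 := hv.continuous.measurable
    have h3 := smoothTransition_contDiff.continuous.measurable
    exact ((h3.comp ((this.div_const _).const_sub 2)).mul ((h2.div this).pow_const 2)).ennreal_ofReal
  · rw [← hlim.liminf_eq]
    exact liminf_le_liminf (Eventually.of_forall fun n => hcut _ (hrad n))

lemma fderiv_translate {η : Space → ℝ} (hη : ContDiff ℝ ∞ η) (x y z : Space) :
    fderiv ℝ (fun y => η (x - y)) y z = -fderiv ℝ η (x - y) z := by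
  have h1 : HasFDerivAt η (fderiv ℝ η (x - y)) (x - y) :=
    (hη.differentiable (by simp)).differentiableAt.hasFDerivAt
  have h2 := h1.comp y ((hasFDerivAt_id y).const_sub x)
  have h3 : HasFDerivAt (fun y => η (x - y)) _ y := h2
  rw [h3.fderiv]
  simp

/-- Mollification turns the weak gradient into the classical one. -/
lemma HasWeakGradient.pd_mollify {f : Space → ℝ} {g : Space → Space} (h : HasWeakGradient f g)
    {η : Space → ℝ} (hη : ContDiff ℝ ∞ η) (hc : HasCompactSupport η) (i : Fin 3) :
    pd i (mollify η f) = mollify η (fun x => g x i) := by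
  ext x
  rw [SemilinearWave.pd_mollify hη hc h.locallyIntegrable]
  have h1 := h.integral_eq _ (contDiff_translate hη x) (hasCompactSupport_translate hc x)
    (basisVec i)
  simp only [fderiv_translate hη, mul_neg, integral_neg, neg_inj] at h1
  rw [mollify, mollify]
  refine h1.trans (integral_congr_ae (Eventually.of_forall fun y => ?_))
  simp [basisVec, EuclideanSpace.inner_single_right]

lemma memLp_coord {g : Space → Space} {q : ℝ≥0∞} (hg : MemLp g q volume) (i : Fin 3) :
    MemLp (fun x => g x i) q volume :=
  hg.of_le ((contDiff_coord i).continuous.comp_aestronglyMeasurable hg.1)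
    (Eventually.of_forall fun x => PiLp.norm_apply_le (g x) i)

lemma sum_eLpNorm_coord_sq {g : Space → Space} (hg : AEStronglyMeasurable g volume) :
    ∑ i, eLpNorm (fun x => g x i) 2 volume ^ 2 = eLpNorm g 2 volume ^ 2 := by
  simp only [eLpNorm_two_sq]
  rw [← lintegral_finsetSum']
  · refine lintegral_congr fun x => ?_
    simp only [← ofReal_norm, ← ENNReal.ofReal_pow (norm_nonneg _)]
    rw [← ENNReal.ofReal_sum_of_nonneg (fun i _ => by positivity), EuclideanSpace.norm_sq_eq]
  · intro i _
    exact ((contDiff_coord i).continuous.comp_aestronglyMeasurable hg).enorm.pow_const 2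

lemma eLpNorm_coord_le (g : Space → Space) (q : ℝ≥0∞) (i : Fin 3) :
    eLpNorm (fun x => g x i) q volume ≤ eLpNorm g q volume :=
  eLpNorm_mono fun x => PiLp.norm_apply_le (g x) i

section

variable {f : Space → ℝ} {g : Space → Space}

lemma MemHomSobolevOne.locallyIntegrable (h : MemHomSobolevOne f g) :
    LocallyIntegrable f volume := h.hasWeakGradient.locallyIntegrable

/-- Hardy's inequality for the mollifications, with a bound independent of the mollifier. -/
lemma MemHomSobolevOne.hardy_mollify (h : MemHomSobolevOne f g) {δ : ℝ} (hδ : 0 < δ) (n : ℕ) :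
    eLpNorm (fun x => mollify (mollifier n) f x / rho δ x) 2 volume ≤ 2 * eLpNorm g 2 volume := by
  have hsm := contDiff_mollifier n
  have hcs := hasCompactSupport_mollifier n
  have hv := contDiff_mollify hsm hcs h.locallyIntegrable
  have hgi := fun i => memLp_coord h.memLp_grad i
  have hpd : ∀ i, pd i (mollify (mollifier n) f) = mollify (mollifier n) (fun x => g x i) :=
    h.hasWeakGradient.pd_mollify hsm hcs
  have hbd : ∀ i, eLpNorm (pd i (mollify (mollifier n) f)) 2 volume
      ≤ eLpNorm (fun x => g x i) 2 volume := fun i => by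
    rw [hpd]
    exact eLpNorm_mollify_le n ((hgi i).locallyIntegrable (by norm_num)) (by norm_num) (by norm_num)
  have h6 : MemLp (mollify (mollifier n) f) 6 volume :=
    ⟨hv.continuous.aestronglyMeasurable, (eLpNorm_mollify_le n h.locallyIntegrable (by norm_num)
      (by norm_num)).trans_lt h.memLp_six.2⟩
  have h2 : ∀ i, MemLp (pd i (mollify (mollifier n) f)) 2 volume := fun i =>
    ⟨(contDiff_pd hv i).continuous.aestronglyMeasurable, (hbd i).trans_lt (hgi i).2⟩
  have main := hardy_smooth hδ hv h6 h2
  have : eLpNorm (fun x => mollify (mollifier n) f x / rho δ x) 2 volume ^ 2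
      ≤ (2 * eLpNorm g 2 volume) ^ 2 := by
    refine main.trans ?_
    rw [mul_pow, ← sum_eLpNorm_coord_sq h.memLp_grad.1]
    norm_num
    gcongr with i
    exact hbd i
  exact (ENNReal.pow_le_pow_left_iff two_ne_zero).1 this

/-- Hardy's inequality with the regularised distance. -/
lemma MemHomSobolevOne.hardy_rho (h : MemHomSobolevOne f g) {δ : ℝ} (hδ : 0 < δ) :
    eLpNorm (fun x => f x / rho δ x) 2 volume ≤ 2 * eLpNorm g 2 volume := by
  have hsm := contDiff_mollifier
  have hcs := hasCompactSupport_mollifier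
  have hv := fun n => contDiff_mollify (hsm n) (hcs n) h.locallyIntegrable
  have hρ0 : ∀ x, rho δ x ≠ 0 := fun x => (rho_pos hδ x).ne'
  refine (Lp.eLpNorm_lim_le_liminf_eLpNorm (f := fun n x => mollify (mollifier n) f x / rho δ x)
    (fun n => ((hv n).continuous.div (continuous_rho δ) hρ0).aestronglyMeasurable) _ ?_).trans ?_
  · filter_upwards [ae_tendsto_mollify h.locallyIntegrable] with x hx using hx.div_const _
  · exact (liminf_le_liminf (Eventually.of_forall fun n => h.hardy_mollify hδ n)).trans (by simp)

lemma tendsto_rho {ι : Type*} {l : Filter ι} {δ : ι → ℝ} (hδ : Tendsto δ l (𝓝 0)) (x : Space) :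
    Tendsto (fun n => rho (δ n) x) l (𝓝 ‖x‖) := by
  have h : Tendsto (fun n => √(‖x‖ ^ 2 + δ n ^ 2)) l (𝓝 (√(‖x‖ ^ 2 + 0 ^ 2))) :=
    ((hδ.pow 2).const_add _).sqrt
  simpa [rho] using h

lemma ae_norm_ne_zero : ∀ᵐ x : Space, ‖x‖ ≠ 0 := by
  filter_upwards [compl_mem_ae_iff.2 (measure_singleton (μ := volume) (0 : Space))] with x hx
  simpa using hx

/-- Hardy's inequality. -/
lemma MemHomSobolevOne.hardy (h : MemHomSobolevOne f g) :
    eLpNorm (fun x => f x / ‖x‖) 2 volume ≤ 2 * eLpNorm g 2 volume := by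
  have hlim : Tendsto (fun n : ℕ => 1 / ((n : ℝ) + 1)) atTop (𝓝 0) :=
    tendsto_one_div_add_atTop_nhds_zero_nat
  refine (Lp.eLpNorm_lim_le_liminf_eLpNorm (f := fun n x => f x / rho (1 / ((n : ℝ) + 1)) x)
    (fun n => ?_) _ ?_).trans ?_
  · exact (h.memLp_six.1.aemeasurable.div
      (continuous_rho _).aemeasurable).aestronglyMeasurable
  · filter_upwards [ae_norm_ne_zero] with x hx
    exact tendsto_const_nhds.div (tendsto_rho hlim x) hx
  · exact (liminf_le_liminf (Eventually.of_forall fun n => h.hardy_rho (by positivity))).trans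
      (by simp)

lemma MemHomSobolevOne.memLp_div_norm (h : MemHomSobolevOne f g) :
    MemLp (fun x => f x / ‖x‖) 2 volume :=
  ⟨(h.memLp_six.1.aemeasurable.div
    continuous_norm.aemeasurable).aestronglyMeasurable,
    h.hardy.trans_lt (ENNReal.mul_lt_top (by simp) h.memLp_grad.2)⟩

end

/-! ### Evolution of the mollified solution -/

lemma abs_nonlin {p : ℝ} (hp : 3 ≤ p) (y : ℝ) : |nonlin p y| = |y| ^ p := by
  rw [nonlin, abs_mul, abs_of_nonneg (Real.rpow_nonneg (abs_nonneg y) _)]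
  rcases eq_or_ne y 0 with rfl | hy
  · simp [Real.zero_rpow (by linarith : p ≠ 0)]
  · rw [← Real.rpow_add_one (abs_pos.2 hy).ne', sub_add_cancel]

/-- All the powers that occur are controlled by the sixth one, which is integrable for functions in
the energy space. -/
lemma rpow_le_one_add_pow_six {y r : ℝ} (hy : 0 ≤ y) (hr : r ≤ 6) (hr0 : 0 ≤ r) :
    y ^ r ≤ 1 + y ^ 6 := by
  rcases le_total y 1 with h | h
  · have := Real.rpow_le_one hy h hr0
    have : 0 ≤ y ^ 6 := by positivity
    linarith
  · have := Real.rpow_le_rpow_of_exponent_le h hr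
    rw [show (6 : ℝ) = ((6 : ℕ) : ℝ) by norm_num, Real.rpow_natCast] at this
    linarith

lemma locallyIntegrable_one_add_pow_six {f : Space → ℝ} (hf : MemLp f 6 volume) :
    LocallyIntegrable (fun x => 1 + |f x| ^ 6) volume := by
  have h : Integrable (fun x => ‖f x‖ ^ 6) volume := by
    simpa using hf.integrable_norm_rpow (by norm_num) (by norm_num)
  exact (locallyIntegrable_const 1).add h.locallyIntegrable

lemma locallyIntegrable_nonlin {p : ℝ} (hp : 3 ≤ p) (hp' : p ≤ 5) {f : Space → ℝ}
    (hf : MemLp f 6 volume) : LocallyIntegrable (fun x => nonlin p (f x)) volume := by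
  refine (locallyIntegrable_one_add_pow_six hf).mono
    ((continuous_nonlin hp).comp_aestronglyMeasurable hf.1) (Eventually.of_forall fun x => ?_)
  rw [Real.norm_eq_abs, abs_nonlin hp, Real.norm_of_nonneg (by positivity)]
  exact rpow_le_one_add_pow_six (abs_nonneg _) (by linarith) (by linarith)

/-- Mollifications of a curve which is continuous in `L²` are jointly continuous. -/
lemma continuous_mollify_uncurry {η : Space → ℝ} (hη : ContDiff ℝ ∞ η) (hc : HasCompactSupport η)
    {b : ℝ → Space → ℝ} (hb : ∀ t, MemLp (b t) 2 volume)
    (hbc : ∀ t, Tendsto (fun s => eLpNorm (b s - b t) 2 volume) (𝓝 t) (𝓝 0)) :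
    Continuous fun q : ℝ × Space => mollify η (b q.1) q.2 := by
  have hl := fun t => (hb t).locallyIntegrable (by norm_num)
  rw [continuous_iff_continuousAt]
  rintro ⟨t, x⟩
  have h1 : Tendsto (fun q : ℝ × Space => mollify η (b q.1 - b t) q.2) (𝓝 (t, x)) (𝓝 0) := by
    rw [tendsto_iff_edist_tendsto_0]
    have h2 : Tendsto (fun q : ℝ × Space => eLpNorm (b q.1 - b t) 2 volume * eLpNorm η 2 volume)
        (𝓝 (t, x)) (𝓝 0) := by
      have h3 := (hbc t).comp (continuous_fst.tendsto (t, x))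
      simpa using ENNReal.Tendsto.mul_const h3
        (Or.inr (hη.continuous.memLp_of_hasCompactSupport hc).2.ne)
    refine tendsto_of_tendsto_of_tendsto_of_le_of_le tendsto_const_nhds h2 (fun _ => zero_le) ?_
    intro q
    simp only [edist_zero_right]
    exact enorm_mollify_le hη ((hb _).1.sub (hb t).1) q.2
  have h2 : Tendsto (fun q : ℝ × Space => mollify η (b t) q.2) (𝓝 (t, x))
      (𝓝 (mollify η (b t) x)) :=
    ((continuous_mollify hη hc (hl t)).tendsto x).comp (continuous_snd.tendsto (t, x))
  have h3 := h1.add h2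
  rw [zero_add] at h3
  refine h3.congr fun q => ?_
  rw [mollify_sub hη hc (hl _) (hl t)]
  simp

/-- A curve which is continuous in `L²` is bounded on compact intervals. -/
lemma exists_eLpNorm_le {E : Type*} [NormedAddCommGroup E] {b : ℝ → Space → E}
    (hb : ∀ t, MemLp (b t) 2 volume)
    (hbc : ∀ t, Tendsto (fun s => eLpNorm (b s - b t) 2 volume) (𝓝 t) (𝓝 0)) (t₀ t₁ : ℝ) :
    ∃ B : ℝ, 0 ≤ B ∧ ∀ t ∈ Icc t₀ t₁, eLpNorm (b t) 2 volume ≤ ENNReal.ofReal B := by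
  have : Fact ((1 : ℝ≥0∞) ≤ 2) := ⟨by norm_num⟩
  have hcont : Continuous fun t => (hb t).toLp (b t) := by
    rw [continuous_iff_continuousAt]
    intro t
    exact (Lp.tendsto_Lp_iff_tendsto_eLpNorm'' b hb (b t) (hb t)).2 (hbc t)
  obtain ⟨C, hC⟩ := isCompact_Icc.exists_bound_of_continuousOn (s := Icc t₀ t₁) hcont.continuousOn
  refine ⟨max C 0, le_max_right _ _, fun t ht => ?_⟩
  have := hC t ht
  rw [Lp.norm_toLp] at this
  rw [← ENNReal.ofReal_toReal (hb t).2.ne]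
  exact ENNReal.ofReal_le_ofReal (this.trans (le_max_left _ _))

/-- A function which is continuous in `x` and differentiable in `t`, with jointly continuous time
derivative, is jointly continuous. -/
lemma continuous_of_hasDerivAt {φ φ' : ℝ → Space → ℝ} (hx : ∀ t, Continuous (φ t))
    (hd : ∀ t x, HasDerivAt (fun s => φ s x) (φ' t x) t)
    (hc : Continuous fun q : ℝ × Space => φ' q.1 q.2) :
    Continuous fun q : ℝ × Space => φ q.1 q.2 := by
  rw [continuous_iff_continuousAt]
  rintro ⟨t, x⟩
  obtain ⟨C, hC⟩ := ((isCompact_Icc (a := t - 1) (b := t + 1)).prod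
    (isCompact_closedBall x 1)).exists_bound_of_continuousOn hc.continuousOn
  have h1 : Tendsto (fun q : ℝ × Space => φ q.1 q.2 - φ t q.2) (𝓝 (t, x)) (𝓝 0) := by
    refine squeeze_zero_norm' (a := fun q => C * ‖q.1 - t‖) ?_ ?_
    · have hn : Icc (t - 1) (t + 1) ×ˢ Metric.closedBall x 1 ∈ 𝓝 (t, x) :=
        prod_mem_nhds (Icc_mem_nhds (by linarith) (by linarith)) (Metric.closedBall_mem_nhds x one_pos)
      filter_upwards [hn] with q hq
      exact (convex_Icc (t - 1) (t + 1)).norm_image_sub_le_of_norm_hasDerivWithin_le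
        (f := fun s => φ s q.2) (f' := fun s => φ' s q.2) (C := C)
        (fun s hs => (hd s q.2).hasDerivWithinAt) (fun s hs => hC (s, q.2) ⟨hs, hq.2⟩)
        (by constructor <;> linarith) hq.1
    · have : Continuous fun q : ℝ × Space => C * ‖q.1 - t‖ := by fun_prop
      simpa using this.tendsto (t, x)
  have h2 := h1.add (((hx t).tendsto x).comp (continuous_snd.tendsto (t, x)))
  rw [zero_add] at h2
  refine h2.congr fun q => ?_
  simp

lemma eq_sum_basisVec (z : Space) : z = ∑ i, z i • basisVec i := by
  ext j
  simp [basisVec, Pi.single_apply]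

section

variable {p : ℝ} {u : ℝ → Space → ℝ} {Du : ℝ → Space → Space} {ut : ℝ → Space → ℝ}
  {η : Space → ℝ}

lemma IsSolution.memLp_Du (hu : IsSolution p u Du ut) (t : ℝ) : MemLp (Du t) 2 volume :=
  (hu.memHomSobolevOne t).memLp_grad

lemma IsSolution.memLp_Du_coord (hu : IsSolution p u Du ut) (t : ℝ) (i : Fin 3) :
    MemLp (fun x => Du t x i) 2 volume := memLp_coord (hu.memLp_Du t) i

lemma IsSolution.locallyIntegrable_u (hu : IsSolution p u Du ut) (t : ℝ) :
    LocallyIntegrable (u t) volume := (hu.memHomSobolevOne t).locallyIntegrable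

lemma IsSolution.continuous_Du_coord (hu : IsSolution p u Du ut) (i : Fin 3) (t : ℝ) :
    Tendsto (fun s => eLpNorm ((fun x => Du s x i) - fun x => Du t x i) 2 volume) (𝓝 t) (𝓝 0) :=
  tendsto_of_tendsto_of_tendsto_of_le_of_le tendsto_const_nhds (hu.continuous_Du t)
    (fun _ => zero_le) fun s => eLpNorm_coord_le (Du s - Du t) 2 i

lemma IsSolution.pd_mollify (hu : IsSolution p u Du ut) (hη : ContDiff ℝ ∞ η)
    (hc : HasCompactSupport η) (t : ℝ) (i : Fin 3) :
    pd i (mollify η (u t)) = mollify η (fun x => Du t x i) :=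
  (hu.memHomSobolevOne t).hasWeakGradient.pd_mollify hη hc i

lemma IsSolution.hasDerivAt_mollify_u (hu : IsSolution p u Du ut) (hη : ContDiff ℝ ∞ η)
    (hc : HasCompactSupport η) (t : ℝ) (x : Space) :
    HasDerivAt (fun s => mollify η (u s) x) (mollify η (ut t) x) t :=
  hu.hasDerivAt_u _ (contDiff_translate hη x) (hasCompactSupport_translate hc x) t

lemma IsSolution.hasDerivAt_pd_mollify_u (hu : IsSolution p u Du ut) (hη : ContDiff ℝ ∞ η)
    (hc : HasCompactSupport η) (i : Fin 3) (t : ℝ) (x : Space) :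
    HasDerivAt (fun s => pd i (mollify η (u s)) x) (pd i (mollify η (ut t)) x) t := by
  have h1 : ∀ s, pd i (mollify η (u s)) x = mollify (pd i η) (u s) x := fun s => by
    rw [SemilinearWave.pd_mollify hη hc (hu.locallyIntegrable_u s)]
  simp only [h1]
  rw [SemilinearWave.pd_mollify hη hc ((hu.memLp_ut t).locallyIntegrable (by norm_num))]
  exact hu.hasDerivAt_mollify_u (contDiff_pd hη i) (hasCompactSupport_pd hc i) t x

/-- The mollified solution solves the wave equation with the mollified nonlinearity. -/
lemma IsSolution.hasDerivAt_mollify_ut (hu : IsSolution p u Du ut) (hη : ContDiff ℝ ∞ η)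
    (hc : HasCompactSupport η) (t : ℝ) (x : Space) :
    HasDerivAt (fun s => mollify η (ut s) x)
      (∑ i, pd i (pd i (mollify η (u t))) x - mollify η (fun y => nonlin p (u t y)) x) t := by
  have h := hu.hasDerivAt_ut _ (contDiff_translate hη x) (hasCompactSupport_translate hc x) t
  refine h.congr_deriv ?_
  have h1 : ∫ y, fderiv ℝ (fun y => η (x - y)) y (Du t y)
      = -∑ i, pd i (pd i (mollify η (u t))) x := by
    have h2 : ∀ y, fderiv ℝ (fun y => η (x - y)) y (Du t y)
        = -∑ i, Du t y i * pd i η (x - y) := by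
      intro y
      rw [fderiv_translate hη]
      conv_lhs => rw [eq_sum_basisVec (Du t y)]
      simp [pd]
    simp only [h2, integral_neg]
    rw [integral_finsetSum _ fun i _ => integrable_mul_translate (contDiff_pd hη i)
      (hasCompactSupport_pd hc i) ((hu.memLp_Du_coord t i).locallyIntegrable (by norm_num)) x]
    congr 1
    refine Finset.sum_congr rfl fun i _ => ?_
    rw [hu.pd_mollify hη hc, SemilinearWave.pd_mollify hη hc
      ((hu.memLp_Du_coord t i).locallyIntegrable (by norm_num))]
    rfl
  rw [h1, neg_neg]
  rfl

lemma IsSolution.continuous_mollify_ut (hu : IsSolution p u Du ut) (hη : ContDiff ℝ ∞ η)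
    (hc : HasCompactSupport η) : Continuous fun q : ℝ × Space => mollify η (ut q.1) q.2 :=
  continuous_mollify_uncurry hη hc hu.memLp_ut hu.continuous_ut

lemma IsSolution.continuous_mollify_u (hu : IsSolution p u Du ut) (hη : ContDiff ℝ ∞ η)
    (hc : HasCompactSupport η) : Continuous fun q : ℝ × Space => mollify η (u q.1) q.2 :=
  continuous_of_hasDerivAt (fun t => continuous_mollify hη hc (hu.locallyIntegrable_u t))
    (hu.hasDerivAt_mollify_u hη hc) (hu.continuous_mollify_ut hη hc)

lemma IsSolution.continuous_pd_mollify_u (hu : IsSolution p u Du ut) (hη : ContDiff ℝ ∞ η)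
    (hc : HasCompactSupport η) (i : Fin 3) :
    Continuous fun q : ℝ × Space => pd i (mollify η (u q.1)) q.2 := by
  simp only [hu.pd_mollify hη hc]
  exact continuous_mollify_uncurry hη hc (hu.memLp_Du_coord · i) (hu.continuous_Du_coord i)

lemma IsSolution.continuous_pd_mollify_ut (hu : IsSolution p u Du ut) (hη : ContDiff ℝ ∞ η)
    (hc : HasCompactSupport η) (i : Fin 3) :
    Continuous fun q : ℝ × Space => pd i (mollify η (ut q.1)) q.2 := by
  have : ∀ t, pd i (mollify η (ut t)) = mollify (pd i η) (ut t) := fun t =>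
    SemilinearWave.pd_mollify hη hc ((hu.memLp_ut t).locallyIntegrable (by norm_num)) i
  simp only [this]
  exact hu.continuous_mollify_ut (contDiff_pd hη i) (hasCompactSupport_pd hc i)

lemma IsSolution.continuous_laplace_mollify_u (hu : IsSolution p u Du ut) (hη : ContDiff ℝ ∞ η)
    (hc : HasCompactSupport η) :
    Continuous fun q : ℝ × Space => ∑ i, pd i (pd i (mollify η (u q.1))) q.2 := by
  refine continuous_finsetSum _ fun i _ => ?_
  have : ∀ t, pd i (pd i (mollify η (u t))) = mollify (pd i η) (fun x => Du t x i) := fun t => by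
    rw [hu.pd_mollify hη hc, SemilinearWave.pd_mollify hη hc
      ((hu.memLp_Du_coord t i).locallyIntegrable (by norm_num))]
  simp only [this]
  exact continuous_mollify_uncurry (contDiff_pd hη i) (hasCompactSupport_pd hc i)
    (hu.memLp_Du_coord · i) (hu.continuous_Du_coord i)

/-- The mollified nonlinearity need not be continuous in time, but it is jointly measurable: by the
equation it differs from a continuous function by a time derivative of a continuous function. -/
lemma IsSolution.measurable_mollify_nonlin (hu : IsSolution p u Du ut) (hη : ContDiff ℝ ∞ η)
    (hc : HasCompactSupport η) :
    Measurable fun q : ℝ × Space => mollify η (fun y => nonlin p (u q.1 y)) q.2 := by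
  have h1 : Measurable fun q : Space × ℝ => deriv (fun s => mollify η (ut s) q.1) q.2 :=
    measurable_deriv_with_param (f := fun (x : Space) (s : ℝ) => mollify η (ut s) x)
      ((hu.continuous_mollify_ut hη hc).comp continuous_swap)
  have h2 := (hu.continuous_laplace_mollify_u hη hc).measurable.sub (h1.comp measurable_swap)
  convert h2 using 1
  ext q
  simp only [Pi.sub_apply, Function.comp, Prod.fst_swap, Prod.snd_swap,
    (hu.hasDerivAt_mollify_ut hη hc q.1 q.2).deriv]
  ring

end

/-- The time derivative of the density along a solution of `w' = ℓ - N(y) + e`. -/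
lemma hasDerivAt_density {p : ℝ} (hp : 3 ≤ p) (a : ℝ) {δ : ℝ} (hδ : 0 < δ) {f : ℝ → ℝ}
    (hf : ContDiff ℝ ∞ f) (x : Space) {y w : ℝ → ℝ} {z : Fin 3 → ℝ → ℝ} {wz : Fin 3 → ℝ} {ℓ e t : ℝ}
    (hy : HasDerivAt y (w t) t) (hz : ∀ i, HasDerivAt (z i) (wz i) t)
    (hw : HasDerivAt w (ℓ - nonlin p (y t) + e) t) :
    HasDerivAt (fun s => density p a δ f s x (y s) (fun i => z i s) (w s))
      (densityRate p a δ f t x (y t) (fun i => z i t) (w t) wz ℓ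
        + 1 / 2 * f (t - rho δ x) * e * (w t - a * ((∑ i, x i * z i t + y t) / rho δ x))) t := by
  have hρ0 := (rho_pos hδ x).ne'
  have hφ : ∀ {g : ℝ → ℝ}, ContDiff ℝ ∞ g → HasDerivAt (fun s : ℝ => g (s - rho δ x))
      (deriv g (t - rho δ x)) t := by
    intro g hg
    have h2 : HasDerivAt g (deriv g (t - rho δ x)) (t - rho δ x) :=
      (hg.differentiable (by simp)).differentiableAt.hasDerivAt
    exact h2.comp_sub_const t (rho δ x)
  have hV : HasDerivAt (fun s => potential p (y s)) (nonlin p (y t) * w t) t :=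
    HasDerivAt.comp (h₂ := potential p) t (hasDerivAt_potential hp (y t)) hy
  have hs1 := HasDerivAt.fun_sum (u := Finset.univ) fun i _ => (hz i).pow 2
  have hs2 := HasDerivAt.fun_sum (u := Finset.univ) fun i _ => (hz i).const_mul (x i)
  have main := (((hφ hf).const_mul (1 / 2)).mul (((hs1.const_mul (1 / 2)).add
    ((hw.pow 2).const_mul (1 / 2))).add hV)).sub (((((hφ hf).const_mul (1 / 2)).mul hw).mul
    ((hs2.add hy).div_const (rho δ x))).sub ((((hφ (contDiff_deriv hf)).const_mul (1 / 4)).mul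
    (hy.pow 2)).div_const (rho δ x)) |>.const_mul a)
  refine main.congr_deriv ?_
  simp only [densityRate, Fin.sum_univ_three, Pi.mul_apply, Pi.add_apply, Pi.pow_apply]
  simp only [Nat.cast_ofNat, Nat.add_one_sub_one, pow_one]
  field_simp
  ring

/-! ### The integrated inequality for the mollified solution -/

/-- Cauchy–Schwarz for lower integrals. -/
lemma lintegral_enorm_mul_le {α : Type*} [MeasurableSpace α] {μ : Measure α} {f g : α → ℝ}
    (hf : AEStronglyMeasurable f μ) (hg : AEStronglyMeasurable g μ) :
    ∫⁻ x, ‖f x * g x‖ₑ ∂μ ≤ eLpNorm f 2 μ * eLpNorm g 2 μ := by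
  have := eLpNorm_smul_le_mul_eLpNorm (p := 2) (q := 2) (r := 1) (μ := μ) (φ := f) hg hf
  simpa only [smul_eq_mul, eLpNorm_one_eq_lintegral_enorm, Pi.mul_apply] using this

/-- The localised functional of a state `(v, z, w)`, where `z` is the gradient of `v`. -/
def functional (p a δ : ℝ) (f : ℝ → ℝ) (t : ℝ) (v : Space → ℝ) (z : Fin 3 → Space → ℝ)
    (w : Space → ℝ) : ℝ :=
  ∫ x, density p a δ f t x (v x) (fun i => z i x) (w x)

/-- The commutator `N(u ∗ η) - N(u) ∗ η` of the nonlinearity with mollification. -/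
def commutator (p : ℝ) (η v : Space → ℝ) (x : Space) : ℝ :=
  nonlin p (mollify η v x) - mollify η (fun y => nonlin p (v y)) x

/-- The radial derivative is bounded by the gradient. -/
lemma abs_radial_le {δ : ℝ} (hδ : 0 < δ) (x : Space) (z : Fin 3 → ℝ) :
    |(∑ i, x i * z i) / rho δ x| ≤ ∑ i, |z i| := by
  have hρ := rho_pos hδ x
  rw [abs_div, abs_of_pos hρ, div_le_iff₀ hρ, Finset.sum_mul]
  refine (Finset.abs_sum_le_sum_abs _ _).trans (Finset.sum_le_sum fun i _ => ?_)
  rw [abs_mul, mul_comm]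
  gcongr
  exact (PiLp.norm_apply_le x i).trans (norm_le_rho δ x)

/-- The multiplier is bounded in `L²` by the energy norm, by Hardy's inequality. -/
lemma eLpNorm_multiplier_le {δ : ℝ} (hδ : 0 < δ) (a : ℝ) {v w : Space → ℝ} {z : Fin 3 → Space → ℝ}
    (hv : AEStronglyMeasurable v volume) (hw : AEStronglyMeasurable w volume)
    (hz : ∀ i, AEStronglyMeasurable (z i) volume) {B : ℝ≥0∞}
    (hvB : eLpNorm (fun x => v x / rho δ x) 2 volume ≤ 2 * B)
    (hwB : eLpNorm w 2 volume ≤ B) (hzB : ∀ i, eLpNorm (z i) 2 volume ≤ B) :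
    eLpNorm (fun x => w x - a * ((∑ i, x i * z i x + v x) / rho δ x)) 2 volume
      ≤ (1 + 5 * ENNReal.ofReal |a|) * B := by
  have hvρ : AEStronglyMeasurable (fun x => v x / rho δ x) volume :=
    (hv.aemeasurable.div (continuous_rho δ).aemeasurable).aestronglyMeasurable
  have hzn : ∀ i, AEStronglyMeasurable (fun x => |z i x|) volume := fun i => (hz i).norm
  have h1 : eLpNorm (fun x => (∑ i, x i * z i x + v x) / rho δ x) 2 volume ≤ 5 * B := by
    have h2 : eLpNorm (fun x => (∑ i, x i * z i x + v x) / rho δ x) 2 volume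
        ≤ eLpNorm ((∑ i, fun x => |z i x|) + fun x => |v x / rho δ x|) 2 volume := by
      refine eLpNorm_mono fun x => ?_
      simp only [Pi.add_apply, Finset.sum_apply, Real.norm_eq_abs]
      rw [add_div]
      refine (abs_add_le _ _).trans ((add_le_add_left (abs_radial_le hδ x _) _).trans
        (le_abs_self _))
    refine h2.trans ?_
    refine (eLpNorm_add_le (Finset.aestronglyMeasurable_sum _ fun i _ => hzn i) hvρ.norm
      (by norm_num)).trans ?_
    have h3 : eLpNorm (∑ i, fun x => |z i x|) 2 volume ≤ ∑ _i : Fin 3, B :=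
      (eLpNorm_sum_le (fun i _ => hzn i) (by norm_num)).trans
        (Finset.sum_le_sum fun i _ => (eLpNorm_norm (z i)).le.trans (hzB i))
    have h4 : eLpNorm (fun x => |v x / rho δ x|) 2 volume ≤ 2 * B :=
      (eLpNorm_norm (fun x => v x / rho δ x)).le.trans hvB
    calc _ ≤ ∑ _i : Fin 3, B + 2 * B := add_le_add h3 h4
      _ = 5 * B := by simp; ring
  have h5 : AEStronglyMeasurable (fun x => (∑ i, x i * z i x + v x) / rho δ x) volume := by
    refine ((Finset.aemeasurable_fun_sum _ fun i _ => ?_).add hv.aemeasurable |>.div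
      (continuous_rho δ).aemeasurable).aestronglyMeasurable
    exact (contDiff_coord i).continuous.aemeasurable.mul (hz i).aemeasurable
  calc _ ≤ eLpNorm w 2 volume
        + eLpNorm (fun x => a * ((∑ i, x i * z i x + v x) / rho δ x)) 2 volume :=
        eLpNorm_sub_le hw (h5.const_mul a) (by norm_num)
    _ ≤ B + ENNReal.ofReal |a| * (5 * B) := by
        gcongr
        refine (eLpNorm_const_smul_le (c := a)
          (f := fun x => (∑ i, x i * z i x + v x) / rho δ x)).trans ?_
        rw [Real.enorm_eq_ofReal_abs]
        gcongr
    _ = _ := by ring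

section

variable {p : ℝ} {u : ℝ → Space → ℝ} {Du : ℝ → Space → Space} {ut : ℝ → Space → ℝ}

lemma IsSolution.measurable_commutator (hu : IsSolution p u Du ut) (hp : 3 ≤ p) (n : ℕ) :
    Measurable fun q : ℝ × Space => commutator p (mollifier n) (u q.1) q.2 :=
  ((continuous_nonlin hp).measurable.comp (hu.continuous_mollify_u (contDiff_mollifier n)
    (hasCompactSupport_mollifier n)).measurable).sub
    (hu.measurable_mollify_nonlin (contDiff_mollifier n) (hasCompactSupport_mollifier n))

/-- The localised functional of the mollified solution decreases by at most the negative part of the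
production, which Hardy's inequality bounds, and by the pairing of the commutator with the
multiplier. -/
lemma IsSolution.functional_mollify_le (hu : IsSolution p u Du ut) (hp : 3 ≤ p)
    (a : ℝ) {δ : ℝ} (hδ : 0 < δ) {f : ℝ → ℝ} (hf : ContDiff ℝ ∞ f) {R : ℝ}
    (hR : ∀ s < -R, f s = 0) {t₀ t₁ : ℝ} (ht : t₀ ≤ t₁) {C M B : ℝ} (hC0 : 0 ≤ C) (hB0 : 0 ≤ B)
    (hprod : ∀ t ∈ Icc t₀ t₁, ∀ x y z w,
      -(C * (y / rho δ x) ^ 2) ≤ production p a δ f t x y z w)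
    (hM : ∀ t ∈ Icc t₀ t₁, ∀ x, |f (t - rho δ x)| ≤ M)
    (hB : ∀ t ∈ Icc t₀ t₁, eLpNorm (Du t) 2 volume ≤ ENNReal.ofReal B)
    (hB' : ∀ t ∈ Icc t₀ t₁, eLpNorm (ut t) 2 volume ≤ ENNReal.ofReal B) (n : ℕ)
    (hE : ∫⁻ t in Ioc t₀ t₁, eLpNorm (commutator p (mollifier n) (u t)) 2 volume ≠ ⊤) :
    functional p a δ f t₀ (mollify (mollifier n) (u t₀))
        (fun i => pd i (mollify (mollifier n) (u t₀))) (mollify (mollifier n) (ut t₀))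
      ≤ functional p a δ f t₁ (mollify (mollifier n) (u t₁))
        (fun i => pd i (mollify (mollifier n) (u t₁))) (mollify (mollifier n) (ut t₁))
      + C * (2 * B) ^ 2 * (t₁ - t₀)
      + (ENNReal.ofReal M * ((1 + 5 * ENNReal.ofReal |a|) * ENNReal.ofReal B)
        * ∫⁻ t in Ioc t₀ t₁, eLpNorm (commutator p (mollifier n) (u t)) 2 volume).toReal := by
  have hη := contDiff_mollifier n
  have hc := hasCompactSupport_mollifier n
  set η := mollifier n with hηdef
  set K : ℝ≥0∞ := ENNReal.ofReal M * ((1 + 5 * ENNReal.ofReal |a|) * ENNReal.ofReal B)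
  have hK : K ≠ ⊤ := by finiteness
  have hM0 : 0 ≤ M := (abs_nonneg _).trans (hM t₀ (left_mem_Icc.2 ht) 0)
  have cv := hu.continuous_mollify_u hη hc
  have cz := hu.continuous_pd_mollify_u hη hc
  have cw := hu.continuous_mollify_ut hη hc
  have cwz := hu.continuous_pd_mollify_ut hη hc
  have cl := hu.continuous_laplace_mollify_u hη hc
  have sv : ∀ t, ContDiff ℝ ∞ (mollify η (u t)) := fun t =>
    contDiff_mollify hη hc (hu.locallyIntegrable_u t)
  have sw : ∀ t, ContDiff ℝ ∞ (mollify η (ut t)) := fun t =>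
    contDiff_mollify hη hc ((hu.memLp_ut t).locallyIntegrable (by norm_num))
  set d : ℝ → Space → ℝ := fun t x => density p a δ f t x (mollify η (u t) x)
    (fun i => pd i (mollify η (u t)) x) (mollify η (ut t) x) with hd
  set r : ℝ → Space → ℝ := fun t x => densityRate p a δ f t x (mollify η (u t) x)
    (fun i => pd i (mollify η (u t)) x) (mollify η (ut t) x) (fun i => pd i (mollify η (ut t)) x)
    (∑ i, pd i (pd i (mollify η (u t))) x) with hr
  -- the multiplier
  set m : ℝ → Space → ℝ := fun t x => mollify η (ut t) x
    - a * ((∑ i, x i * pd i (mollify η (u t)) x + mollify η (u t) x) / rho δ x) with hm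
  set e : ℝ → Space → ℝ := fun t x => 1 / 2 * f (t - rho δ x) * commutator p η (u t) x * m t x
    with he
  set μ : Measure ℝ := volume.restrict (Ioc t₀ t₁) with hμ
  have hmem : ∀ᵐ t ∂μ, t ∈ Icc t₀ t₁ := by
    filter_upwards [ae_restrict_mem measurableSet_Ioc] with t h using Ioc_subset_Icc_self h
  -- the time derivative of the density
  have hderiv : ∀ t x, HasDerivAt (fun s => d s x) (r t x + e t x) t := by
    intro t x
    refine hasDerivAt_density hp a hδ hf x (y := fun s => mollify η (u s) x)
      (w := fun s => mollify η (ut s) x) (z := fun i s => pd i (mollify η (u s)) x)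
      (hu.hasDerivAt_mollify_u hη hc t x) (fun i => hu.hasDerivAt_pd_mollify_u hη hc i t x) ?_
    refine (hu.hasDerivAt_mollify_ut hη hc t x).congr_deriv ?_
    simp only [commutator]; ring
  -- integrability of the rate and of the error on `(t₀, t₁] × ℝ³`
  have cr : Continuous fun q : ℝ × Space => r q.1 q.2 :=
    continuous_densityRate hp a hδ hf continuous_fst continuous_snd cv cz cw cwz cl
  have hrint : Integrable (fun q : ℝ × Space => r q.1 q.2) (μ.prod volume) := by
    have h1 : IntegrableOn (fun q : ℝ × Space => r q.1 q.2)
        (Icc t₀ t₁ ×ˢ Metric.closedBall 0 (t₁ + R)) (volume.prod volume) :=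
      cr.continuousOn.integrableOn_compact (isCompact_Icc.prod (isCompact_closedBall _ _))
    have h2 : IntegrableOn (fun q : ℝ × Space => r q.1 q.2)
        (Icc t₀ t₁ ×ˢ univ) (volume.prod volume) := by
      refine h1.of_forall_sdiff_eq_zero (measurableSet_Icc.prod MeasurableSet.univ) ?_
      rintro ⟨t, x⟩ ⟨⟨h3, -⟩, h4⟩
      refine densityRate_eq_zero hR ?_ _ _ _ _ _
      by_contra h5
      refine h4 ⟨h3, ?_⟩
      rw [mem_closedBall_zero_iff]
      linarith [h3.2]
    have h3 := h2.mono_set (prod_mono_left (t := univ) Ioc_subset_Icc_self)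
    rwa [IntegrableOn, ← Measure.prod_restrict, Measure.restrict_univ] at h3
  have cm : Continuous fun q : ℝ × Space => m q.1 q.2 := by
    have h1 : Continuous fun q : ℝ × Space => rho δ q.2 := (continuous_rho δ).comp continuous_snd
    have h2 : ∀ q : ℝ × Space, rho δ q.2 ≠ 0 := fun q => (rho_pos hδ _).ne'
    have h3 : ∀ i, Continuous fun q : ℝ × Space => q.2 i := fun i =>
      (contDiff_coord i).continuous.comp continuous_snd
    exact cw.sub (continuous_const.mul (((continuous_finsetSum _ fun i _ =>
      (h3 i).mul (cz i)).add cv).div h1 h2))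
  have cf : Continuous fun q : ℝ × Space => f (q.1 - rho δ q.2) :=
    hf.continuous.comp (continuous_fst.sub ((continuous_rho δ).comp continuous_snd))
  have me : Measurable fun q : ℝ × Space => e q.1 q.2 :=
    ((continuous_const.mul cf).measurable.mul (hu.measurable_commutator hp n)).mul cm.measurable
  have hmB : ∀ t ∈ Icc t₀ t₁,
      eLpNorm (m t) 2 volume ≤ (1 + 5 * ENNReal.ofReal |a|) * ENNReal.ofReal B := by
    intro t h
    refine eLpNorm_multiplier_le hδ a (sv t).continuous.aestronglyMeasurable
      (sw t).continuous.aestronglyMeasurable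
      (fun i => (contDiff_pd (sv t) i).continuous.aestronglyMeasurable) ?_ ?_ ?_
    · exact ((hu.memHomSobolevOne t).hardy_mollify hδ n).trans (by gcongr; exact hB t h)
    · exact (eLpNorm_mollify_le n ((hu.memLp_ut t).locallyIntegrable (by norm_num)) (by norm_num)
        (by norm_num)).trans (hB' t h)
    · intro i
      rw [hu.pd_mollify hη hc]
      exact (eLpNorm_mollify_le n ((hu.memLp_Du_coord t i).locallyIntegrable (by norm_num))
        (by norm_num) (by norm_num)).trans ((eLpNorm_coord_le (Du t) 2 i).trans (hB t h))
  have hcm : ∀ t, Measurable (commutator p η (u t)) := fun t =>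
    (hu.measurable_commutator hp n).comp measurable_prodMk_left
  have hebd : ∫⁻ t, ∫⁻ x, ‖e t x‖ₑ ∂volume ∂μ
      ≤ K * ∫⁻ t in Ioc t₀ t₁, eLpNorm (commutator p η (u t)) 2 volume := by
    rw [← lintegral_const_mul' _ _ hK]
    refine lintegral_mono_ae ?_
    filter_upwards [hmem] with t h
    calc ∫⁻ x, ‖e t x‖ₑ
        ≤ ∫⁻ x, ENNReal.ofReal M * ‖commutator p η (u t) x * m t x‖ₑ := by
          refine lintegral_mono fun x => ?_
          simp only [he]
          rw [mul_assoc, enorm_mul]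
          gcongr
          rw [Real.enorm_eq_ofReal_abs, abs_mul]
          refine ENNReal.ofReal_le_ofReal ?_
          have := hM t h x
          rw [abs_of_pos (by norm_num : (0 : ℝ) < 1 / 2)]
          linarith
      _ = ENNReal.ofReal M * ∫⁻ x, ‖commutator p η (u t) x * m t x‖ₑ :=
          lintegral_const_mul' _ _ ENNReal.ofReal_ne_top
      _ ≤ ENNReal.ofReal M * (eLpNorm (commutator p η (u t)) 2 volume
            * ((1 + 5 * ENNReal.ofReal |a|) * ENNReal.ofReal B)) := by
          gcongr
          refine (lintegral_enorm_mul_le (hcm t).aestronglyMeasurable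
            (cm.comp (Continuous.prodMk_right t)).aestronglyMeasurable).trans ?_
          gcongr
          exact hmB t h
      _ = K * eLpNorm (commutator p η (u t)) 2 volume := by simp only [K]; ring
  have hfinE : K * ∫⁻ t in Ioc t₀ t₁, eLpNorm (commutator p η (u t)) 2 volume ≠ ⊤ :=
    ENNReal.mul_ne_top hK hE
  have heint : Integrable (fun q : ℝ × Space => e q.1 q.2) (μ.prod volume) := by
    refine ⟨me.aestronglyMeasurable, ?_⟩
    rw [HasFiniteIntegral, lintegral_prod _ me.enorm.aemeasurable]
    exact hebd.trans_lt hfinE.lt_top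
  have hint : Integrable (fun q : ℝ × Space => r q.1 q.2 + e q.1 q.2) (μ.prod volume) :=
    hrint.add heint
  -- the fundamental theorem of calculus and Fubini's theorem
  have hdint : ∀ t, Integrable (d t) := fun t =>
    (continuous_density hp a hδ hf continuous_const continuous_id (sv t).continuous
      (fun i => (contDiff_pd (sv t) i).continuous)
      (sw t).continuous).integrable_of_hasCompactSupport
      (hasCompactSupport_of_eq_zero fun x hx => density_eq_zero hR hx _ _ _)
  have hftc : (∫ x, d t₁ x) - ∫ x, d t₀ x
      = (∫ t, ∫ x, r t x ∂volume ∂μ) + ∫ t, ∫ x, e t x ∂volume ∂μ := by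
    rw [← integral_prod _ hrint, ← integral_prod _ heint, ← integral_add hrint heint,
      ← integral_sub (hdint t₁) (hdint t₀), integral_prod_symm _ hint]
    refine integral_congr_ae ?_
    filter_upwards [hint.prod_left_ae] with x hx
    have h1 := intervalIntegral.integral_eq_sub_of_hasDerivAt (f := fun s => d s x)
      (fun t _ => hderiv t x) ((intervalIntegrable_iff_integrableOn_Ioc_of_le ht).2 hx)
    rw [intervalIntegral.integral_of_le ht] at h1
    exact h1.symm
  -- the production is bounded below by Hardy's inequality
  have hlow : -(C * (2 * B) ^ 2 * (t₁ - t₀)) ≤ ∫ t, ∫ x, r t x ∂volume ∂μ := by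
    have h1 : ∀ t ∈ Icc t₀ t₁, -(C * (2 * B) ^ 2) ≤ ∫ x, r t x := by
      intro t h
      have hvρ : MemLp (fun x => mollify η (u t) x / rho δ x) 2 volume :=
        ⟨((sv t).continuous.div (continuous_rho δ)
          fun x => (rho_pos hδ x).ne').aestronglyMeasurable,
          ((hu.memHomSobolevOne t).hardy_mollify hδ n).trans_lt
            (ENNReal.mul_lt_top (by simp) (hu.memLp_Du t).2)⟩
      have h2 : ∫ x, (mollify η (u t) x / rho δ x) ^ 2 ≤ (2 * B) ^ 2 := by
        rw [← ENNReal.ofReal_le_ofReal_iff (by positivity),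
          ofReal_integral_eq_lintegral_ofReal hvρ.integrable_sq
            (Eventually.of_forall fun x => sq_nonneg _), ← eLpNorm_two_sq_real,
          ENNReal.ofReal_pow (by positivity)]
        gcongr
        refine ((hu.memHomSobolevOne t).hardy_mollify hδ n).trans ?_
        rw [ENNReal.ofReal_mul (by norm_num)]
        gcongr
        · simp
        · exact hB t h
      have hP : Integrable fun x => production p a δ f t x (mollify η (u t) x)
          (fun i => pd i (mollify η (u t)) x) (mollify η (ut t) x) :=
        (continuous_production hp a hδ hf continuous_const continuous_id (sv t).continuous
          (fun i => (contDiff_pd (sv t) i).continuous)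
          (sw t).continuous).integrable_of_hasCompactSupport
          (hasCompactSupport_of_eq_zero fun x hx => production_eq_zero hR hx _ _ _)
      rw [hr, integral_densityRate_eq hp a hδ hf hR t (sv t) (sw t)]
      calc -(C * (2 * B) ^ 2) ≤ -(C * ∫ x, (mollify η (u t) x / rho δ x) ^ 2) := by
            gcongr
        _ = ∫ x, -(C * (mollify η (u t) x / rho δ x) ^ 2) := by
            rw [integral_neg, integral_const_mul]
        _ ≤ _ := integral_mono (hvρ.integrable_sq.const_mul C).neg hP fun x => hprod t h x _ _ _
    have h3 : ∫ _t, -(C * (2 * B) ^ 2) ∂μ ≤ ∫ t, ∫ x, r t x ∂volume ∂μ := by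
      refine integral_mono_ae (integrable_const _) hrint.integral_prod_left ?_
      filter_upwards [hmem] with t h using h1 t h
    refine le_trans (le_of_eq ?_) h3
    simp [hμ, ht]
    ring
  have herr : |∫ t, ∫ x, e t x ∂volume ∂μ|
      ≤ (K * ∫⁻ t in Ioc t₀ t₁, eLpNorm (commutator p η (u t)) 2 volume).toReal := by
    rw [← Real.norm_eq_abs, ← toReal_enorm]
    refine ENNReal.toReal_mono hfinE (le_trans ?_ hebd)
    refine (enorm_integral_le_lintegral_enorm _).trans (lintegral_mono fun t => ?_)
    exact enorm_integral_le_lintegral_enorm _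
  have h1 := neg_abs_le (∫ t, ∫ x, e t x ∂volume ∂μ)
  change (∫ x, d t₀ x) ≤ (∫ x, d t₁ x) + _ + _
  linarith

end

/-! ### Continuity of superposition operators -/

/-- A bound on the derivative of power type gives a local Lipschitz bound of power type. -/
lemma abs_sub_le_of_deriv_le {G G' : ℝ → ℝ} {C s : ℝ} (hC : 0 ≤ C) (hs : 1 ≤ s)
    (hG : ∀ y, HasDerivAt G (G' y) y) (hG' : ∀ y, |G' y| ≤ C * |y| ^ (s - 1)) (a b : ℝ) :
    |G a - G b| ≤ C * (|a| + |b|) ^ (s - 1) * |a - b| := by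
  refine (convex_uIcc b a).norm_image_sub_le_of_norm_hasDerivWithin_le (f := G) (f' := G')
    (fun y _ => (hG y).hasDerivWithinAt) (fun y hy => ?_) left_mem_uIcc right_mem_uIcc
  refine (hG' y).trans ?_
  gcongr
  rw [mem_uIcc] at hy
  have h1 := abs_nonneg a
  have h2 := abs_nonneg b
  rcases hy with hy | hy <;>
    exact abs_le.2 ⟨by linarith [neg_abs_le a, neg_abs_le b], by linarith [le_abs_self a, le_abs_self b]⟩

lemma abs_nonlin_sub_le {p : ℝ} (hp : 3 ≤ p) (a b : ℝ) :
    |nonlin p a - nonlin p b| ≤ p * (|a| + |b|) ^ (p - 1) * |a - b| := by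
  refine abs_sub_le_of_deriv_le (G' := fun y => (p - 1) * |y| ^ (p - 1 - 2) * y * y
    + |y| ^ (p - 1)) (by linarith) (by linarith) (fun y => ?_) (fun y => ?_) a b
  · exact ((hasDerivAt_abs_rpow y (p := p - 1) (by linarith)).mul (hasDerivAt_id y)).congr_deriv
      (by simp)
  · have h1 : |y| ^ (p - 1 - 2) * y * y ≤ |y| ^ (p - 1) := by
      rcases eq_or_ne y 0 with rfl | hy
      · simp [Real.zero_rpow (by linarith : p - 1 ≠ 0)]
      · rw [Real.rpow_sub (abs_pos.2 hy), Real.rpow_two, sq_abs]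
        have : y ^ 2 ≠ 0 := pow_ne_zero _ hy
        exact le_of_eq (by field_simp)
    have h2 : 0 ≤ |y| ^ (p - 1 - 2) * y * y := by
      rw [mul_assoc, ← sq]; positivity
    have h3 : 0 ≤ |y| ^ (p - 1) := by positivity
    rw [abs_of_nonneg (by nlinarith)]
    nlinarith

lemma abs_rpow_sub_le {s : ℝ} (hs : 1 < s) (a b : ℝ) :
    |(|a| ^ s) - |b| ^ s| ≤ s * (|a| + |b|) ^ (s - 1) * |a - b| := by
  refine abs_sub_le_of_deriv_le (G := fun y => |y| ^ s) (by linarith) hs.le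
    (fun y => hasDerivAt_abs_rpow y hs) (fun y => ?_) a b
  rcases eq_or_ne y 0 with rfl | hy
  · simp [Real.zero_rpow (by linarith : s - 1 ≠ 0)]
  · rw [abs_mul, abs_mul, abs_of_nonneg (by positivity : 0 ≤ |y| ^ (s - 2)), mul_assoc,
      ← Real.rpow_add_one (abs_pos.2 hy).ne', abs_of_pos (by linarith : 0 < s)]
    exact le_of_eq (by ring_nf)

/-- A function with a Lipschitz bound of power type acts continuously from `L²ˢ` to `L²`. -/
lemma tendsto_eLpNorm_comp_sub {α : Type*} [MeasurableSpace α] {μ : Measure α} {G : ℝ → ℝ}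
    {C s : ℝ} (hs : 1 < s)
    (hG : ∀ a b, |G a - G b| ≤ C * (|a| + |b|) ^ (s - 1) * |a - b|)
    {f : ℕ → α → ℝ} {g : α → ℝ} (hf : ∀ n, AEStronglyMeasurable (f n) μ)
    (hg : MemLp g (ENNReal.ofReal (2 * s)) μ)
    (hlim : Tendsto (fun n => eLpNorm (f n - g) (ENNReal.ofReal (2 * s)) μ) atTop (𝓝 0)) :
    Tendsto (fun n => eLpNorm (fun x => G (f n x) - G (g x)) 2 μ) atTop (𝓝 0) := by
  set q := ENNReal.ofReal (2 * s) with hq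
  have hq1 : 1 ≤ q := by
    rw [hq, ← ENNReal.ofReal_one]; exact ENNReal.ofReal_le_ofReal (by linarith)
  have hs1 : 0 < s - 1 := by linarith
  set r := ENNReal.ofReal (2 * s / (s - 1)) with hr
  have hrq : r * ENNReal.ofReal (s - 1) = q := by
    rw [hr, hq, ← ENNReal.ofReal_mul (by positivity)]; congr 1; field_simp
  have hH : ENNReal.HolderTriple r q 2 := by
    constructor
    rw [hr, hq, ← ENNReal.ofReal_inv_of_pos (by positivity), ← ENNReal.ofReal_inv_of_pos (by positivity),
      ← ENNReal.ofReal_add (by positivity) (by positivity)]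
    rw [show (2 : ℝ≥0∞) = ENNReal.ofReal 2 by simp, ← ENNReal.ofReal_inv_of_pos (by norm_num)]
    congr 1
    field_simp
    ring
  have hbd : ∀ n, eLpNorm (fun x => G (f n x) - G (g x)) 2 μ
      ≤ ENNReal.ofReal C * ((eLpNorm (f n - g) q μ + (eLpNorm g q μ + eLpNorm g q μ)) ^ (s - 1)
        * eLpNorm (f n - g) q μ) := by
    intro n
    have hm : AEStronglyMeasurable (fun x => |f n x| + |g x|) μ := (hf n).norm.add hg.1.norm
    have h1 : eLpNorm (fun x => G (f n x) - G (g x)) 2 μ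
        ≤ ENNReal.ofReal C * eLpNorm ((fun x => (|f n x| + |g x|) ^ (s - 1)) • (f n - g)) 2 μ := by
      refine (eLpNorm_le_mul_eLpNorm_of_ae_le_mul (c := C) (Eventually.of_forall fun x => ?_) 2)
      refine (hG _ _).trans (le_of_eq ?_)
      simp only [Pi.smul_apply', smul_eq_mul, norm_mul, Real.norm_eq_abs, Pi.sub_apply]
      rw [abs_of_nonneg (a := (|f n x| + |g x|) ^ (s - 1)) (by positivity)]
      ring
    refine h1.trans ?_
    gcongr
    have hm' : AEStronglyMeasurable (fun x => (|f n x| + |g x|) ^ (s - 1)) μ :=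
      (hm.aemeasurable.pow_const _).aestronglyMeasurable
    refine (eLpNorm_smul_le_mul_eLpNorm (p := r) (q := q) (r := 2) ((hf n).sub hg.1) hm').trans ?_
    gcongr
    have h2 : eLpNorm (fun x => (|f n x| + |g x|) ^ (s - 1)) r μ
        = eLpNorm (fun x => |f n x| + |g x|) q μ ^ (s - 1) := by
      rw [← hrq, ← eLpNorm_norm_rpow _ hs1]
      refine eLpNorm_congr_norm_ae (Eventually.of_forall fun x => ?_)
      simp only [Real.norm_eq_abs]
      rw [abs_of_nonneg (a := |f n x| + |g x|) (by positivity)]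
    rw [h2]
    gcongr
    refine (eLpNorm_mono (g := fun x => |(f n - g) x| + (|g x| + |g x|)) fun x => ?_).trans ?_
    · simp only [Real.norm_eq_abs, Pi.sub_apply]
      rw [abs_of_nonneg (a := |f n x| + |g x|) (by positivity),
        abs_of_nonneg (a := |f n x - g x| + (|g x| + |g x|)) (by positivity)]
      have := abs_sub_abs_le_abs_sub (f n x) (g x)
      linarith
    · have e1 : AEStronglyMeasurable (fun x => |(f n - g) x|) μ := ((hf n).sub hg.1).norm
      have e2 : AEStronglyMeasurable (fun x => |g x|) μ := hg.1.norm
      refine (eLpNorm_add_le e1 (e2.add e2) hq1).trans ?_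
      gcongr
      · exact (eLpNorm_norm (f n - g)).le
      · refine (eLpNorm_add_le e2 e2 hq1).trans ?_
        gcongr
        all_goals exact (eLpNorm_norm g).le
  refine tendsto_of_tendsto_of_tendsto_of_le_of_le tendsto_const_nhds ?_ (fun _ => zero_le) hbd
  have hgt : eLpNorm g q μ + eLpNorm g q μ ≠ ⊤ := ENNReal.add_ne_top.2 ⟨hg.2.ne, hg.2.ne⟩
  have h3 := (hlim.add_const (eLpNorm g q μ + eLpNorm g q μ)).ennrpow_const (s - 1)
  rw [zero_add] at h3
  have h4 := ENNReal.Tendsto.mul h3 (Or.inr ENNReal.zero_ne_top) hlim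
    (Or.inr (ENNReal.rpow_ne_top_of_nonneg hs1.le hgt))
  have h5 := ENNReal.Tendsto.const_mul (a := ENNReal.ofReal C) h4 (Or.inr ENNReal.ofReal_ne_top)
  simpa using h5

/-! ### Removing the mollification -/

lemma eLpNorm_nonlin {p : ℝ} (hp : 3 ≤ p) (f : Space → ℝ) :
    eLpNorm (fun x => nonlin p (f x)) 2 volume
      = eLpNorm f (ENNReal.ofReal (2 * p)) volume ^ p := by
  have h : (2 : ℝ≥0∞) * ENNReal.ofReal p = ENNReal.ofReal (2 * p) := by
    rw [ENNReal.ofReal_mul (by norm_num)]; simp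
  rw [← h, ← eLpNorm_norm_rpow _ (by linarith)]
  refine eLpNorm_congr_norm_ae (Eventually.of_forall fun x => ?_)
  simp only [Real.norm_eq_abs]
  rw [abs_nonlin hp, abs_of_nonneg (a := |f x| ^ p) (by positivity)]

lemma one_le_ofReal_two_mul {s : ℝ} (hs : 1 ≤ s) : 1 ≤ ENNReal.ofReal (2 * s) := by
  rw [← ENNReal.ofReal_one]; exact ENNReal.ofReal_le_ofReal (by linarith)

/-- The commutator with mollification is controlled by the nonlinearity itself. -/
lemma eLpNorm_commutator_le {p : ℝ} (hp : 3 ≤ p) (hp' : p ≤ 5) {f : Space → ℝ}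
    (hf : MemLp f 6 volume) (n : ℕ) :
    eLpNorm (commutator p (mollifier n) f) 2 volume
      ≤ 2 * eLpNorm f (ENNReal.ofReal (2 * p)) volume ^ p := by
  have hl := hf.locallyIntegrable (by norm_num)
  have hN := locallyIntegrable_nonlin hp hp' hf
  have hsm := contDiff_mollifier n
  have hcs := hasCompactSupport_mollifier n
  have m1 : AEStronglyMeasurable (fun x => nonlin p (mollify (mollifier n) f x)) volume :=
    ((continuous_nonlin hp).comp (continuous_mollify hsm hcs hl)).aestronglyMeasurable
  have m2 := (continuous_mollify hsm hcs hN).aestronglyMeasurable (μ := volume)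
  refine (eLpNorm_sub_le m1 m2 (by norm_num)).trans ?_
  rw [two_mul, eLpNorm_nonlin hp]
  gcongr
  · exact eLpNorm_mollify_le n hl (one_le_ofReal_two_mul (by linarith)) ENNReal.ofReal_ne_top
  · exact (eLpNorm_mollify_le n hN (by norm_num) (by norm_num)).trans (eLpNorm_nonlin hp f).le

/-- The commutator with mollification vanishes in the limit. -/
lemma tendsto_eLpNorm_commutator {p : ℝ} (hp : 3 ≤ p) (hp' : p ≤ 5) {f : Space → ℝ}
    (hf : MemLp f 6 volume) (hfp : MemLp f (ENNReal.ofReal (2 * p)) volume) :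
    Tendsto (fun n => eLpNorm (commutator p (mollifier n) f) 2 volume) atTop (𝓝 0) := by
  have hl := hf.locallyIntegrable (by norm_num)
  have hN := locallyIntegrable_nonlin hp hp' hf
  have hsm := contDiff_mollifier
  have hcs := hasCompactSupport_mollifier
  have hNm : AEStronglyMeasurable (fun x => nonlin p (f x)) volume :=
    (continuous_nonlin hp).comp_aestronglyMeasurable hf.1
  have hN2 : MemLp (fun x => nonlin p (f x)) 2 volume := by
    refine ⟨hNm, ?_⟩
    rw [eLpNorm_nonlin hp]
    exact ENNReal.rpow_lt_top_of_nonneg (by linarith) hfp.2.ne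
  have t1 := tendsto_eLpNorm_comp_sub (by linarith : 1 < p)
    (abs_nonlin_sub_le hp)
    (fun n => (continuous_mollify (hsm n) (hcs n) hl).aestronglyMeasurable) hfp
    (tendsto_eLpNorm_mollify_sub (one_le_ofReal_two_mul (by linarith)) ENNReal.ofReal_ne_top hfp)
  have t2 := tendsto_eLpNorm_mollify_sub (by norm_num) (by norm_num) hN2
  have t3 := t1.add t2
  rw [add_zero] at t3
  refine tendsto_of_tendsto_of_tendsto_of_le_of_le tendsto_const_nhds t3 (fun _ => zero_le) ?_
  intro n
  have m1 : AEStronglyMeasurable (fun x => nonlin p (mollify (mollifier n) f x)) volume :=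
    ((continuous_nonlin hp).comp (continuous_mollify (hsm n) (hcs n) hl)).aestronglyMeasurable
  have m2 := (continuous_mollify (hsm n) (hcs n) hN).aestronglyMeasurable (μ := volume)
  have h1 : commutator p (mollifier n) f
      = (fun x => nonlin p (mollify (mollifier n) f x) - nonlin p (f x))
        - (mollify (mollifier n) (fun y => nonlin p (f y)) - fun x => nonlin p (f x)) := by
    ext x; simp [commutator]
  change eLpNorm (commutator p (mollifier n) f) 2 volume ≤ _
  rw [h1]
  exact eLpNorm_sub_le (m1.sub hNm) (m2.sub hNm) (by norm_num)

section

variable {p : ℝ} {u : ℝ → Space → ℝ} {Du : ℝ → Space → Space} {ut : ℝ → Space → ℝ}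

/-- The spatial norms of the solution are measurable in time, being limits of those of its
mollifications. -/
lemma IsSolution.measurable_eLpNorm (hu : IsSolution p u Du ut) {q : ℝ≥0∞} (hq : 1 ≤ q)
    (hq' : q ≠ ⊤) : Measurable fun t => eLpNorm (u t) q volume := by
  have hq0 : q ≠ 0 := (zero_lt_one.trans_le hq).ne'
  have hsm := contDiff_mollifier
  have hcs := hasCompactSupport_mollifier
  refine measurable_of_tendsto_metrizable
    (f := fun n t => eLpNorm (mollify (mollifier n) (u t)) q volume) (fun n => ?_) ?_
  · simp only [eLpNorm_eq_lintegral_rpow_enorm_toReal hq0 hq']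
    refine Measurable.pow_const ?_ _
    exact ((hu.continuous_mollify_u (hsm n) (hcs n)).measurable.enorm.pow_const
      q.toReal).lintegral_prod_right'
  · rw [tendsto_pi_nhds]
    intro t
    have hl := hu.locallyIntegrable_u t
    refine tendsto_of_le_liminf_of_limsup_le ?_ ?_
    · exact Lp.eLpNorm_lim_le_liminf_eLpNorm
        (fun n => (continuous_mollify (hsm n) (hcs n) hl).aestronglyMeasurable) _
        (ae_tendsto_mollify hl)
    · refine (limsup_le_limsup (Eventually.of_forall fun n => eLpNorm_mollify_le n hl hq hq')).trans ?_
      simp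

/-- The nonlinearity is integrable in time with values in `L²`. -/
lemma IsSolution.lintegral_eLpNorm_rpow_ne_top (hu : IsSolution p u Du ut) (hp : 3 ≤ p)
    (hp' : p ≤ 5) (t₀ t₁ : ℝ) :
    ∫⁻ t in Ioc t₀ t₁, eLpNorm (u t) (ENNReal.ofReal (2 * p)) volume ^ p ≠ ⊤ := by
  set h : ℝ → ℝ≥0∞ := fun t => eLpNorm (u t) (ENNReal.ofReal (2 * p)) volume with hh
  set Q : ℝ≥0∞ := ENNReal.ofReal (2 * p) / ENNReal.ofReal (p - 3) with hQ
  have hp0 : 0 < p := by linarith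
  have hmeas : Measurable h :=
    hu.measurable_eLpNorm (one_le_ofReal_two_mul (by linarith)) ENNReal.ofReal_ne_top
  have hfin : eLpNorm h Q (volume.restrict (Icc t₀ t₁)) < ⊤ := hu.spaceTimeNorm_lt_top t₀ t₁
  -- on a bounded interval the time exponent `2 p / (p - 3)` may be lowered to `p`, since `p ≤ 5`
  have hpQ : ENNReal.ofReal p ≤ Q := by
    rw [hQ, ENNReal.le_div_iff_mul_le (Or.inr (by simp; linarith)) (Or.inl ENNReal.ofReal_ne_top),
      ← ENNReal.ofReal_mul hp0.le]
    exact ENNReal.ofReal_le_ofReal (by nlinarith)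
  have hle := eLpNorm_le_eLpNorm_mul_rpow_measure_univ (μ := volume.restrict (Icc t₀ t₁)) hpQ
    hmeas.aestronglyMeasurable
  have hp_ne : ENNReal.ofReal p ≠ 0 := by simpa using hp0
  have hfin2 : eLpNorm h (ENNReal.ofReal p) (volume.restrict (Icc t₀ t₁)) < ⊤ := by
    refine hle.trans_lt (ENNReal.mul_lt_top hfin (ENNReal.rpow_lt_top_of_nonneg ?_ ?_))
    · rw [sub_nonneg]
      by_cases hQt : Q = ⊤
      · rw [hQt]; simp
      · exact one_div_le_one_div_of_le (ENNReal.toReal_pos hp_ne ENNReal.ofReal_ne_top)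
          (ENNReal.toReal_mono hQt hpQ)
    · simp
  have h2 := lintegral_rpow_enorm_lt_top_of_eLpNorm_lt_top hp_ne ENNReal.ofReal_ne_top hfin2
  rw [ENNReal.toReal_ofReal hp0.le] at h2
  simp only [enorm_eq_self] at h2
  exact (lt_of_le_of_lt (lintegral_mono_set Ioc_subset_Icc_self) h2).ne

lemma IsSolution.lintegral_commutator_ne_top (hu : IsSolution p u Du ut) (hp : 3 ≤ p)
    (hp' : p ≤ 5) (t₀ t₁ : ℝ) (n : ℕ) :
    ∫⁻ t in Ioc t₀ t₁, eLpNorm (commutator p (mollifier n) (u t)) 2 volume ≠ ⊤ := by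
  refine ((lintegral_mono fun t => eLpNorm_commutator_le hp hp'
    (hu.memHomSobolevOne t).memLp_six n).trans_lt ?_).ne
  rw [lintegral_const_mul' _ _ (by norm_num)]
  exact ENNReal.mul_lt_top (by simp) (hu.lintegral_eLpNorm_rpow_ne_top hp hp' t₀ t₁).lt_top

/-- The commutator vanishes in `L¹` in time with values in `L²`. -/
lemma IsSolution.tendsto_lintegral_commutator (hu : IsSolution p u Du ut) (hp : 3 ≤ p)
    (hp' : p ≤ 5) (t₀ t₁ : ℝ) :
    Tendsto (fun n => ∫⁻ t in Ioc t₀ t₁, eLpNorm (commutator p (mollifier n) (u t)) 2 volume)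
      atTop (𝓝 0) := by
  have hfin := hu.lintegral_eLpNorm_rpow_ne_top hp hp' t₀ t₁
  have hmeas : Measurable fun t => eLpNorm (u t) (ENNReal.ofReal (2 * p)) volume :=
    hu.measurable_eLpNorm (one_le_ofReal_two_mul (by linarith)) ENNReal.ofReal_ne_top
  have h0 : (0 : ℝ≥0∞) = ∫⁻ _t in Ioc t₀ t₁, 0 := by simp
  rw [h0]
  refine tendsto_lintegral_of_dominated_convergence
    (fun t => 2 * eLpNorm (u t) (ENNReal.ofReal (2 * p)) volume ^ p) (fun n => ?_)
    (fun n => Eventually.of_forall fun t => eLpNorm_commutator_le hp hp'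
      (hu.memHomSobolevOne t).memLp_six n) ?_ ?_
  · simp only [eLpNorm_eq_lintegral_rpow_enorm_toReal two_ne_zero ENNReal.ofNat_ne_top]
    refine Measurable.pow_const ?_ _
    exact ((hu.measurable_commutator hp n).enorm.pow_const _).lintegral_prod_right'
  · rw [lintegral_const_mul' _ _ (by norm_num)]
    exact ENNReal.mul_ne_top (by simp) hfin
  · filter_upwards [ae_lt_top (hmeas.pow_const p) hfin] with t ht
    refine tendsto_eLpNorm_commutator hp hp' (hu.memHomSobolevOne t).memLp_six
      ⟨(hu.memHomSobolevOne t).memLp_six.1, ?_⟩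
    exact (ENNReal.rpow_lt_top_iff_of_pos (by linarith)).1 ht

end

/-- `Integrable.add` with the sum written pointwise, for rewriting integrals of sums. -/
lemma _root_.MeasureTheory.Integrable.add_fun {α : Type*} [MeasurableSpace α] {μ : Measure α}
    {f g : α → ℝ} (hf : Integrable f μ) (hg : Integrable g μ) :
    Integrable (fun x => f x + g x) μ := hf.add hg

/-- Integrals of products converge if both factors converge in `L²`. -/
lemma tendsto_integral_mul {α : Type*} [MeasurableSpace α] {μ : Measure α} {f g : ℕ → α → ℝ}
    {f₀ g₀ : α → ℝ} (hf : ∀ n, MemLp (f n) 2 μ) (hf₀ : MemLp f₀ 2 μ) (hg : ∀ n, MemLp (g n) 2 μ)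
    (hg₀ : MemLp g₀ 2 μ) (h : Tendsto (fun n => eLpNorm (f n - f₀) 2 μ) atTop (𝓝 0))
    (h' : Tendsto (fun n => eLpNorm (g n - g₀) 2 μ) atTop (𝓝 0)) :
    Tendsto (fun n => ∫ x, f n x * g n x ∂μ) atTop (𝓝 (∫ x, f₀ x * g₀ x ∂μ)) := by
  have : Fact ((1 : ℝ≥0∞) ≤ 2) := ⟨by norm_num⟩
  have h1 := (Lp.tendsto_Lp_iff_tendsto_eLpNorm'' f hf f₀ hf₀).2 h
  have h2 := (Lp.tendsto_Lp_iff_tendsto_eLpNorm'' g hg g₀ hg₀).2 h'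
  have key : ∀ {a b : α → ℝ} (ha : MemLp a 2 μ) (hb : MemLp b 2 μ),
      inner ℝ (hb.toLp b) (ha.toLp a) = ∫ x, a x * b x ∂μ := by
    intro a b ha hb
    rw [L2.inner_def]
    refine integral_congr_ae ?_
    filter_upwards [ha.coeFn_toLp, hb.coeFn_toLp] with x hx hx'
    rw [hx, hx']
    simp
  have h3 := h2.inner (𝕜 := ℝ) h1
  simpa only [key] using h3

/-- The weighted version of `tendsto_integral_mul`, with local convergence only. -/
lemma tendsto_integral_weight_mul {c : Space → ℝ} (hc : Continuous c) {r : ℝ}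
    (hr : ∀ x, r < ‖x‖ → c x = 0) {f g : ℕ → Space → ℝ} {f₀ g₀ : Space → ℝ}
    (hf : ∀ n, MemLp (f n) 2 (volume.restrict (Metric.closedBall 0 r)))
    (hf₀ : MemLp f₀ 2 (volume.restrict (Metric.closedBall 0 r)))
    (hg : ∀ n, MemLp (g n) 2 (volume.restrict (Metric.closedBall 0 r)))
    (hg₀ : MemLp g₀ 2 (volume.restrict (Metric.closedBall 0 r)))
    (h : Tendsto (fun n => eLpNorm (f n - f₀) 2 (volume.restrict (Metric.closedBall 0 r)))
      atTop (𝓝 0))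
    (h' : Tendsto (fun n => eLpNorm (g n - g₀) 2 (volume.restrict (Metric.closedBall 0 r)))
      atTop (𝓝 0)) :
    Tendsto (fun n => ∫ x, c x * f n x * g n x) atTop (𝓝 (∫ x, c x * f₀ x * g₀ x)) := by
  have hcs := hasCompactSupport_of_eq_zero hr
  obtain ⟨M, hM⟩ := hc.bounded_above_of_compact_support hcs
  have hcf : ∀ {a : Space → ℝ}, MemLp a 2 (volume.restrict (Metric.closedBall 0 r)) →
      MemLp (fun x => c x * a x) 2 (volume.restrict (Metric.closedBall 0 r)) := fun {a} ha =>
    ha.of_le_mul (c := M) (hc.aestronglyMeasurable.mul ha.1) (Eventually.of_forall fun x => by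
      rw [norm_mul]; gcongr; exact hM x)
  have hset : ∀ a b : Space → ℝ, ∫ x, c x * a x * b x
      = ∫ x in Metric.closedBall 0 r, c x * a x * b x := by
    intro a b
    rw [setIntegral_eq_integral_of_forall_compl_eq_zero]
    intro x hx
    rw [hr x (by simpa using hx)]
    simp
  simp only [hset]
  refine tendsto_integral_mul (fun n => hcf (hf n)) (hcf hf₀) hg hg₀ ?_ h'
  have h3 := ENNReal.Tendsto.const_mul (a := ENNReal.ofReal M) h (Or.inr ENNReal.ofReal_ne_top)
  rw [mul_zero] at h3
  refine tendsto_of_tendsto_of_tendsto_of_le_of_le tendsto_const_nhds h3 (fun _ => zero_le) fun n => ?_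
  refine eLpNorm_le_mul_eLpNorm_of_ae_le_mul (Eventually.of_forall fun x => ?_) 2
  rw [Pi.sub_apply, ← mul_sub, norm_mul, Pi.sub_apply]
  gcongr
  exact hM x

lemma integrable_weight_mul {c : Space → ℝ} (hc : Continuous c) {r : ℝ}
    (hr : ∀ x, r < ‖x‖ → c x = 0) {f₀ g₀ : Space → ℝ}
    (hf₀ : MemLp f₀ 2 (volume.restrict (Metric.closedBall 0 r)))
    (hg₀ : MemLp g₀ 2 (volume.restrict (Metric.closedBall 0 r))) :
    Integrable (fun x => c x * f₀ x * g₀ x) := by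
  have hcs := hasCompactSupport_of_eq_zero hr
  obtain ⟨M, hM⟩ := hc.bounded_above_of_compact_support hcs
  have h1 : IntegrableOn (fun x => c x * (f₀ x * g₀ x)) (Metric.closedBall 0 r) :=
    (hf₀.integrable_mul hg₀).bdd_mul hc.aestronglyMeasurable (Eventually.of_forall hM)
  have h2 : IntegrableOn (fun x => c x * (f₀ x * g₀ x)) univ := by
    refine h1.of_forall_sdiff_eq_zero MeasurableSet.univ ?_
    rintro x ⟨-, hx⟩
    rw [hr x (by simpa using hx), zero_mul]
  simpa only [integrableOn_univ, mul_assoc] using h2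

/-- The potential energy as a square, so that its convergence can be studied in `L²`. -/
lemma potential_eq_sq {p : ℝ} (y : ℝ) :
    potential p y = 1 / (p + 1) * (|y| ^ ((p + 1) / 2) * |y| ^ ((p + 1) / 2)) := by
  rw [potential, ← Real.mul_rpow (abs_nonneg y) (abs_nonneg y), ← sq,
    ← Real.rpow_natCast, ← Real.rpow_mul (abs_nonneg y)]
  congr 2
  push_cast; ring

/-- Convergence of states in `L²` of a ball, including the square root of the potential energy. -/
structure LocalConvergence (p r : ℝ) (v : ℕ → Space → ℝ) (z : ℕ → Fin 3 → Space → ℝ)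
    (w : ℕ → Space → ℝ) (v₀ : Space → ℝ) (z₀ : Fin 3 → Space → ℝ) (w₀ : Space → ℝ) : Prop where
  memLp_v : ∀ n, MemLp (v n) 2 (volume.restrict (Metric.closedBall 0 r))
  memLp_z : ∀ i n, MemLp (z n i) 2 (volume.restrict (Metric.closedBall 0 r))
  memLp_w : ∀ n, MemLp (w n) 2 (volume.restrict (Metric.closedBall 0 r))
  memLp_V : ∀ n, MemLp (fun x => |v n x| ^ ((p + 1) / 2)) 2
    (volume.restrict (Metric.closedBall 0 r))
  memLp_v₀ : MemLp v₀ 2 (volume.restrict (Metric.closedBall 0 r))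
  memLp_z₀ : ∀ i, MemLp (z₀ i) 2 (volume.restrict (Metric.closedBall 0 r))
  memLp_w₀ : MemLp w₀ 2 (volume.restrict (Metric.closedBall 0 r))
  memLp_V₀ : MemLp (fun x => |v₀ x| ^ ((p + 1) / 2)) 2 (volume.restrict (Metric.closedBall 0 r))
  tendsto_v : Tendsto (fun n => eLpNorm (v n - v₀) 2 (volume.restrict (Metric.closedBall 0 r)))
    atTop (𝓝 0)
  tendsto_z : ∀ i, Tendsto (fun n => eLpNorm (z n i - z₀ i) 2
    (volume.restrict (Metric.closedBall 0 r))) atTop (𝓝 0)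
  tendsto_w : Tendsto (fun n => eLpNorm (w n - w₀) 2 (volume.restrict (Metric.closedBall 0 r)))
    atTop (𝓝 0)
  tendsto_V : Tendsto (fun n => eLpNorm ((fun x => |v n x| ^ ((p + 1) / 2))
    - fun x => |v₀ x| ^ ((p + 1) / 2)) 2 (volume.restrict (Metric.closedBall 0 r))) atTop (𝓝 0)

/-- The coefficient of `y²` in `radialDivergence`. -/
def radialCoeff (δ : ℝ) (f : ℝ → ℝ) (t : ℝ) (x : Space) : ℝ :=
  3 * f (t - rho δ x) / rho δ x ^ 2 - deriv f (t - rho δ x) * ‖x‖ ^ 2 / rho δ x ^ 3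
    - 2 * f (t - rho δ x) * ‖x‖ ^ 2 / rho δ x ^ 4

/-- The integrand, whose integral vanishes, by which the outward functional differs from the
integral of the outward energy density. -/
def radialDivergence (δ : ℝ) (f : ℝ → ℝ) (t : ℝ) (x : Space) (y : ℝ) (z : Fin 3 → ℝ) : ℝ :=
  ∑ i, 2 * f (t - rho δ x) / rho δ x ^ 2 * x i * y * z i + radialCoeff δ f t x * y * y

section

variable {p a δ t R : ℝ} {f : ℝ → ℝ} {v₀ w₀ : Space → ℝ} {z₀ : Fin 3 → Space → ℝ}

/-- The density is a quadratic form in `u`, `∇u`, `u_t` and `|u| ^ ((p + 1) / 2)`, with continuous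
coefficients. -/
lemma density_eq_quadratic (hδ : 0 < δ) (x : Space) (y : ℝ) (z : Fin 3 → ℝ) (w : ℝ) :
    density p a δ f t x y z w
      = ∑ i, (1 / 4 * f (t - rho δ x) * z i * z i
          + -(a / 2) * (f (t - rho δ x) / rho δ x * x i) * w * z i)
        + 1 / 4 * f (t - rho δ x) * w * w
        + -(a / 2) * (f (t - rho δ x) / rho δ x) * w * y
        + a / 4 * (deriv f (t - rho δ x) / rho δ x) * y * y
        + 1 / 2 * (1 / (p + 1)) * f (t - rho δ x) * |y| ^ ((p + 1) / 2) * |y| ^ ((p + 1) / 2) := by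
  have := (rho_pos hδ x).ne'
  rw [density, potential_eq_sq]
  simp only [Fin.sum_univ_three]
  field_simp
  ring

lemma LocalConvergence.tendsto_functional {v w : ℕ → Space → ℝ} {z : ℕ → Fin 3 → Space → ℝ}
    (h : LocalConvergence p (t + R) v z w v₀ z₀ w₀) (hδ : 0 < δ) (hf : ContDiff ℝ ∞ f)
    (hR : ∀ s < -R, f s = 0) :
    Tendsto (fun n => functional p a δ f t (v n) (z n) (w n)) atTop
      (𝓝 (functional p a δ f t v₀ z₀ w₀)) := by
  have cρ := continuous_rho δ
  have hρ0 : ∀ x, rho δ x ≠ 0 := fun x => (rho_pos hδ x).ne'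
  have cx : ∀ i, Continuous fun x : Space => x i := fun i => (contDiff_coord i).continuous
  have cφ : Continuous fun x => f (t - rho δ x) := (contDiff_weight hf hδ t).continuous
  have cφ' : Continuous fun x => deriv f (t - rho δ x) :=
    (contDiff_weight (contDiff_deriv hf) hδ t).continuous
  have zφ : ∀ x, t + R < ‖x‖ → f (t - rho δ x) = 0 := fun x => weight_eq_zero hR
  have zφ' : ∀ x, t + R < ‖x‖ → deriv f (t - rho δ x) = 0 := fun x =>
    weight_eq_zero (deriv_eq_zero_of_lt hR)
  have c1 : Continuous fun x => 1 / 4 * f (t - rho δ x) := by fun_prop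
  have c2 : ∀ i, Continuous fun x : Space => -(a / 2) * (f (t - rho δ x) / rho δ x * x i) :=
    fun i => by have := cx i; fun_prop (disch := assumption)
  have c3 : Continuous fun x => -(a / 2) * (f (t - rho δ x) / rho δ x) := by
    fun_prop (disch := assumption)
  have c4 : Continuous fun x => a / 4 * (deriv f (t - rho δ x) / rho δ x) := by
    fun_prop (disch := assumption)
  have c5 : Continuous fun x => 1 / 2 * (1 / (p + 1)) * f (t - rho δ x) := by fun_prop
  have z1 : ∀ x, t + R < ‖x‖ → 1 / 4 * f (t - rho δ x) = 0 := fun x hx => by simp [zφ x hx]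
  have z2 : ∀ (i : Fin 3) (x : Space), t + R < ‖x‖ →
    -(a / 2) * (f (t - rho δ x) / rho δ x * x i) = 0 := fun i x hx => by simp [zφ x hx]
  have z3 : ∀ x, t + R < ‖x‖ → -(a / 2) * (f (t - rho δ x) / rho δ x) = 0 := fun x hx => by
    simp [zφ x hx]
  have z4 : ∀ x, t + R < ‖x‖ → a / 4 * (deriv f (t - rho δ x) / rho δ x) = 0 := fun x hx => by
    simp [zφ' x hx]
  have z5 : ∀ x, t + R < ‖x‖ → 1 / 2 * (1 / (p + 1)) * f (t - rho δ x) = 0 := fun x hx => by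
    simp [zφ x hx]
  have key : ∀ {v w : Space → ℝ} {z : Fin 3 → Space → ℝ},
      MemLp v 2 (volume.restrict (Metric.closedBall 0 (t + R))) →
      (∀ i, MemLp (z i) 2 (volume.restrict (Metric.closedBall 0 (t + R)))) →
      MemLp w 2 (volume.restrict (Metric.closedBall 0 (t + R))) →
      MemLp (fun x => |v x| ^ ((p + 1) / 2)) 2 (volume.restrict (Metric.closedBall 0 (t + R))) →
      functional p a δ f t v z w
        = ∑ i, ((∫ x, 1 / 4 * f (t - rho δ x) * z i x * z i x)
            + ∫ x, -(a / 2) * (f (t - rho δ x) / rho δ x * x i) * w x * z i x)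
          + (∫ x, 1 / 4 * f (t - rho δ x) * w x * w x)
          + (∫ x, -(a / 2) * (f (t - rho δ x) / rho δ x) * w x * v x)
          + (∫ x, a / 4 * (deriv f (t - rho δ x) / rho δ x) * v x * v x)
          + ∫ x, 1 / 2 * (1 / (p + 1)) * f (t - rho δ x) * |v x| ^ ((p + 1) / 2)
            * |v x| ^ ((p + 1) / 2) := by
    intro v w z hv hz hw hV
    have i1 := fun i => integrable_weight_mul c1 z1 (hz i) (hz i)
    have i2 := fun i => integrable_weight_mul (c2 i) (z2 i) hw (hz i)
    have i3 := integrable_weight_mul c1 z1 hw hw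
    have i4 := integrable_weight_mul c3 z3 hw hv
    have i5 := integrable_weight_mul c4 z4 hv hv
    have i6 := integrable_weight_mul c5 z5 hV hV
    have i7 := integrable_finsetSum (Finset.univ) fun i _ => (i1 i).add_fun (i2 i)
    simp only [functional, density_eq_quadratic hδ]
    rw [integral_add (((i7.add_fun i3).add_fun i4).add_fun i5) i6, integral_add ((i7.add_fun i3).add_fun i4) i5,
      integral_add (i7.add_fun i3) i4, integral_add i7 i3,
      integral_finsetSum _ fun i _ => (i1 i).add_fun (i2 i)]
    congr 4
    exact Finset.sum_congr rfl fun i _ => integral_add (i1 i) (i2 i)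
  rw [key h.memLp_v₀ h.memLp_z₀ h.memLp_w₀ h.memLp_V₀]
  simp only [fun n => key (h.memLp_v n) (fun i => h.memLp_z i n) (h.memLp_w n) (h.memLp_V n)]
  refine ((((tendsto_finsetSum _ fun i _ => ?_).add ?_).add ?_).add ?_).add ?_
  · exact (tendsto_integral_weight_mul c1 z1 (h.memLp_z i) (h.memLp_z₀ i) (h.memLp_z i)
      (h.memLp_z₀ i) (h.tendsto_z i) (h.tendsto_z i)).add
      (tendsto_integral_weight_mul (c2 i) (z2 i) h.memLp_w h.memLp_w₀ (h.memLp_z i)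
      (h.memLp_z₀ i) h.tendsto_w (h.tendsto_z i))
  · exact tendsto_integral_weight_mul c1 z1 h.memLp_w h.memLp_w₀ h.memLp_w h.memLp_w₀
      h.tendsto_w h.tendsto_w
  · exact tendsto_integral_weight_mul c3 z3 h.memLp_w h.memLp_w₀ h.memLp_v h.memLp_v₀
      h.tendsto_w h.tendsto_v
  · exact tendsto_integral_weight_mul c4 z4 h.memLp_v h.memLp_v₀ h.memLp_v h.memLp_v₀
      h.tendsto_v h.tendsto_v
  · exact tendsto_integral_weight_mul c5 z5 h.memLp_V h.memLp_V₀ h.memLp_V h.memLp_V₀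
      h.tendsto_V h.tendsto_V

lemma continuous_radialCoeff (hδ : 0 < δ) (hf : ContDiff ℝ ∞ f) :
    Continuous (radialCoeff δ f t) := by
  have cρ := continuous_rho δ
  have hρ0 : ∀ x, rho δ x ≠ 0 := fun x => (rho_pos hδ x).ne'
  have hρ2 : ∀ x, rho δ x ^ 2 ≠ 0 := fun x => pow_ne_zero _ (hρ0 x)
  have hρ3 : ∀ x, rho δ x ^ 3 ≠ 0 := fun x => pow_ne_zero _ (hρ0 x)
  have hρ4 : ∀ x, rho δ x ^ 4 ≠ 0 := fun x => pow_ne_zero _ (hρ0 x)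
  have cφ : Continuous fun x => f (t - rho δ x) := (contDiff_weight hf hδ t).continuous
  have cφ' : Continuous fun x => deriv f (t - rho δ x) :=
    (contDiff_weight (contDiff_deriv hf) hδ t).continuous
  unfold radialCoeff
  fun_prop (disch := assumption)

lemma continuous_crossCoeff (hδ : 0 < δ) (hf : ContDiff ℝ ∞ f) (i : Fin 3) :
    Continuous fun x : Space => 2 * f (t - rho δ x) / rho δ x ^ 2 * x i := by
  have cρ := continuous_rho δ
  have hρ2 : ∀ x, rho δ x ^ 2 ≠ 0 := fun x => pow_ne_zero _ (rho_pos hδ x).ne'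
  have cφ : Continuous fun x => f (t - rho δ x) := (contDiff_weight hf hδ t).continuous
  have cx : Continuous fun x : Space => x i := (contDiff_coord i).continuous
  fun_prop (disch := assumption)

lemma radialCoeff_eq_zero (hR : ∀ s < -R, f s = 0) (x : Space) (hx : t + R < ‖x‖) :
    radialCoeff δ f t x = 0 := by
  simp [radialCoeff, weight_eq_zero hR hx, weight_eq_zero (deriv_eq_zero_of_lt hR) hx]

lemma crossCoeff_eq_zero (hR : ∀ s < -R, f s = 0) (i : Fin 3) (x : Space) (hx : t + R < ‖x‖) :
    2 * f (t - rho δ x) / rho δ x ^ 2 * x i = 0 := by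
  simp [weight_eq_zero hR hx]

lemma integrable_radialDivergence (hδ : 0 < δ) (hf : ContDiff ℝ ∞ f) (hR : ∀ s < -R, f s = 0)
    (hv : MemLp v₀ 2 (volume.restrict (Metric.closedBall 0 (t + R))))
    (hz : ∀ i, MemLp (z₀ i) 2 (volume.restrict (Metric.closedBall 0 (t + R)))) :
    Integrable fun x => radialDivergence δ f t x (v₀ x) fun i => z₀ i x :=
  (integrable_finsetSum _ fun i _ => integrable_weight_mul (continuous_crossCoeff hδ hf i)
    (crossCoeff_eq_zero hR i) hv (hz i)).add_fun
    (integrable_weight_mul (continuous_radialCoeff hδ hf) (radialCoeff_eq_zero hR) hv hv)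

lemma LocalConvergence.tendsto_integral_radialDivergence {v w : ℕ → Space → ℝ}
    {z : ℕ → Fin 3 → Space → ℝ} (h : LocalConvergence p (t + R) v z w v₀ z₀ w₀) (hδ : 0 < δ)
    (hf : ContDiff ℝ ∞ f) (hR : ∀ s < -R, f s = 0) :
    Tendsto (fun n => ∫ x, radialDivergence δ f t x (v n x) fun i => z n i x) atTop
      (𝓝 (∫ x, radialDivergence δ f t x (v₀ x) fun i => z₀ i x)) := by
  have c1 := fun i => continuous_crossCoeff (t := t) hδ hf i
  have c2 := continuous_radialCoeff (t := t) hδ hf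
  have z1 := fun i => crossCoeff_eq_zero (t := t) (δ := δ) hR i
  have z2 := radialCoeff_eq_zero (t := t) (δ := δ) hR
  have key : ∀ {v : Space → ℝ} {z : Fin 3 → Space → ℝ},
      MemLp v 2 (volume.restrict (Metric.closedBall 0 (t + R))) →
      (∀ i, MemLp (z i) 2 (volume.restrict (Metric.closedBall 0 (t + R)))) →
      ∫ x, radialDivergence δ f t x (v x) (fun i => z i x)
        = ∑ i, (∫ x, 2 * f (t - rho δ x) / rho δ x ^ 2 * x i * v x * z i x)
          + ∫ x, radialCoeff δ f t x * v x * v x := by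
    intro v z hv hz
    have i1 := fun i => integrable_weight_mul (c1 i) (z1 i) hv (hz i)
    have i2 := integrable_weight_mul c2 z2 hv hv
    simp only [radialDivergence]
    rw [integral_add (integrable_finsetSum _ fun i _ => i1 i) i2,
      integral_finsetSum _ fun i _ => i1 i]
  rw [key h.memLp_v₀ h.memLp_z₀]
  simp only [fun n => key (h.memLp_v n) (fun i => h.memLp_z i n)]
  refine (tendsto_finsetSum _ fun i _ => ?_).add ?_
  · exact tendsto_integral_weight_mul (c1 i) (z1 i) h.memLp_v h.memLp_v₀ (h.memLp_z i)
      (h.memLp_z₀ i) h.tendsto_v (h.tendsto_z i)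
  · exact tendsto_integral_weight_mul c2 z2 h.memLp_v h.memLp_v₀ h.memLp_v h.memLp_v₀
      h.tendsto_v h.tendsto_v

end

/-- Convergence in `L^q'` implies convergence in `L^q` of a ball for `q ≤ q'`. -/
lemma tendsto_eLpNorm_restrict {f : ℕ → Space → ℝ} (hf : ∀ n, AEStronglyMeasurable (f n) volume)
    {q q' : ℝ≥0∞} (hq : 0 < q) (hqq : q ≤ q') (hq' : q' ≠ ⊤)
    (h : Tendsto (fun n => eLpNorm (f n) q' volume) atTop (𝓝 0)) (r : ℝ) :
    Tendsto (fun n => eLpNorm (f n) q (volume.restrict (Metric.closedBall 0 r))) atTop (𝓝 0) := by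
  set μ : Measure Space := volume.restrict (Metric.closedBall 0 r)
  have hK : μ univ ^ (1 / q.toReal - 1 / q'.toReal) ≠ ⊤ := by
    refine ENNReal.rpow_ne_top_of_nonneg ?_ ?_
    · rw [sub_nonneg]
      exact one_div_le_one_div_of_le (ENNReal.toReal_pos hq.ne' (ne_top_of_le_ne_top hq' hqq))
        (ENNReal.toReal_mono hq' hqq)
    · simpa [μ] using
        (measure_closedBall_lt_top (μ := (volume : Measure Space)) (x := 0) (r := r)).ne
  have h1 := ENNReal.Tendsto.mul_const (b := μ univ ^ (1 / q.toReal - 1 / q'.toReal)) h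
    (Or.inr hK)
  rw [zero_mul] at h1
  refine tendsto_of_tendsto_of_tendsto_of_le_of_le tendsto_const_nhds h1 (fun _ => zero_le) fun n => ?_
  refine (eLpNorm_le_eLpNorm_mul_rpow_measure_univ hqq (hf n).restrict).trans ?_
  gcongr
  exact Measure.restrict_le_self

lemma memLp_restrict_of_memLp_six {f : Space → ℝ} (hf : MemLp f 6 volume) {q : ℝ≥0∞}
    (hq : q ≤ 6) (r : ℝ) : MemLp f q (volume.restrict (Metric.closedBall 0 r)) := by
  have : IsFiniteMeasure (volume.restrict (Metric.closedBall (0 : Space) r)) :=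
    ⟨by simpa using (measure_closedBall_lt_top (μ := (volume : Measure Space)) (x := 0) (r := r))⟩
  exact (hf.restrict _).mono_exponent hq

lemma memLp_rpow_restrict {p : ℝ} (hp : 3 ≤ p) (hp' : p ≤ 5) {f : Space → ℝ}
    (hf : MemLp f 6 volume) (r : ℝ) :
    MemLp (fun x => |f x| ^ ((p + 1) / 2)) 2 (volume.restrict (Metric.closedBall 0 r)) := by
  have h1 : ENNReal.ofReal (2 * ((p + 1) / 2)) ≤ 6 := by
    rw [show (6 : ℝ≥0∞) = ENNReal.ofReal 6 by simp]
    exact ENNReal.ofReal_le_ofReal (by linarith)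
  have h2 := memLp_restrict_of_memLp_six hf h1 r
  have hs : 0 < (p + 1) / 2 := by linarith
  refine ⟨(h2.1.norm.aemeasurable.pow_const _).aestronglyMeasurable, ?_⟩
  have h3 : (2 : ℝ≥0∞) * ENNReal.ofReal ((p + 1) / 2) = ENNReal.ofReal (2 * ((p + 1) / 2)) := by
    rw [ENNReal.ofReal_mul (by norm_num)]; simp
  have h4 := eLpNorm_norm_rpow (μ := volume.restrict (Metric.closedBall 0 r)) (p := 2) f hs
  simp only [Real.norm_eq_abs] at h4
  rw [h4, h3]
  exact ENNReal.rpow_lt_top_of_nonneg hs.le h2.2.ne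

lemma memLp_mollify (n : ℕ) {f : Space → ℝ} {q : ℝ≥0∞} (hq : 1 ≤ q) (hq' : q ≠ ⊤)
    (hf : MemLp f q volume) : MemLp (mollify (mollifier n) f) q volume :=
  ⟨(continuous_mollify (contDiff_mollifier n) (hasCompactSupport_mollifier n)
    (hf.locallyIntegrable hq)).aestronglyMeasurable,
    (eLpNorm_mollify_le n (hf.locallyIntegrable hq) hq hq').trans_lt hf.2⟩

/-- The mollifications of a state in the energy space converge to it locally. -/
lemma MemHomSobolevOne.localConvergence {p : ℝ} (hp : 3 ≤ p) (hp' : p ≤ 5) {f : Space → ℝ}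
    {g : Space → Space} (h : MemHomSobolevOne f g) {k : Space → ℝ} (hk : MemLp k 2 volume) (r : ℝ) :
    LocalConvergence p r (fun n => mollify (mollifier n) f)
      (fun n i => pd i (mollify (mollifier n) f)) (fun n => mollify (mollifier n) k)
      f (fun i x => g x i) k := by
  have h6 := fun n => memLp_mollify n (by norm_num) (by norm_num) h.memLp_six
  have hlim6 := tendsto_eLpNorm_mollify_sub (by norm_num) (by norm_num) h.memLp_six
  have hpd : ∀ n i, pd i (mollify (mollifier n) f) = mollify (mollifier n) (fun x => g x i) :=
    fun n => h.hasWeakGradient.pd_mollify (contDiff_mollifier n) (hasCompactSupport_mollifier n)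
  have hgi := fun i => memLp_coord h.memLp_grad i
  have hgn := fun i n => memLp_mollify n (by norm_num) (by norm_num) (hgi i)
  have hkn := fun n => memLp_mollify n (by norm_num) (by norm_num) hk
  have hmono : ∀ (F : ℕ → Space → ℝ), Tendsto (fun n => eLpNorm (F n) 2 volume) atTop (𝓝 0) →
      Tendsto (fun n => eLpNorm (F n) 2 (volume.restrict (Metric.closedBall 0 r))) atTop (𝓝 0) :=
    fun F hF => tendsto_of_tendsto_of_tendsto_of_le_of_le tendsto_const_nhds hF (fun _ => zero_le)
      fun n => eLpNorm_mono_measure _ Measure.restrict_le_self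
  have hsub : ∀ n, AEStronglyMeasurable (mollify (mollifier n) f - f) volume := fun n =>
    (h6 n).1.sub h.memLp_six.1
  refine
    { memLp_v := fun n => memLp_restrict_of_memLp_six (h6 n) (by norm_num) r
      memLp_z := fun i n => by rw [hpd]; exact (hgn i n).restrict _
      memLp_w := fun n => (hkn n).restrict _
      memLp_V := fun n => memLp_rpow_restrict hp hp' (h6 n) r
      memLp_v₀ := memLp_restrict_of_memLp_six h.memLp_six (by norm_num) r
      memLp_z₀ := fun i => (hgi i).restrict _
      memLp_w₀ := hk.restrict _
      memLp_V₀ := memLp_rpow_restrict hp hp' h.memLp_six r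
      tendsto_v := tendsto_eLpNorm_restrict hsub (by norm_num) (by norm_num) (by norm_num) hlim6 r
      tendsto_z := fun i => ?_
      tendsto_w := hmono _ (tendsto_eLpNorm_mollify_sub (by norm_num) (by norm_num) hk)
      tendsto_V := ?_ }
  · simp only [hpd]
    exact hmono _ (tendsto_eLpNorm_mollify_sub (by norm_num) (by norm_num) (hgi i))
  -- `|·| ^ ((p + 1) / 2)` acts continuously from `L^(p+1)` to `L²`, and `p + 1 ≤ 6`
  · have hs : 1 < (p + 1) / 2 := by linarith
    have hq6 : ENNReal.ofReal (2 * ((p + 1) / 2)) ≤ 6 := by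
      rw [show (6 : ℝ≥0∞) = ENNReal.ofReal 6 by simp]
      exact ENNReal.ofReal_le_ofReal (by linarith)
    exact tendsto_eLpNorm_comp_sub (G := fun y => |y| ^ ((p + 1) / 2)) hs (abs_rpow_sub_le hs)
      (fun n => (h6 n).1.restrict)
      (memLp_restrict_of_memLp_six h.memLp_six hq6 r)
      (tendsto_eLpNorm_restrict hsub
        (zero_lt_one.trans_le (one_le_ofReal_two_mul hs.le)) hq6 (by norm_num) hlim6 r)

section

variable {δ t R : ℝ} {f : ℝ → ℝ}

/-- The vector field `f(t - ρ) v² x / ρ²`, whose divergence is `radialDivergence`. -/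
def radialField (δ : ℝ) (f : ℝ → ℝ) (t : ℝ) (v : Space → ℝ) (i : Fin 3) (x : Space) : ℝ :=
  f (t - rho δ x) * x i / rho δ x ^ 2 * v x ^ 2

lemma contDiff_radialField (hδ : 0 < δ) (hf : ContDiff ℝ ∞ f) {v : Space → ℝ}
    (hv : ContDiff ℝ ∞ v) (i : Fin 3) : ContDiff ℝ ∞ (radialField δ f t v i) :=
  (((contDiff_weight hf hδ t).mul (contDiff_coord i)).div ((contDiff_rho hδ).pow 2)
    fun x => pow_ne_zero _ (rho_pos hδ x).ne').mul (hv.pow 2)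

lemma sum_pd_radialField (hδ : 0 < δ) (hf : ContDiff ℝ ∞ f) {v : Space → ℝ}
    (hv : ContDiff ℝ ∞ v) (x : Space) :
    ∑ i, pd i (radialField δ f t v i) x = radialDivergence δ f t x (v x) fun i => pd i v x := by
  have h1 : (1 : WithTop ℕ∞) ≤ (∞ : WithTop ℕ∞) := by simp
  have hρ0 := (rho_pos hδ x).ne'
  have hρ0' : rho δ (x + (0 : ℝ) • basisVec 0) ≠ 0 := (rho_pos hδ _).ne'
  have key : ∀ i, pd i (radialField δ f t v i) x
      = ((-(deriv f (t - rho δ x) * (x i / rho δ x)) * x i + f (t - rho δ x)) / rho δ x ^ 2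
        - 2 * f (t - rho δ x) * x i * (x i / rho δ x) / rho δ x ^ 3) * v x ^ 2
        + 2 * f (t - rho δ x) * x i / rho δ x ^ 2 * v x * pd i v x := by
    intro i
    have hρ0' : rho δ (x + (0 : ℝ) • basisVec i) ≠ 0 := (rho_pos hδ _).ne'
    have hρ := hasDerivAt_rho_line hδ x i
    have hs : HasDerivAt (fun s : ℝ => f (t - rho δ (x + s • basisVec i)))
        (-(deriv f (t - rho δ x) * (x i / rho δ x))) 0 := by
      have h2 : HasDerivAt f (deriv f (t - rho δ x)) (t - rho δ (x + (0 : ℝ) • basisVec i)) := by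
        simpa using (hf.differentiable (by simp)).differentiableAt.hasDerivAt
      exact (HasDerivAt.comp (h₂ := f) (0 : ℝ) h2 (hρ.const_sub t)).congr_deriv (by ring)
    have hv0 := hasDerivAt_line (hv.of_le h1) x i
    have main := ((hs.mul (hasDerivAt_coord x i i)).div (hρ.pow 2) (pow_ne_zero _ hρ0')).mul
      (hv0.pow 2)
    rw [(hasDerivAt_line ((contDiff_radialField hδ hf hv i).of_le h1) x i).unique main]
    simp only [Pi.mul_apply, Pi.div_apply, Pi.pow_apply, zero_smul, add_zero]
    simp
    field_simp
  simp only [key, radialDivergence, radialCoeff, norm_sq_eq_sum, Fin.sum_univ_three]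
  field_simp
  ring

lemma integral_radialDivergence_smooth (hδ : 0 < δ) (hf : ContDiff ℝ ∞ f)
    (hR : ∀ s < -R, f s = 0) {v : Space → ℝ} (hv : ContDiff ℝ ∞ v) :
    ∫ x, radialDivergence δ f t x (v x) (fun i => pd i v x) = 0 := by
  have h1 : (1 : WithTop ℕ∞) ≤ (∞ : WithTop ℕ∞) := by simp
  have hF := fun i => (contDiff_radialField (t := t) hδ hf hv i).of_le h1
  have hFc : ∀ i, HasCompactSupport (radialField δ f t v i) := fun i =>
    hasCompactSupport_of_eq_zero (r := t + R) fun x hx => by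
      simp [radialField, weight_eq_zero hR hx]
  simp only [← sum_pd_radialField hδ hf hv]
  have hint : ∀ i, Integrable (pd i (radialField δ f t v i)) := fun i =>
    (((hF i).continuous_fderiv one_ne_zero).clm_apply
      continuous_const).integrable_of_hasCompactSupport (hasCompactSupport_pd (hFc i) i)
  rw [integral_finsetSum _ fun i _ => hint i, Finset.sum_eq_zero fun i _ =>
    integral_pd_eq_zero (hF i) (hFc i) i]

lemma MemHomSobolevOne.integral_radialDivergence {v : Space → ℝ} {g : Space → Space}
    (h : MemHomSobolevOne v g) (hδ : 0 < δ) (hf : ContDiff ℝ ∞ f) (hR : ∀ s < -R, f s = 0) :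
    ∫ x, radialDivergence δ f t x (v x) (fun i => g x i) = 0 := by
  have h1 := (h.localConvergence (le_refl 3) (by norm_num) (k := 0) MemLp.zero
    (t + R)).tendsto_integral_radialDivergence hδ hf hR
  simp only [fun n => integral_radialDivergence_smooth (t := t) hδ hf hR (contDiff_mollify
    (contDiff_mollifier n) (hasCompactSupport_mollifier n) h.locallyIntegrable)] at h1
  exact tendsto_nhds_unique h1 tendsto_const_nhds

variable {p : ℝ} {u : ℝ → Space → ℝ} {Du : ℝ → Space → Space} {ut : ℝ → Space → ℝ}

/-- The integrated inequality for the solution itself. -/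
lemma IsSolution.functional_le (hu : IsSolution p u Du ut) (hp : 3 ≤ p) (hp' : p ≤ 5)
    (a : ℝ) (hδ : 0 < δ) (hf : ContDiff ℝ ∞ f) (hR : ∀ s < -R, f s = 0) {t₀ t₁ : ℝ}
    (ht : t₀ ≤ t₁) {C M B : ℝ} (hC0 : 0 ≤ C) (hB0 : 0 ≤ B)
    (hprod : ∀ t ∈ Icc t₀ t₁, ∀ x y z w,
      -(C * (y / rho δ x) ^ 2) ≤ production p a δ f t x y z w)
    (hM : ∀ s ≤ t₁, |f s| ≤ M)
    (hB : ∀ t ∈ Icc t₀ t₁, eLpNorm (Du t) 2 volume ≤ ENNReal.ofReal B)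
    (hB' : ∀ t ∈ Icc t₀ t₁, eLpNorm (ut t) 2 volume ≤ ENNReal.ofReal B) :
    functional p a δ f t₀ (u t₀) (fun i x => Du t₀ x i) (ut t₀)
      ≤ functional p a δ f t₁ (u t₁) (fun i x => Du t₁ x i) (ut t₁)
      + C * (2 * B) ^ 2 * (t₁ - t₀) := by
  have hlim := fun t => ((hu.memHomSobolevOne t).localConvergence hp hp' (hu.memLp_ut t)
    (t + R)).tendsto_functional (a := a) hδ hf hR
  set K : ℝ≥0∞ := ENNReal.ofReal M * ((1 + 5 * ENNReal.ofReal |a|) * ENNReal.ofReal B)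
  have hK : K ≠ ⊤ := by finiteness
  have herr : Tendsto (fun n => (K * ∫⁻ t in Ioc t₀ t₁,
      eLpNorm (commutator p (mollifier n) (u t)) 2 volume).toReal) atTop (𝓝 0) := by
    have h1 := ENNReal.Tendsto.const_mul (a := K) (hu.tendsto_lintegral_commutator hp hp' t₀ t₁)
      (Or.inr hK)
    rw [mul_zero] at h1
    exact (ENNReal.tendsto_toReal ENNReal.zero_ne_top).comp h1
  have h2 := ((hlim t₁).add_const (C * (2 * B) ^ 2 * (t₁ - t₀))).add herr
  rw [add_zero] at h2
  refine le_of_tendsto_of_tendsto' (hlim t₀) h2 fun n => ?_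
  exact hu.functional_mollify_le hp a hδ hf hR ht hC0 hB0 hprod
    (fun t h x => hM _ (by linarith [h.2, rho_pos hδ x])) hB hB' n
    (hu.lintegral_commutator_ne_top hp hp' t₀ t₁ n)

end

/-! ### The outward energy density -/

/-- The density of the outward energy. -/
def outwardDensity (p : ℝ) (f : Space → ℝ) (g : Space → Space) (h : Space → ℝ) (x : Space) : ℝ :=
  1 / 4 * |Lminus f g h x| ^ 2 + 1 / 4 * ‖sphericalGrad g x‖ ^ 2
    + 1 / (2 * (p + 1)) * |f x| ^ (p + 1)

/-- The outward energy density with `ρ` in place of `|x|`. -/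
def regularDensity (p δ : ℝ) (x : Space) (y : ℝ) (z : Fin 3 → ℝ) (w : ℝ) : ℝ :=
  1 / 4 * ((∑ i, x i * z i + y) / rho δ x - w) ^ 2
    + 1 / 4 * (∑ i, z i ^ 2 - ((∑ i, x i * z i) / rho δ x) ^ 2) + 1 / 2 * potential p y

/-- The part of the outward functional that is lost as `δ → 0`. -/
def remainder (δ : ℝ) (f : ℝ → ℝ) (t : ℝ) (x : Space) (y : ℝ) : ℝ :=
  1 / 4 * ((1 - ‖x‖ ^ 2 / rho δ x ^ 2) / rho δ x)
    * (deriv f (t - rho δ x) + 2 * f (t - rho δ x) / rho δ x) * y ^ 2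

/-- A function that dominates all the energy densities. For states in the energy space it is locally
integrable, by Hardy's inequality. -/
def majorant (v : Space → ℝ) (g : Space → Space) (k : Space → ℝ) (x : Space) : ℝ :=
  ‖g x‖ ^ 2 + k x ^ 2 + (v x / ‖x‖) ^ 2 + (1 + |v x| ^ 6)

section

variable {p δ t R : ℝ} {f : ℝ → ℝ} {v k : Space → ℝ} {g : Space → Space}

lemma outwardDensity_nonneg (hp : 3 ≤ p) (x : Space) : 0 ≤ outwardDensity p v g k x := by
  have : 0 < p + 1 := by linarith
  unfold outwardDensity
  positivity

lemma inner_radialDir (z x : Space) : inner ℝ z (radialDir x) = (∑ i, x i * z i) / ‖x‖ := by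
  rw [radialDir, inner_smul_right, PiLp.inner_apply]
  simp [div_eq_inv_mul]

lemma outwardDensity_eq {x : Space} (hx : ‖x‖ ≠ 0) : outwardDensity p v g k x
    = 1 / 4 * ((∑ i, x i * g x i + v x) / ‖x‖ - k x) ^ 2
    + 1 / 4 * (∑ i, g x i ^ 2 - ((∑ i, x i * g x i) / ‖x‖) ^ 2) + 1 / 2 * potential p (v x) := by
  have h1 : ‖sphericalGrad g x‖ ^ 2 = ‖g x‖ ^ 2 - inner ℝ (g x) (radialDir x) ^ 2 := by
    have h2 : ‖radialDir x‖ = 1 := by rw [radialDir, norm_smul]; simp [hx]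
    rw [sphericalGrad, norm_sub_sq_real, norm_smul, inner_smul_right, h2, mul_one,
      Real.norm_eq_abs, sq_abs]
    ring
  have h3 : 1 / (2 * (p + 1)) = 1 / 2 * (1 / (p + 1)) := by rw [one_div_mul_one_div]
  rw [outwardDensity, h1, h3, sq_abs, Lminus, inner_radialDir, norm_sq_eq_sum, potential, add_div]
  ring

/-- Up to a divergence, the outward functional has the regularised outward energy density. -/
lemma density_one_eq (hδ : 0 < δ) (x : Space) (y : ℝ) (z : Fin 3 → ℝ) (w : ℝ) :
    density p 1 δ f t x y z w = f (t - rho δ x) * regularDensity p δ x y z w + remainder δ f t x y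
      - 1 / 4 * radialDivergence δ f t x y z := by
  have := (rho_pos hδ x).ne'
  simp only [density, regularDensity, remainder, radialDivergence, radialCoeff, Fin.sum_univ_three]
  field_simp
  ring

lemma potential_le (hp : 3 ≤ p) (hp' : p ≤ 5) (y : ℝ) : potential p y ≤ 1 + |y| ^ 6 := by
  have h1 := rpow_le_one_add_pow_six (abs_nonneg y) (by linarith : p + 1 ≤ 6) (by linarith)
  have h2 : 1 / (p + 1) ≤ 1 := by
    rw [div_le_one (by linarith)]; linarith
  have h3 : 0 ≤ |y| ^ (p + 1) := by positivity
  rw [potential]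
  nlinarith

lemma regularDensity_nonneg (hp : 3 ≤ p) (hδ : 0 < δ) (x : Space) (y : ℝ) (z : Fin 3 → ℝ) (w : ℝ) :
    0 ≤ regularDensity p δ x y z w := by
  have h1 := sq_radial_le hδ x z
  have h2 := norm_sq_div_rho_sq_le hδ x
  have h3 : 0 ≤ ∑ i, z i ^ 2 := Finset.sum_nonneg fun i _ => sq_nonneg _
  have h4 := potential_nonneg hp y
  have h5 := mul_le_mul_of_nonneg_right h2 h3
  have h6 := sq_nonneg ((∑ i, x i * z i + y) / rho δ x - w)
  unfold regularDensity
  linarith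

lemma sq_div_rho_le (hδ : 0 < δ) {x : Space} (hx : ‖x‖ ≠ 0) (y : ℝ) :
    (y / rho δ x) ^ 2 ≤ (y / ‖x‖) ^ 2 := by
  have h1 : 0 < ‖x‖ := lt_of_le_of_ne (norm_nonneg x) hx.symm
  have h2 := rho_pos hδ x
  rw [div_pow, div_pow]
  gcongr
  exact norm_le_rho δ x

lemma regularDensity_le (hp : 3 ≤ p) (hp' : p ≤ 5) (hδ : 0 < δ) {x : Space} (hx : ‖x‖ ≠ 0) (y : ℝ)
    (z : Fin 3 → ℝ) (w : ℝ) :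
    regularDensity p δ x y z w ≤ ∑ i, z i ^ 2 + w ^ 2 + (y / ‖x‖) ^ 2 + (1 + |y| ^ 6) := by
  have h1 := sq_radial_le hδ x z
  have h2 := norm_sq_div_rho_sq_le hδ x
  have h3 : 0 ≤ ∑ i, z i ^ 2 := Finset.sum_nonneg fun i _ => sq_nonneg _
  have h4 := potential_le hp hp' y
  have h4' := potential_nonneg hp y
  have h5 := mul_le_mul_of_nonneg_right h2 h3
  have h6 := sq_div_rho_le hδ hx y
  rw [regularDensity, add_div]
  set A := (∑ i, x i * z i) / rho δ x
  set Y := y / rho δ x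
  nlinarith [sq_nonneg (A - Y), sq_nonneg (A + w), sq_nonneg (Y + w)]

lemma majorant_nonneg (x : Space) : 0 ≤ majorant v g k x := by
  unfold majorant; positivity

lemma MemHomSobolevOne.integrableOn_majorant (h : MemHomSobolevOne v g) (hk : MemLp k 2 volume)
    (r : ℝ) : IntegrableOn (majorant v g k) (Metric.closedBall 0 r) := by
  have h1 : Integrable fun x => ‖g x‖ ^ 2 := h.memLp_grad.integrable_norm_pow (by norm_num)
  have h2 : Integrable fun x => k x ^ 2 := hk.integrable_sq
  have h3 : Integrable fun x => (v x / ‖x‖) ^ 2 := h.memLp_div_norm.integrable_sq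
  have h4 := (locallyIntegrable_one_add_pow_six h.memLp_six).integrableOn_isCompact
    (isCompact_closedBall (0 : Space) r)
  exact ((h1.add_fun h2).add_fun h3).integrableOn.add h4

/-- Functions of bounded support which are dominated by the energy densities are integrable. -/
lemma MemHomSobolevOne.integrable_of_le_majorant (h : MemHomSobolevOne v g) (hk : MemLp k 2 volume)
    {F : Space → ℝ} (hF : AEStronglyMeasurable F volume) {r K : ℝ}
    (hr : ∀ x, r < ‖x‖ → F x = 0) (hK : ∀ᵐ x, |F x| ≤ K * majorant v g k x) : Integrable F := by
  have h1 : IntegrableOn F (Metric.closedBall 0 r) :=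
    ((h.integrableOn_majorant hk r).const_mul K).mono' hF.restrict (ae_restrict_of_ae hK)
  have h2 : IntegrableOn F univ := h1.of_forall_sdiff_eq_zero MeasurableSet.univ fun x hx =>
    hr x (by simpa using hx)
  rwa [integrableOn_univ] at h2

/-- A continuous weight that vanishes near `-∞` is bounded on every left half-line. -/
lemma exists_weight_bound (hf : Continuous f) (hR : ∀ s < -R, f s = 0) (t : ℝ) :
    ∃ M, 0 ≤ M ∧ ∀ s ≤ t, |f s| ≤ M := by
  obtain ⟨C, hC⟩ := isCompact_Icc.exists_bound_of_continuousOn (s := Icc (-R) t) hf.continuousOn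
  refine ⟨max C 0, le_max_right _ _, fun s hs => ?_⟩
  rcases lt_or_ge s (-R) with h | h
  · rw [hR s h, abs_zero]; exact le_max_right _ _
  · exact (hC s ⟨h, hs⟩).trans (le_max_left _ _)

lemma abs_remainder_le (hδ : 0 < δ) {M : ℝ} (hM : ∀ s ≤ t, |f s| ≤ M)
    (hM' : ∀ s ≤ t, |deriv f s| ≤ M) {r : ℝ} {x : Space} (hx : ‖x‖ ≠ 0)
    (hxr : ‖x‖ ≤ r) (y : ℝ) :
    |remainder δ f t x y| ≤ M * (r + 2) * (y / ‖x‖) ^ 2 := by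
  have hx0 : 0 < ‖x‖ := lt_of_le_of_ne (norm_nonneg x) hx.symm
  have hρ := rho_pos hδ x
  have hle := norm_le_rho δ x
  have hM0 : 0 ≤ M := (abs_nonneg _).trans (hM t le_rfl)
  have hs : t - rho δ x ≤ t := by linarith
  have h1 := norm_sq_div_rho_sq_le hδ x
  have h1' : 0 ≤ ‖x‖ ^ 2 / rho δ x ^ 2 := by positivity
  have hb : |deriv f (t - rho δ x) + 2 * f (t - rho δ x) / rho δ x| ≤ M + 2 * M / ‖x‖ := by
    refine (abs_add_le _ _).trans (add_le_add (hM' _ hs) ?_)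
    rw [abs_div, abs_mul, abs_of_pos hρ, abs_two]
    have := hM _ hs
    gcongr
  have hc : |1 / 4 * ((1 - ‖x‖ ^ 2 / rho δ x ^ 2) / rho δ x)| ≤ 1 / ‖x‖ := by
    rw [abs_of_nonneg (mul_nonneg (by norm_num) (div_nonneg (by linarith) hρ.le)), ← mul_div_assoc]
    gcongr
    linarith
  rw [remainder, abs_mul, abs_mul, abs_of_nonneg (sq_nonneg y)]
  calc _ ≤ 1 / ‖x‖ * (M + 2 * M / ‖x‖) * y ^ 2 := by gcongr
    _ = M * (‖x‖ + 2) * (y / ‖x‖) ^ 2 := by field_simp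
    _ ≤ _ := by gcongr

/-- A bound for the regularised integrand which does not depend on `δ`. -/
lemma abs_weight_mul_regularDensity_add_remainder_le (hp : 3 ≤ p) (hp' : p ≤ 5) (hδ : 0 < δ)
    (hR : ∀ s < -R, f s = 0) {M : ℝ} (hM : ∀ s ≤ t, |f s| ≤ M) (hM' : ∀ s ≤ t, |deriv f s| ≤ M)
    {x : Space} (hx : ‖x‖ ≠ 0) :
    |f (t - rho δ x) * regularDensity p δ x (v x) (fun i => g x i) (k x) + remainder δ f t x (v x)|
      ≤ M * (|t + R| + 3) * majorant v g k x := by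
  have hM0 : 0 ≤ M := (abs_nonneg _).trans (hM t le_rfl)
  have hm := majorant_nonneg (v := v) (g := g) (k := k) x
  rcases lt_or_ge (t + R) ‖x‖ with h | h
  · rw [remainder, weight_eq_zero hR h, weight_eq_zero (deriv_eq_zero_of_lt hR) h]
    simp
    positivity
  have h1 := abs_remainder_le hδ hM hM' hx (h.trans (le_abs_self _)) (v x)
  have h2 : regularDensity p δ x (v x) (fun i => g x i) (k x) ≤ majorant v g k x := by
    rw [majorant, norm_sq_eq_sum]
    exact regularDensity_le hp hp' hδ hx _ _ _
  have h3 := regularDensity_nonneg hp hδ x (v x) (fun i => g x i) (k x)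
  have h4 : (v x / ‖x‖) ^ 2 ≤ majorant v g k x := by
    have : 0 ≤ ‖g x‖ ^ 2 + k x ^ 2 + (1 + |v x| ^ 6) := by positivity
    rw [majorant]; linarith
  refine (abs_add_le _ _).trans ?_
  rw [abs_mul, abs_of_nonneg h3]
  calc _ ≤ M * majorant v g k x + M * (|t + R| + 2) * majorant v g k x := by
        refine add_le_add (mul_le_mul (hM _ (by linarith [rho_pos hδ x])) h2 h3 hM0)
          (h1.trans ?_)
        gcongr
    _ = _ := by ring

lemma aemeasurable_weight_mul_regularDensity_add_remainder (hp : 3 ≤ p) (hδ : 0 < δ)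
    (hf : ContDiff ℝ ∞ f) (h : MemHomSobolevOne v g) (hk : MemLp k 2 volume) :
    AEMeasurable fun x => f (t - rho δ x) * regularDensity p δ x (v x) (fun i => g x i) (k x)
      + remainder δ f t x (v x) := by
  have hv := h.memLp_six.1.aemeasurable
  have hg := fun i => (memLp_coord h.memLp_grad i).1.aemeasurable
  have hk' := hk.1.aemeasurable
  have hρ : AEMeasurable (rho δ) := (continuous_rho δ).aemeasurable
  have hφ : AEMeasurable fun x => f (t - rho δ x) :=
    (contDiff_weight hf hδ t).continuous.aemeasurable
  have hφ' : AEMeasurable fun x => deriv f (t - rho δ x) :=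
    (contDiff_weight (contDiff_deriv hf) hδ t).continuous.aemeasurable
  have hs : AEMeasurable fun x => ∑ i, x i * g x i := Finset.aemeasurable_fun_sum _ fun i _ =>
    (contDiff_coord i).continuous.aemeasurable.mul (hg i)
  have hs2 : AEMeasurable fun x => ∑ i, g x i ^ 2 := Finset.aemeasurable_fun_sum _ fun i _ =>
    (hg i).pow_const 2
  have hV := (continuous_potential hp).measurable.comp_aemeasurable hv
  have hn : AEMeasurable fun x : Space => ‖x‖ ^ 2 := (continuous_norm.pow 2).aemeasurable
  exact (hφ.mul ((((((hs.add hv).div hρ).sub hk').pow_const 2).const_mul _).add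
    ((hs2.sub ((hs.div hρ).pow_const 2)).const_mul _) |>.add (hV.const_mul _))).add
    ((((aemeasurable_const.sub (hn.div (hρ.pow_const 2))).div hρ).const_mul _).mul
      (hφ'.add ((hφ.const_mul 2).div hρ)) |>.mul (hv.pow_const 2))

/-- The outward functional is the integral of the regularised outward energy density. -/
lemma MemHomSobolevOne.functional_one_eq (h : MemHomSobolevOne v g) (hk : MemLp k 2 volume)
    (hp : 3 ≤ p) (hp' : p ≤ 5) (hδ : 0 < δ) (hf : ContDiff ℝ ∞ f) (hR : ∀ s < -R, f s = 0) :
    functional p 1 δ f t v (fun i x => g x i) k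
      = ∫ x, (f (t - rho δ x) * regularDensity p δ x (v x) (fun i => g x i) (k x)
        + remainder δ f t x (v x)) := by
  obtain ⟨M₁, hM₁0, hM₁⟩ := exists_weight_bound hf.continuous hR t
  obtain ⟨M₂, hM₂0, hM₂⟩ := exists_weight_bound (contDiff_deriv hf).continuous
    (deriv_eq_zero_of_lt hR) t
  have h1 : Integrable fun x => f (t - rho δ x) * regularDensity p δ x (v x) (fun i => g x i) (k x)
      + remainder δ f t x (v x) := by
    refine h.integrable_of_le_majorant hk (r := t + R) (K := (M₁ + M₂) * (|t + R| + 3))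
      (aemeasurable_weight_mul_regularDensity_add_remainder hp hδ hf h hk).aestronglyMeasurable
      (fun x hx => ?_) ?_
    · rw [remainder, weight_eq_zero hR hx, weight_eq_zero (deriv_eq_zero_of_lt hR) hx]
      simp
    · filter_upwards [ae_norm_ne_zero] with x hx
      exact abs_weight_mul_regularDensity_add_remainder_le hp hp' hδ hR
        (fun s hs => (hM₁ s hs).trans (by linarith)) (fun s hs => (hM₂ s hs).trans (by linarith)) hx
  have h2 := integrable_radialDivergence (t := t) hδ hf hR
    (memLp_restrict_of_memLp_six h.memLp_six (by norm_num) _)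
    (fun i => (memLp_coord h.memLp_grad i).restrict _)
  simp only [functional, density_one_eq hδ]
  rw [integral_sub h1 (h2.const_mul _), integral_const_mul, h.integral_radialDivergence hδ hf hR]
  ring

/-- As `δ → 0` the outward functional tends to the weighted outward energy. -/
lemma MemHomSobolevOne.tendsto_functional_one (h : MemHomSobolevOne v g) (hk : MemLp k 2 volume)
    (hp : 3 ≤ p) (hp' : p ≤ 5) (hf : ContDiff ℝ ∞ f) (hR : ∀ s < -R, f s = 0) :
    Tendsto (fun n : ℕ => functional p 1 (1 / ((n : ℝ) + 1)) f t v (fun i x => g x i) k) atTop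
      (𝓝 (∫ x, f (t - ‖x‖) * outwardDensity p v g k x)) := by
  obtain ⟨M₁, hM₁0, hM₁⟩ := exists_weight_bound hf.continuous hR t
  obtain ⟨M₂, hM₂0, hM₂⟩ := exists_weight_bound (contDiff_deriv hf).continuous
    (deriv_eq_zero_of_lt hR) t
  have hδ : ∀ n : ℕ, 0 < 1 / ((n : ℝ) + 1) := fun n => by positivity
  simp only [fun n => h.functional_one_eq (t := t) hk hp hp' (hδ n) hf hR]
  have hbd : ∀ n : ℕ, ∀ᵐ x, ‖f (t - rho (1 / ((n : ℝ) + 1)) x)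
      * regularDensity p (1 / ((n : ℝ) + 1)) x (v x) (fun i => g x i) (k x)
      + remainder (1 / ((n : ℝ) + 1)) f t x (v x)‖
      ≤ (Metric.closedBall 0 (t + R)).indicator
        (fun x => (M₁ + M₂) * (|t + R| + 3) * majorant v g k x) x := by
    intro n
    filter_upwards [ae_norm_ne_zero] with x hx
    by_cases hxr : x ∈ Metric.closedBall 0 (t + R)
    · rw [indicator_of_mem hxr]
      exact abs_weight_mul_regularDensity_add_remainder_le hp hp' (hδ n) hR
        (fun s hs => (hM₁ s hs).trans (by linarith)) (fun s hs => (hM₂ s hs).trans (by linarith)) hx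
    · rw [indicator_of_notMem hxr]
      have hx' : t + R < ‖x‖ := by simpa using hxr
      rw [remainder, weight_eq_zero hR hx', weight_eq_zero (deriv_eq_zero_of_lt hR) hx']
      simp
  refine tendsto_integral_of_dominated_convergence _ (fun n =>
    (aemeasurable_weight_mul_regularDensity_add_remainder hp (hδ n) hf h
      hk).aestronglyMeasurable) ?_ hbd ?_
  · exact (integrable_indicator_iff measurableSet_closedBall).2
      ((h.integrableOn_majorant hk _).const_mul _)
  · filter_upwards [ae_norm_ne_zero] with x hx
    have hρ := tendsto_rho tendsto_one_div_add_atTop_nhds_zero_nat x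
    have hφ := (hf.continuous.tendsto (t - ‖x‖)).comp (hρ.const_sub t)
    have hφ' := ((contDiff_deriv hf).continuous.tendsto (t - ‖x‖)).comp (hρ.const_sub t)
    rw [outwardDensity_eq hx]
    have e1 := (((((tendsto_const_nhds (x := ∑ i, x i * g x i + v x)).div hρ hx).sub_const
      (k x)).pow 2).const_mul (1 / 4)).add ((((((tendsto_const_nhds
      (x := ∑ i, x i * g x i)).div hρ hx).pow 2).const_sub (∑ i, g x i ^ 2)).const_mul (1 / 4)))
      |>.add_const (1 / 2 * potential p (v x))
    have e2 : Tendsto (fun n : ℕ => remainder (1 / ((n : ℝ) + 1)) f t x (v x)) atTop (𝓝 0) := by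
      have e3 := (((((tendsto_const_nhds (x := ‖x‖ ^ 2)).div (hρ.pow 2)
        (pow_ne_zero 2 hx)).const_sub 1).div hρ hx).const_mul (1 / 4)).mul
        (hφ'.add ((hφ.const_mul 2).div hρ hx)) |>.mul_const (v x ^ 2)
      rw [div_self (pow_ne_zero 2 hx), sub_self, zero_div, mul_zero, zero_mul, zero_mul] at e3
      exact e3
    have e4 := (hφ.mul e1).add e2
    rw [add_zero] at e4
    exact e4

variable {u : ℝ → Space → ℝ} {Du : ℝ → Space → Space} {ut : ℝ → Space → ℝ}

/-- The outward energy, weighted by a function of `t - |x|` for which `f + f' r ≥ 0` holds at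
distance `r` from the origin, is nondecreasing. -/
lemma IsSolution.integral_outwardDensity_le (hu : IsSolution p u Du ut) (hp : 3 ≤ p) (hp' : p ≤ 5)
    (hf : ContDiff ℝ ∞ f) (hR : ∀ s < -R, f s = 0) {t₀ t₁ : ℝ} (ht : t₀ ≤ t₁)
    (hf0 : ∀ s ≤ t₁, 0 ≤ f s) (hf1 : ∀ s r, 0 < r → s + r ≤ t₁ → 0 ≤ f s + deriv f s * r) :
    ∫ x, f (t₀ - ‖x‖) * outwardDensity p (u t₀) (Du t₀) (ut t₀) x
      ≤ ∫ x, f (t₁ - ‖x‖) * outwardDensity p (u t₁) (Du t₁) (ut t₁) x := by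
  obtain ⟨M, hM0, hM⟩ := exists_weight_bound hf.continuous hR t₁
  obtain ⟨C, hC0, hC⟩ := exists_weight_bound (contDiff_deriv (contDiff_deriv hf)).continuous
    (deriv_eq_zero_of_lt (deriv_eq_zero_of_lt hR)) t₁
  obtain ⟨B₁, hB₁0, hB₁⟩ := exists_eLpNorm_le hu.memLp_Du hu.continuous_Du t₀ t₁
  obtain ⟨B₂, hB₂0, hB₂⟩ := exists_eLpNorm_le hu.memLp_ut hu.continuous_ut t₀ t₁
  have hlim := fun t => (hu.memHomSobolevOne t).tendsto_functional_one (t := t) (hu.memLp_ut t)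
    hp hp' hf hR
  have h0 : Tendsto (fun n : ℕ => C * (1 / ((n : ℝ) + 1)) * (2 * (B₁ + B₂)) ^ 2 * (t₁ - t₀))
      atTop (𝓝 0) := by
    have := ((tendsto_one_div_add_atTop_nhds_zero_nat (𝕜 := ℝ)).const_mul C).mul_const
      ((2 * (B₁ + B₂)) ^ 2) |>.mul_const (t₁ - t₀)
    simpa using this
  have h1 := (hlim t₁).add h0
  rw [add_zero] at h1
  refine le_of_tendsto_of_tendsto' (hlim t₀) h1 fun n => ?_
  have hδ : 0 < 1 / ((n : ℝ) + 1) := by positivity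
  refine hu.functional_le hp hp' 1 hδ hf hR ht (by positivity) (by positivity)
    (fun t h x y z w => ?_) hM (fun t h => (hB₁ t h).trans (ENNReal.ofReal_le_ofReal (by linarith)))
    (fun t h => (hB₂ t h).trans (ENNReal.ofReal_le_ofReal (by linarith)))
  have hρ := rho_pos hδ x
  have hs : t - rho (1 / ((n : ℝ) + 1)) x ≤ t₁ := by linarith [h.2]
  refine le_production_one hp hδ (hf0 _ hs) ?_ (hC _ hs) y z w
  have h2 := hf1 (t - rho (1 / ((n : ℝ) + 1)) x) _ hρ (by linarith [h.2])
  have h3 := div_nonneg h2 hρ.le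
  rw [add_div, mul_div_cancel_right₀ _ hρ.ne'] at h3
  linarith

end

/-! ### Monotonicity of the energy and bounds for the outward energy -/

/-- The density of the energy. -/
def energyDensity (p : ℝ) (f : Space → ℝ) (g : Space → Space) (h : Space → ℝ) (x : Space) : ℝ :=
  1 / 2 * ‖g x‖ ^ 2 + 1 / 2 * |h x| ^ 2 + 1 / (p + 1) * |f x| ^ (p + 1)

section

variable {p δ t R : ℝ} {f : ℝ → ℝ} {v k : Space → ℝ} {g : Space → Space}

lemma energyDensity_nonneg (hp : 3 ≤ p) (x : Space) : 0 ≤ energyDensity p v g k x := by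
  have : 0 < p + 1 := by linarith
  unfold energyDensity
  positivity

lemma energyDensity_le_majorant (hp : 3 ≤ p) (hp' : p ≤ 5) (x : Space) :
    energyDensity p v g k x ≤ majorant v g k x := by
  have h1 := potential_le hp hp' (v x)
  rw [potential] at h1
  rw [energyDensity, majorant, sq_abs]
  nlinarith [sq_nonneg (k x), sq_nonneg ‖g x‖, sq_nonneg (v x / ‖x‖)]

lemma outwardDensity_le_majorant (hp : 3 ≤ p) (hp' : p ≤ 5) {x : Space} (hx : ‖x‖ ≠ 0) :
    outwardDensity p v g k x ≤ majorant v g k x := by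
  have h1 := potential_le hp hp' (v x)
  have h2 := potential_nonneg hp (v x)
  have h3 : ((∑ i, x i * g x i) / ‖x‖) ^ 2 ≤ ‖g x‖ ^ 2 := by
    rw [div_pow, div_le_iff₀ (by positivity), norm_sq_eq_sum (g x), mul_comm]
    exact sq_sum_coord_mul_le x _
  rw [outwardDensity_eq hx, majorant, add_div, ← norm_sq_eq_sum]
  set A := (∑ i, x i * g x i) / ‖x‖
  set Y := v x / ‖x‖
  nlinarith [sq_nonneg (A - Y), sq_nonneg (A + k x), sq_nonneg (Y + k x)]

lemma outwardDensity_le (hp : 3 ≤ p) {x : Space} (hx : ‖x‖ ≠ 0) :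
    outwardDensity p v g k x ≤ 2 * energyDensity p v g k x + (v x / ‖x‖) ^ 2 := by
  have h2 := potential_nonneg hp (v x)
  have h3 : ((∑ i, x i * g x i) / ‖x‖) ^ 2 ≤ ‖g x‖ ^ 2 := by
    rw [div_pow, div_le_iff₀ (by positivity), norm_sq_eq_sum (g x), mul_comm]
    exact sq_sum_coord_mul_le x _
  rw [outwardDensity_eq hx, add_div, ← norm_sq_eq_sum, energyDensity, sq_abs, ← potential]
  set A := (∑ i, x i * g x i) / ‖x‖
  set Y := v x / ‖x‖
  nlinarith [sq_nonneg (A - Y), sq_nonneg (A + k x), sq_nonneg (Y + k x)]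

lemma MemHomSobolevOne.aemeasurable_energyDensity (h : MemHomSobolevOne v g)
    (hk : MemLp k 2 volume) : AEMeasurable (energyDensity p v g k) :=
  (((h.memLp_grad.1.norm.aemeasurable.pow_const 2).const_mul _).add
    ((hk.1.norm.aemeasurable.pow_const 2).const_mul _)).add
    ((h.memLp_six.1.norm.aemeasurable.pow_const _).const_mul _)

lemma MemHomSobolevOne.aemeasurable_outwardDensity (h : MemHomSobolevOne v g)
    (hk : MemLp k 2 volume) : AEMeasurable (outwardDensity p v g k) := by
  have hr : AEStronglyMeasurable radialDir volume :=
    ((measurable_norm.inv).smul measurable_id).aestronglyMeasurable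
  have hg := h.memLp_grad.1
  have h1 : AEStronglyMeasurable (fun x => inner ℝ (g x) (radialDir x)) volume := hg.inner hr
  have h2 : AEStronglyMeasurable (sphericalGrad g) volume := hg.sub (h1.smul hr)
  have h3 : AEMeasurable (Lminus v g k) :=
    (h1.aemeasurable.add (h.memLp_six.1.aemeasurable.div measurable_norm.aemeasurable)).sub
      hk.1.aemeasurable
  exact (((h3.norm.pow_const 2).const_mul _).add
    ((h2.norm.aemeasurable.pow_const 2).const_mul _)).add
    ((h.memLp_six.1.norm.aemeasurable.pow_const _).const_mul _)

lemma two_mul_ofReal (a : ℝ) : 2 * ENNReal.ofReal a = ENNReal.ofReal (2 * a) := by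
  rw [ENNReal.ofReal_mul (by norm_num)]; simp

/-- By Hardy's inequality the outward energy is controlled by the energy. -/
lemma MemHomSobolevOne.outwardEnergy_le (h : MemHomSobolevOne v g) (hk : MemLp k 2 volume)
    (hp : 3 ≤ p) : outwardEnergy p v g k univ ≤ 10 * energy p v g k := by
  have hE : AEMeasurable fun x => ENNReal.ofReal (energyDensity p v g k x) :=
    (h.aemeasurable_energyDensity hk).ennreal_ofReal
  have h1 : ∫⁻ x, ENNReal.ofReal ((v x / ‖x‖) ^ 2) ≤ 8 * energy p v g k := by
    rw [← eLpNorm_two_sq_real]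
    calc _ ≤ (2 * eLpNorm g 2 volume) ^ 2 := by gcongr; exact h.hardy
      _ = 4 * ∫⁻ x, ‖g x‖ₑ ^ 2 := by rw [mul_pow, eLpNorm_two_sq]; norm_num
      _ ≤ 4 * ∫⁻ x, 2 * ENNReal.ofReal (energyDensity p v g k x) := by
          gcongr with x
          rw [← ofReal_norm, ← ENNReal.ofReal_pow (norm_nonneg _),
            two_mul_ofReal]
          refine ENNReal.ofReal_le_ofReal ?_
          have := potential_nonneg hp (v x)
          rw [energyDensity, ← potential, sq_abs]
          nlinarith [sq_nonneg (k x)]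
      _ = 8 * energy p v g k := by
          rw [lintegral_const_mul' _ _ (by norm_num), ← mul_assoc]
          norm_num [energy, energyDensity]
  calc outwardEnergy p v g k univ = ∫⁻ x, ENNReal.ofReal (outwardDensity p v g k x) := by
        rw [outwardEnergy, Measure.restrict_univ]; rfl
    _ ≤ ∫⁻ x, (2 * ENNReal.ofReal (energyDensity p v g k x)
          + ENNReal.ofReal ((v x / ‖x‖) ^ 2)) := by
        refine lintegral_mono_ae ?_
        filter_upwards [ae_norm_ne_zero] with x hx
        rw [two_mul_ofReal, ← ENNReal.ofReal_add (mul_nonneg (by norm_num) (energyDensity_nonneg hp x))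
            (sq_nonneg _)]
        exact ENNReal.ofReal_le_ofReal (outwardDensity_le hp hx)
    _ = 2 * energy p v g k + ∫⁻ x, ENNReal.ofReal ((v x / ‖x‖) ^ 2) := by
        rw [lintegral_add_left' (hE.const_mul 2), lintegral_const_mul' _ _ (by norm_num)]
        rfl
    _ ≤ 2 * energy p v g k + 8 * energy p v g k := by gcongr
    _ = _ := by rw [← add_mul]; norm_num

variable {u : ℝ → Space → ℝ} {Du : ℝ → Space → Space} {ut : ℝ → Space → ℝ}

/-- A weighted integral inequality between nonnegative densities passes to lower integrals, and to
the limit of the weights. -/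
lemma lintegral_le_of_weights {D₀ D₁ : Space → ℝ} {a₀ a₁ : ℕ → Space → ℝ} {b₀ b₁ : Space → ℝ}
    (hD₁ : ∀ x, 0 ≤ D₁ x) (hD₀ : ∀ x, 0 ≤ D₀ x)
    (h₀ : ∀ n, Integrable fun x => a₀ n x * D₀ x) (h₁ : ∀ n, Integrable fun x => a₁ n x * D₁ x)
    (ha₀ : ∀ n x, 0 ≤ a₀ n x) (ha₁ : ∀ n x, 0 ≤ a₁ n x)
    (hlim : ∀ x, Tendsto (fun n => a₀ n x) atTop (𝓝 (b₀ x))) (hle : ∀ n x, a₁ n x ≤ b₁ x)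
    (h : ∀ n, ∫ x, a₀ n x * D₀ x ≤ ∫ x, a₁ n x * D₁ x) :
    ∫⁻ x, ENNReal.ofReal (b₀ x * D₀ x) ≤ ∫⁻ x, ENNReal.ofReal (b₁ x * D₁ x) := by
  have hbd : ∀ n, ∫⁻ x, ENNReal.ofReal (a₀ n x * D₀ x) ≤ ∫⁻ x, ENNReal.ofReal (b₁ x * D₁ x) := by
    intro n
    rw [← ofReal_integral_eq_lintegral_ofReal (h₀ n)
      (Eventually.of_forall fun x => mul_nonneg (ha₀ n x) (hD₀ x))]
    refine (ENNReal.ofReal_le_ofReal (h n)).trans ?_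
    rw [ofReal_integral_eq_lintegral_ofReal (h₁ n)
      (Eventually.of_forall fun x => mul_nonneg (ha₁ n x) (hD₁ x))]
    exact lintegral_mono fun x => ENNReal.ofReal_le_ofReal
      (mul_le_mul_of_nonneg_right (hle n x) (hD₁ x))
  calc ∫⁻ x, ENNReal.ofReal (b₀ x * D₀ x)
      = ∫⁻ x, liminf (fun n => ENNReal.ofReal (a₀ n x * D₀ x)) atTop :=
        lintegral_congr fun x =>
          (ENNReal.tendsto_ofReal ((hlim x).mul_const (D₀ x))).liminf_eq.symm
    _ ≤ liminf (fun n => ∫⁻ x, ENNReal.ofReal (a₀ n x * D₀ x)) atTop :=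
        lintegral_liminf_le' fun n => (h₀ n).1.aemeasurable.ennreal_ofReal
    _ ≤ liminf (fun _ : ℕ => ∫⁻ x, ENNReal.ofReal (b₁ x * D₁ x)) atTop :=
        liminf_le_liminf (Eventually.of_forall hbd)
    _ = _ := by simp

lemma smoothTransition_add_eq_zero (R : ℝ) : ∀ s < -R, Real.smoothTransition (s + R) = 0 :=
  fun s hs => Real.smoothTransition.zero_of_nonpos (by linarith)

lemma tendsto_smoothTransition_add (s : ℝ) :
    Tendsto (fun n : ℕ => Real.smoothTransition (s + n)) atTop (𝓝 1) := by
  refine tendsto_const_nhds.congr' ?_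
  filter_upwards [eventually_ge_atTop ⌈1 - s⌉₊] with n hn
  have : (1 : ℝ) - s ≤ n := Nat.ceil_le.1 hn
  exact (Real.smoothTransition.one_of_one_le (by linarith)).symm

lemma deriv_smoothTransition_add_nonneg (R s : ℝ) :
    0 ≤ deriv (fun s => Real.smoothTransition (s + R)) s := by
  refine Monotone.deriv_nonneg fun a b hab => Real.smoothTransition.monotone (by linarith)

/-- The energy does not decrease: this holds for the energy weighted by a nondecreasing function of
`t - ρ`, and such weights increase to `1`. -/
lemma IsSolution.energy_le (hu : IsSolution p u Du ut) (hp : 3 ≤ p) (hp' : p ≤ 5) {t₀ t₁ : ℝ}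
    (ht : t₀ ≤ t₁) : energy p (u t₀) (Du t₀) (ut t₀) ≤ energy p (u t₁) (Du t₁) (ut t₁) := by
  set f : ℕ → ℝ → ℝ := fun n s => Real.smoothTransition (s + n) with hfdef
  have hf : ∀ n, ContDiff ℝ ∞ (f n) := fun n =>
    smoothTransition_contDiff.comp (contDiff_id.add contDiff_const)
  have hR : ∀ n : ℕ, ∀ s < -(n : ℝ), f n s = 0 := fun n => smoothTransition_add_eq_zero n
  have h01 : ∀ n s, 0 ≤ f n s ∧ f n s ≤ 1 := fun n s =>
    ⟨Real.smoothTransition.nonneg _, Real.smoothTransition.le_one _⟩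
  obtain ⟨B₁, hB₁0, hB₁⟩ := exists_eLpNorm_le hu.memLp_Du hu.continuous_Du t₀ t₁
  obtain ⟨B₂, hB₂0, hB₂⟩ := exists_eLpNorm_le hu.memLp_ut hu.continuous_ut t₀ t₁
  have hint : ∀ n t, Integrable fun x =>
      f n (t - rho 1 x) * energyDensity p (u t) (Du t) (ut t) x := by
    intro n t
    refine (hu.memHomSobolevOne t).integrable_of_le_majorant (hu.memLp_ut t) (r := t + n) (K := 1)
      ?_ (fun x hx => by rw [weight_eq_zero (hR n) hx, zero_mul]) (Eventually.of_forall fun x => ?_)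
    · exact ((contDiff_weight (hf n) one_pos t).continuous.aemeasurable.mul
        ((hu.memHomSobolevOne t).aemeasurable_energyDensity
          (hu.memLp_ut t))).aestronglyMeasurable
    · rw [abs_of_nonneg (mul_nonneg (h01 n _).1 (energyDensity_nonneg hp x))]
      exact mul_le_mul (h01 n _).2 (energyDensity_le_majorant hp hp' x)
        (energyDensity_nonneg hp x) zero_le_one
  have hfun : ∀ n t, functional p 0 1 (f n) t (u t) (fun i x => Du t x i) (ut t)
      = 1 / 2 * ∫ x, f n (t - rho 1 x) * energyDensity p (u t) (Du t) (ut t) x := by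
    intro n t
    rw [functional, ← integral_const_mul]
    congr 1
    ext x
    rw [density, energyDensity, potential, sq_abs, norm_sq_eq_sum]
    ring
  have hle := lintegral_le_of_weights (a₀ := fun n x => f n (t₀ - rho 1 x))
    (a₁ := fun n x => f n (t₁ - rho 1 x)) (b₀ := fun _ => 1) (b₁ := fun _ => 1)
    (D₀ := energyDensity p (u t₀) (Du t₀) (ut t₀)) (D₁ := energyDensity p (u t₁) (Du t₁) (ut t₁))
    (energyDensity_nonneg hp) (energyDensity_nonneg hp) (fun n => hint n t₀) (fun n => hint n t₁)
    (fun n x => (h01 n _).1) (fun n x => (h01 n _).1)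
    (fun x => tendsto_smoothTransition_add (t₀ - rho 1 x)) (fun n x => (h01 n _).2) fun n => ?_
  · simp only [one_mul] at hle
    exact hle
  · have h1 := hu.functional_le hp hp' 0 one_pos (hf n) (hR n) ht (C := 0) (M := 1) le_rfl
      (by positivity : 0 ≤ B₁ + B₂) (fun t _ x y z w => ?_)
      (fun s _ => by rw [abs_of_nonneg (h01 n s).1]; exact (h01 n s).2)
      (fun t h => (hB₁ t h).trans (ENNReal.ofReal_le_ofReal (by linarith)))
      (fun t h => (hB₂ t h).trans (ENNReal.ofReal_le_ofReal (by linarith)))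
    · rw [hfun, hfun] at h1
      linarith
    · rw [zero_mul, neg_zero]
      exact production_zero_nonneg hp one_pos (deriv_smoothTransition_add_nonneg _ _) y z w

/-- The outward energy, weighted by `1 - exp (-l (t₁ - t + |x|))`, is nondecreasing. -/
lemma IsSolution.lintegral_outwardDensity_le (hu : IsSolution p u Du ut) (hp : 3 ≤ p) (hp' : p ≤ 5)
    {t₀ t₁ : ℝ} (ht : t₀ ≤ t₁) {l : ℝ} (hl : 0 ≤ l) :
    ∫⁻ x, ENNReal.ofReal ((1 - Real.exp (l * (t₀ - ‖x‖ - t₁)))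
        * outwardDensity p (u t₀) (Du t₀) (ut t₀) x)
      ≤ ∫⁻ x, ENNReal.ofReal ((1 - Real.exp (l * (t₁ - ‖x‖ - t₁)))
        * outwardDensity p (u t₁) (Du t₁) (ut t₁) x) := by
  set χ : ℕ → ℝ → ℝ := fun n s => Real.smoothTransition (s + n) with hχdef
  set e : ℝ → ℝ := fun s => 1 - Real.exp (l * (s - t₁)) with hedef
  have hχ : ∀ n, ContDiff ℝ ∞ (χ n) := fun n =>
    smoothTransition_contDiff.comp (contDiff_id.add contDiff_const)
  have he : ContDiff ℝ ∞ e := by fun_prop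
  have hR : ∀ n : ℕ, ∀ s < -(n : ℝ), χ n s * e s = 0 := fun n s hs => by
    rw [hχdef]; simp only; rw [smoothTransition_add_eq_zero n s hs, zero_mul]
  have h01 : ∀ n s, 0 ≤ χ n s ∧ χ n s ≤ 1 := fun n s =>
    ⟨Real.smoothTransition.nonneg _, Real.smoothTransition.le_one _⟩
  have he01 : ∀ s ≤ t₁, 0 ≤ e s ∧ e s ≤ 1 := fun s hs =>
    ⟨sub_nonneg.2 (Real.exp_le_one_iff.2 (mul_nonpos_of_nonneg_of_nonpos hl (by linarith))),
      sub_le_self _ (Real.exp_pos _).le⟩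
  have hf : ∀ n, ContDiff ℝ ∞ fun s => χ n s * e s := fun n => (hχ n).mul he
  have hint : ∀ n, ∀ t ≤ t₁, Integrable fun x =>
      χ n (t - ‖x‖) * e (t - ‖x‖) * outwardDensity p (u t) (Du t) (ut t) x := by
    intro n t htt
    refine (hu.memHomSobolevOne t).integrable_of_le_majorant (hu.memLp_ut t) (r := t + n) (K := 1)
      ?_ (fun x hx => by rw [hR n _ (by linarith), zero_mul]) ?_
    · exact (((hf n).continuous.comp
        (continuous_const.sub continuous_norm)).aemeasurable.mul
        ((hu.memHomSobolevOne t).aemeasurable_outwardDensity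
          (hu.memLp_ut t))).aestronglyMeasurable
    · filter_upwards [ae_norm_ne_zero] with x hx
      have hs : t - ‖x‖ ≤ t₁ := by linarith [norm_nonneg x]
      rw [abs_of_nonneg (mul_nonneg (mul_nonneg (h01 n _).1 (he01 _ hs).1)
        (outwardDensity_nonneg hp x))]
      exact mul_le_mul (mul_le_one₀ (h01 n _).2 (he01 _ hs).1 (he01 _ hs).2)
        (outwardDensity_le_majorant hp hp' hx) (outwardDensity_nonneg hp x) zero_le_one
  have hs : ∀ t ≤ t₁, ∀ x : Space, t - ‖x‖ ≤ t₁ := fun t htt x => by linarith [norm_nonneg x]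
  refine lintegral_le_of_weights (a₀ := fun n x => χ n (t₀ - ‖x‖) * e (t₀ - ‖x‖))
    (a₁ := fun n x => χ n (t₁ - ‖x‖) * e (t₁ - ‖x‖))
    (outwardDensity_nonneg hp) (outwardDensity_nonneg hp) (fun n => hint n t₀ ht)
    (fun n => hint n t₁ le_rfl)
    (fun n x => mul_nonneg (h01 n _).1 (he01 _ (hs _ ht x)).1)
    (fun n x => mul_nonneg (h01 n _).1 (he01 _ (hs _ le_rfl x)).1)
    (fun x => ?_) (fun n x => ?_) fun n => ?_
  · have := (tendsto_smoothTransition_add (t₀ - ‖x‖)).mul_const (e (t₀ - ‖x‖))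
    rwa [one_mul] at this
  · exact mul_le_of_le_one_left (he01 _ (hs _ le_rfl x)).1 (h01 n _).2
  · refine hu.integral_outwardDensity_le hp hp' (f := fun s => χ n s * e s) (hf n) (hR n) ht
      (fun s h => mul_nonneg (h01 n s).1 (he01 s h).1) fun s r hr hsr => ?_
    have d1 : HasDerivAt e (-(l * Real.exp (l * (s - t₁)))) s := by
      have := ((((hasDerivAt_id s).sub_const t₁).const_mul l).exp).const_sub 1
      refine this.congr_deriv ?_
      simp; ring
    have d2 := (((hχ n).differentiable (by simp)) s).hasDerivAt
    have d3 : deriv (fun s => χ n s * e s) s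
        = deriv (χ n) s * e s + χ n s * -(l * Real.exp (l * (s - t₁))) := (d2.mul d1).deriv
    rw [d3]
    have h1 : 0 ≤ deriv (χ n) s := deriv_smoothTransition_add_nonneg _ _
    have h2 := (he01 s (by linarith)).1
    -- concavity of `e` gives `e s + e' s (t₁ - s) ≥ e t₁ = 0`
    have h3 : 0 ≤ e s - l * Real.exp (l * (s - t₁)) * r := by
      have h4 := Real.add_one_le_exp (l * (t₁ - s))
      have h5 : Real.exp (l * (s - t₁)) * Real.exp (l * (t₁ - s)) = 1 := by
        rw [← Real.exp_add]; ring_nf; simp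
      have h6 := Real.exp_pos (l * (s - t₁))
      have h7 := mul_le_mul_of_nonneg_left h4 h6.le
      have h8 : l * Real.exp (l * (s - t₁)) * r ≤ l * Real.exp (l * (s - t₁)) * (t₁ - s) := by
        gcongr; linarith
      simp only [hedef]
      nlinarith
    have h9 := mul_nonneg (h01 n s).1 h3
    have h10 := mul_nonneg (mul_nonneg h1 h2) hr.le
    nlinarith

end

/-! ### Time reversal and conclusion -/

section

variable {p : ℝ} {u : ℝ → Space → ℝ} {Du : ℝ → Space → Space} {ut : ℝ → Space → ℝ}

/-- The equation is invariant under reversal of time. -/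
lemma IsSolution.reverse (hu : IsSolution p u Du ut) :
    IsSolution p (fun t => u (-t)) (fun t => Du (-t)) (fun t => -ut (-t)) where
  memHomSobolevOne t := hu.memHomSobolevOne (-t)
  memLp_ut t := (hu.memLp_ut (-t)).neg
  continuous_Du t := (hu.continuous_Du (-t)).comp (continuous_neg.tendsto t)
  continuous_ut t := by
    refine ((hu.continuous_ut (-t)).comp (continuous_neg.tendsto t)).congr fun s => ?_
    rw [Function.comp_apply, ← eLpNorm_neg]
    congr 1
    abel
  spaceTimeNorm_lt_top a b := by
    have h1 : MeasurePreserving (fun t : ℝ => -t) (volume.restrict (Icc a b))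
        (volume.restrict (Icc (-b) (-a))) := by
      have := (Measure.measurePreserving_neg (volume : Measure ℝ)).restrict_preimage
        (measurableSet_Icc (a := -b) (b := -a))
      simpa using this
    have h2 := hu.spaceTimeNorm_lt_top (-b) (-a)
    rw [← h1.map_eq, show (fun t : ℝ => -t) = Homeomorph.neg ℝ from rfl,
      (Homeomorph.neg ℝ).measurableEmbedding.eLpNorm_map_measure] at h2
    exact h2
  hasDerivAt_u ψ hψ hc t := by
    refine ((hu.hasDerivAt_u ψ hψ hc (-t)).scomp t (hasDerivAt_neg t)).congr_deriv ?_
    simp [integral_neg]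
  hasDerivAt_ut ψ hψ hc t := by
    have h := ((hu.hasDerivAt_ut ψ hψ hc (-t)).scomp t (hasDerivAt_neg t)).neg
    refine (h.congr_deriv ?_).congr_of_eventuallyEq (Eventually.of_forall fun s => ?_)
    · simp [sub_eq_add_neg]
    · simp [integral_neg]

/-- By time reversal the energy does not increase either. -/
lemma IsSolution.energy_le_energy_zero (hu : IsSolution p u Du ut) (hp : 3 ≤ p) (hp' : p ≤ 5)
    {t : ℝ} (ht : 0 ≤ t) : energy p (u t) (Du t) (ut t) ≤ energy p (u 0) (Du 0) (ut 0) := by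
  have h := hu.reverse.energy_le hp hp' (neg_nonpos.2 ht)
  simpa [energy] using h

/-- The outward energy lost between two times dominates the outward energy near the origin: the
weight `1 - exp (-l |x|)` is smaller than `1` by at least `exp (-l r)` in the ball of radius `r`. -/
lemma IsSolution.outwardEnergy_add_le (hu : IsSolution p u Du ut) (hp : 3 ≤ p) (hp' : p ≤ 5)
    {t₀ t₁ : ℝ} (ht : t₀ ≤ t₁) {l : ℝ} (hl : 0 ≤ l) (r : ℝ) :
    ENNReal.ofReal (1 - Real.exp (l * (t₀ - t₁))) * outwardEnergy p (u t₀) (Du t₀) (ut t₀) univ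
      + ENNReal.ofReal (Real.exp (-(l * r)))
        * outwardEnergy p (u t₁) (Du t₁) (ut t₁) (annulus 0 r)
      ≤ outwardEnergy p (u t₁) (Du t₁) (ut t₁) univ := by
  set D₀ := outwardDensity p (u t₀) (Du t₀) (ut t₀)
  set D₁ := outwardDensity p (u t₁) (Du t₁) (ut t₁)
  have hD₁ : AEMeasurable D₁ :=
    (hu.memHomSobolevOne t₁).aemeasurable_outwardDensity (hu.memLp_ut t₁)
  have hA : MeasurableSet (annulus 0 r) :=
    (measurableSet_lt measurable_const measurable_norm).inter
      (measurableSet_lt measurable_norm measurable_const)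
  have h1 : ENNReal.ofReal (1 - Real.exp (l * (t₀ - t₁)))
      * outwardEnergy p (u t₀) (Du t₀) (ut t₀) univ
      ≤ ∫⁻ x, ENNReal.ofReal ((1 - Real.exp (l * (t₀ - ‖x‖ - t₁))) * D₀ x) := by
    rw [outwardEnergy, Measure.restrict_univ, ← lintegral_const_mul' _ _ ENNReal.ofReal_ne_top]
    refine lintegral_mono fun x => ?_
    rw [← ENNReal.ofReal_mul (sub_nonneg.2 (Real.exp_le_one_iff.2
      (mul_nonpos_of_nonneg_of_nonpos hl (by linarith))))]
    refine ENNReal.ofReal_le_ofReal (mul_le_mul_of_nonneg_right ?_ (outwardDensity_nonneg hp x))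
    have : l * (t₀ - ‖x‖ - t₁) ≤ l * (t₀ - t₁) := by
      gcongr; linarith [norm_nonneg x]
    linarith [Real.exp_le_exp.2 this]
  have h2 := hu.lintegral_outwardDensity_le hp hp' ht hl
  have h3 : ENNReal.ofReal (Real.exp (-(l * r)))
      * outwardEnergy p (u t₁) (Du t₁) (ut t₁) (annulus 0 r)
      = ∫⁻ x, (annulus 0 r).indicator
        (fun x => ENNReal.ofReal (Real.exp (-(l * r)) * D₁ x)) x := by
    rw [lintegral_indicator hA, outwardEnergy, ← lintegral_const_mul' _ _ ENNReal.ofReal_ne_top]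
    refine lintegral_congr fun x => ?_
    rw [ENNReal.ofReal_mul (Real.exp_pos _).le]
    rfl
  rw [h3]
  refine (add_le_add_left (h1.trans h2) _).trans ?_
  rw [← lintegral_add_right' _
    ((hD₁.const_mul _).ennreal_ofReal.indicator hA), outwardEnergy, Measure.restrict_univ]
  refine lintegral_mono fun x => ?_
  have hD := outwardDensity_nonneg (v := u t₁) (g := Du t₁) (k := ut t₁) hp x
  have hx : l * (t₁ - ‖x‖ - t₁) = -(l * ‖x‖) := by ring
  have hx1 : Real.exp (-(l * ‖x‖)) ≤ 1 :=
    Real.exp_le_one_iff.2 (neg_nonpos.2 (mul_nonneg hl (norm_nonneg x)))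
  simp only [hx]
  by_cases hxA : x ∈ annulus 0 r
  · rw [indicator_of_mem hxA, ← ENNReal.ofReal_add (mul_nonneg (by linarith) hD)
      (mul_nonneg (Real.exp_pos _).le hD), ← add_mul]
    refine ENNReal.ofReal_le_ofReal (mul_le_of_le_one_left hD ?_)
    have : Real.exp (-(l * r)) ≤ Real.exp (-(l * ‖x‖)) :=
      Real.exp_le_exp.2 (neg_le_neg (mul_le_mul_of_nonneg_left hxA.2.le hl))
    linarith
  · rw [indicator_of_notMem hxA, add_zero]
    exact ENNReal.ofReal_le_ofReal (mul_le_of_le_one_left hD (by linarith [Real.exp_pos (-(l * ‖x‖))]))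

/-- The outward energy leaves every cone `|x| < c t` with `c < 1` as `t → ∞`. -/
lemma IsSolution.tendsto_outwardEnergy (hu : IsSolution p u Du ut) (hp : 3 ≤ p) (hp' : p ≤ 5)
    (hE : energy p (u 0) (Du 0) (ut 0) < ⊤) {c : ℝ} (hc : c < 1) :
    Tendsto (fun t : ℝ => outwardEnergy p (u t) (Du t) (ut t) (annulus 0 (c * |t|))) atTop
      (𝓝 0) := by
  set G : ℝ → ℝ≥0∞ := fun t => outwardEnergy p (u t) (Du t) (ut t) univ with hG
  set A : ℝ → ℝ≥0∞ := fun t => outwardEnergy p (u t) (Du t) (ut t) (annulus 0 (c * |t|)) with hA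
  have hAG : ∀ t, A t ≤ G t := fun t => lintegral_mono_set (subset_univ _)
  have hGb : ∀ t, 0 ≤ t → G t ≤ 10 * energy p (u 0) (Du 0) (ut 0) := fun t ht =>
    ((hu.memHomSobolevOne t).outwardEnergy_le (hu.memLp_ut t) hp).trans
      (by gcongr; exact hu.energy_le_energy_zero hp hp' ht)
  have hEt : 10 * energy p (u 0) (Du 0) (ut 0) ≠ ⊤ := ENNReal.mul_ne_top (by norm_num) hE.ne
  have hGt : ∀ t, 0 ≤ t → G t ≠ ⊤ := fun t ht => ne_top_of_le_ne_top hEt (hGb t ht)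
  -- the supremum `S` of the outward energy at positive times
  set s : Set ℝ := (fun t => (G t).toReal) '' Ici 0 with hs
  have hbdd : BddAbove s := by
    refine ⟨(10 * energy p (u 0) (Du 0) (ut 0)).toReal, ?_⟩
    rintro _ ⟨t, ht, rfl⟩
    exact ENNReal.toReal_mono hEt (hGb t ht)
  have hne : s.Nonempty := ⟨_, 0, self_mem_Ici, rfl⟩
  set S := sSup s with hS
  have hGS : ∀ t, 0 ≤ t → (G t).toReal ≤ S := fun t ht => le_csSup hbdd ⟨t, ht, rfl⟩
  have hS0 : 0 ≤ S := ENNReal.toReal_nonneg.trans (hGS 0 le_rfl)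
  have hreal : ∀ t₀ t₁, 0 ≤ t₀ → t₀ ≤ t₁ → 0 < t₁ → ∀ K, 0 ≤ K →
      (1 - Real.exp (-(K * (1 - t₀ / t₁)))) * (G t₀).toReal + Real.exp (-(K * c)) * (A t₁).toReal
        ≤ S := by
    intro t₀ t₁ h0 h01 h1 K hK
    have h2 := hu.outwardEnergy_add_le hp hp' h01 (div_nonneg hK h1.le) (c * |t₁|)
    have e1 : K / t₁ * (t₀ - t₁) = -(K * (1 - t₀ / t₁)) := by field_simp; ring
    have e2 : K / t₁ * (c * |t₁|) = K * c := by rw [abs_of_pos h1]; field_simp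
    rw [e1, e2] at h2
    have h3 : 0 ≤ 1 - Real.exp (-(K * (1 - t₀ / t₁))) := by
      have : t₀ / t₁ ≤ 1 := (div_le_one h1).2 h01
      exact sub_nonneg.2 (Real.exp_le_one_iff.2 (neg_nonpos.2 (mul_nonneg hK (by linarith))))
    have h4 := ENNReal.toReal_mono (hGt t₁ h1.le) h2
    have hG0 := hGt t₀ h0
    have hA1 : A t₁ ≠ ⊤ := ne_top_of_le_ne_top (hGt t₁ h1.le) (hAG t₁)
    rw [ENNReal.toReal_add (ENNReal.mul_ne_top ENNReal.ofReal_ne_top hG0)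
      (ENNReal.mul_ne_top ENNReal.ofReal_ne_top hA1), ENNReal.toReal_mul, ENNReal.toReal_mul,
      ENNReal.toReal_ofReal h3, ENNReal.toReal_ofReal (Real.exp_pos _).le] at h4
    exact h4.trans (hGS t₁ h1.le)
  have hlim : Tendsto (fun t => (A t).toReal) atTop (𝓝 0) := by
    rw [Metric.tendsto_atTop]
    intro ε hε
    -- `K` makes the loss of weight between the two times small, relative to `exp (-K c)`
    obtain ⟨K, hK0, hK⟩ : ∃ K, 0 ≤ K ∧ S * Real.exp (-(K * ((1 - c) / 2))) < ε / 2 := by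
      have h1 : Tendsto (fun K : ℝ => S * Real.exp (-(K * ((1 - c) / 2)))) atTop (𝓝 (S * 0)) :=
        ((Real.tendsto_exp_neg_atTop_nhds_zero).comp
          (tendsto_id.atTop_mul_const (by linarith : 0 < (1 - c) / 2))).const_mul S
      rw [mul_zero] at h1
      exact ((eventually_ge_atTop 0).and (h1.eventually_lt_const (by positivity))).exists
    obtain ⟨_, ⟨T, hT, rfl⟩, hTS⟩ := exists_lt_of_lt_csSup hne
      (show S - Real.exp (-(K * c)) * (ε / 2) < sSup s from
        sub_lt_self _ (by have := Real.exp_pos (-(K * c)); positivity))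
    have hT0 : 0 ≤ T := hT
    refine ⟨max (T + 1) (2 * T / (1 - c)), fun t ht => ?_⟩
    have ht1 : T + 1 ≤ t := (le_max_left _ _).trans ht
    have ht2 : 2 * T / (1 - c) ≤ t := (le_max_right _ _).trans ht
    have htpos : 0 < t := by linarith
    have h1 := hreal T t hT0 (by linarith) htpos K hK0
    have h2 : T / t ≤ (1 - c) / 2 := by
      rw [div_le_iff₀ (by linarith)] at ht2
      rw [div_le_iff₀ htpos]
      linarith
    have h3 : Real.exp (-(K * (1 - T / t))) ≤ Real.exp (-(K * c)) * Real.exp (-(K * ((1 - c) / 2))) := by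
      rw [← Real.exp_add]
      refine Real.exp_le_exp.2 ?_
      nlinarith [mul_le_mul_of_nonneg_left h2 hK0]
    have h4 := hGS T hT0
    have h5 := Real.exp_pos (-(K * c))
    have h6 : Real.exp (-(K * (1 - T / t))) * (G T).toReal
        ≤ Real.exp (-(K * c)) * (S * Real.exp (-(K * ((1 - c) / 2)))) := by
      calc _ ≤ Real.exp (-(K * c)) * Real.exp (-(K * ((1 - c) / 2))) * S :=
            mul_le_mul h3 h4 ENNReal.toReal_nonneg (by positivity)
        _ = _ := by ring
    have h7 := mul_lt_mul_of_pos_left hK h5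
    have h8 : Real.exp (-(K * c)) * (A t).toReal < Real.exp (-(K * c)) * ε := by
      simp only at hTS
      linarith
    rw [Real.dist_eq, sub_zero, abs_of_nonneg ENNReal.toReal_nonneg]
    exact lt_of_mul_lt_mul_left h8 h5.le
  have h1 := ENNReal.tendsto_ofReal hlim
  rw [ENNReal.ofReal_zero] at h1
  refine h1.congr' ?_
  filter_upwards [eventually_ge_atTop 0] with t ht
  exact ENNReal.ofReal_toReal (ne_top_of_le_ne_top (hGt t ht) (hAG t))

end

end

end SemilinearWave

theorem mainTheorem6 (p : ℝ) (hp₃ : 3 ≤ p) (hp₅ : p ≤ 5)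
    (u : ℝ → SemilinearWave.Space → ℝ)
    (Du : ℝ → SemilinearWave.Space → SemilinearWave.Space)
    (ut : ℝ → SemilinearWave.Space → ℝ)
    (hu : SemilinearWave.IsSolution p u Du ut)
    (hE : SemilinearWave.energy p (u 0) (Du 0) (ut 0) < ⊤)
    (c : ℝ) (hc : c ∈ Ioo (0 : ℝ) 1) :
    Tendsto (fun t : ℝ => SemilinearWave.outwardEnergy p (u t) (Du t) (ut t)
        (SemilinearWave.annulus 0 (c * |t|))) atTop (𝓝 0) ∧
    Tendsto (fun t : ℝ => SemilinearWave.inwardEnergy p (u t) (Du t) (ut t)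
        (SemilinearWave.annulus 0 (c * |t|))) atBot (𝓝 0) := by
  refine ⟨hu.tendsto_outwardEnergy hp₃ hp₅ hE hc.2, ?_⟩
  have hE' : SemilinearWave.energy p (u (-0)) (Du (-0)) (-ut (-0)) < ⊤ := by
    simpa [SemilinearWave.energy] using hE
  have h := (hu.reverse.tendsto_outwardEnergy hp₃ hp₅ hE' hc.2).comp tendsto_neg_atBot_atTop
  refine h.congr fun t => ?_
  simp [SemilinearWave.outwardEnergy, SemilinearWave.inwardEnergy, SemilinearWave.Lminus,
    SemilinearWave.Lplus]
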